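/- **Setting.** Let $d\in\{1,2,3\}$ and let $D\subset\mathbb R^d$ be bounded and open. Let $\mathcal H=H^1_0(D)^d$ with norm $\|u\|_{\mathcal H}=(\int_D|\nabla u|_F^2)^{1/2}$, let $\mathcal H^*$ be its dual with the dual norm, and let $\mathcal L=\{q\in L^2(D):\int_D q=0\}$ with the $L^2$-norm. Let $C_4>0$ satisfy $\|u\|_{L^4(D)}\le C_4\|\nabla u\|_{L^2(D)}$ for all scalar $u\in H^1_0(D)$. The space $L^\infty(D)^{d\times d}$ carries the norm $\operatorname{ess\,sup}_x|A(x)|_F$. For $A,B,M\in L^\infty(D)^{d\times d}$ put $$a(u,v;A)=\int_D\operatorname{tr}(\nabla u^\top A^\top\nabla v),\quad b(v,p;B)=-\int_D\operatorname{tr}(\nabla v\,B\,p),\quad m(u,v,w;M)=\int_D(\nabla v\,M\,u)^\top w ,$$ where $(\nabla v)_{ij}=\partial v_i/\partial x_j$ in $b$ and $m$; in $a$ either this convention or the transposed one is fixed. Let $U\subseteq\mathbb R^{I}$ be a parameter set, where $I$ is a finite or infinite index set, $\mathbb R^I$ has the product topology, and every section of $U$ in a coordinate direction accumulates at each of its points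 (for example $U$ open, or $U=[-\frac12,\frac12]^I$). Partial derivatives are taken along these sections, one-sided at end points. For a finitely supported multi-index $\nu$, $\partial^\nu$ takes $\nu_j$ derivatives in $y_j$ for each $j$, and bounds on $\partial^\nu$ are understood for every order of differentiation. A map $\phi$ from $U$ to a normed space is of class Gevrey-$\delta$ if all its iterated partial derivatives exist and are continuous on $U$, and each $y_0\in U$ has a neighbourhood in $U$ on which $\|\partial^\nu\phi(y)\|\le C(|\nu|!)^\delta/R^\nu$ for all $\nu$, with some $C>0$ and some positive sequence $R=(R_j)$. **Assumptions.** Let $\delta\ge1$, let $\overline a,\overline b,\overline m,\alpha,\beta>0$ and $\overline f,\overline g\in\mathbb R$, and let $R=(R_j)$ be a positive sequence. Let $A,B,M:U\to L^\infty(D)^{d\times d}$, $f:U\to\mathcal H^*$, $g:U\to\mathcal L$ be maps such that: 1. For every $y\in U$ and a.e. $x\in D$ the matrices $A,B,M$ are non-singular and $A$ is symmetric. 2. For all $y\in U$ and $u\in\mathcal H$: $\alpha\|u\|_{\mathcal H}^2\le a(u,u;A(y))$. For all $y\in U$: $\beta\le\inf_{0\ne p\in\mathcal L}\sup_{0\ne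 u\in\mathcal H}\dfrac{b(u,p;B(y))}{\|u\|_{\mathcal H}\|p\|_{\mathcal L}}$. 3. $A,B,M,f,g$ have continuous partial derivatives of all orders on $U$, and for all $y\in U$ and all $\nu$ (including $\nu=0$) $$\max\Big\{\frac{\|\partial^\nu A(y)\|_{L^\infty}}{\overline a},\frac{\|\partial^\nu B(y)\|_{L^\infty}}{\overline b},\frac{\|\partial^\nu M(y)\|_{L^\infty}}{C_4^{-2}\overline m}\Big\}\le\frac12\frac{(|\nu|!)^\delta}{(2R)^\nu},$$ $$\|\partial^\nu f(y)\|_{\mathcal H^*}\le\frac{\overline f}2\frac{(|\nu|!)^\delta}{(2R)^\nu},\qquad\|\partial^\nu g(y)\|_{\mathcal L}\le\frac{\overline g}2\frac{(|\nu|!)^\delta}{(2R)^\nu}.$$ 4. (Small data) $\dfrac{\overline f}{\alpha}+\dfrac{\overline g}{\beta}<\dfrac{\alpha}{\overline m}$. Let $\gamma=\frac{\alpha}{\overline m}\Big(1-\sqrt{1-\frac{\overline m}{\alpha}\big(\frac{\overline f}{\alpha}+\frac{\overline g}{\beta}\big)}\Big)$. By *the solution at $y\in U$* we mean the pair $(u,p)\in\mathcal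 H\times\mathcal L$ with $\|u\|_{\mathcal H}\le\gamma$ such that for all $v\in\mathcal H$ and $q\in\mathcal L$ $$a(u,v;A(y))+m(u,u,v;M(y))-b(v,p;B(y))=\langle f(y),v\rangle,\qquad b(u,q;B(y))=\langle g(y),q\rangle_{\mathcal L}.$$ **Theorem.** (i) For each $y\in U$ there is at most one such pair. (ii) Such a pair exists at every $y\in U$ for which there is $w\in\mathcal H$ with $\|w\|_{\mathcal H}\le\overline g/(2\beta)$, $b(w,q;B(y))=\langle g(y),q\rangle_{\mathcal L}$ for all $q\in\mathcal L$, and $a(w,v;A(y))=0$ for all $v\in\mathcal H$ satisfying $b(v,\cdot\,;B(y))=0$ (in particular, whenever $g(y)=0$). (iii) There are constants $\widetilde C_u,\widetilde C_p>0$ and a positive sequence $\widetilde R$ such that, if $(u(y),p(y))$ is the solution at $y$ for every $y\in U$, then $u$ and $p$ are of class Gevrey-$\delta$ on $U$, and for all $y\in U$ and all finitely supported $\nu$ $$\|\partial^\nu u(y)\|_{\mathcal H}\le\frac{\widetilde C_u(|\nu|!)^\delta}{\widetilde R^\nu},\qquad\|\partial^\nu p(y)\|_{\mathcal L}\le\frac{\widetilde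 C_p(|\nu|!)^\delta}{\widetilde R^\nu}.$$ If moreover $\delta=1$, $I$ is finite and $U$ is open, then $u$ and $p$ are real analytic on $U$. -/

import Mathlib

open MeasureTheory Set Filter Topology
open scoped ContDiff ENNReal

/-! ### The physical domain and the function spaces -/

/-- `ℝᵏ` with the Euclidean norm. -/
abbrev Vec (k : ℕ) : Type := EuclideanSpace ℝ (Fin k)

/-- Real `k × d` matrices with the Frobenius norm. -/
abbrev Mat (k d : ℕ) : Type := EuclideanSpace ℝ (Fin k × Fin d)

/-- The underlying matrix. -/
def Mat.toMatrix {k d : ℕ} (a : Mat k d) : Matrix (Fin k) (Fin d) ℝ :=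
  Matrix.of fun i j => a (i, j)

/-- A bounded open set `D ⊆ ℝᵈ`, `d ∈ {1, 2, 3}`. -/
structure PhysDomain (d : ℕ) where
  carrier : Set (Vec d)
  isOpen : IsOpen carrier
  isBounded : Bornology.IsBounded carrier
  dim : d = 1 ∨ d = 2 ∨ d = 3

/-- Lebesgue measure on `D`. -/
noncomputable def PhysDomain.vol {d : ℕ} (D : PhysDomain d) : Measure (Vec d) :=
  volume.restrict D.carrier

instance {d : ℕ} (D : PhysDomain d) : IsFiniteMeasure D.vol := by
  unfold PhysDomain.vol
  exact ⟨by simpa using D.isBounded.measure_lt_top⟩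

/-- The Jacobian field of `φ : ℝᵈ → ℝᵏ`: its `(i, j)` entry is `∂φᵢ/∂xⱼ`. -/
noncomputable def jacobian {k d : ℕ} (φ : Vec d → Vec k) (x : Vec d) : Mat k d :=
  WithLp.toLp 2 fun ij => fderiv ℝ φ x (EuclideanSpace.single ij.2 1) ij.1

/-- Test fields: `φ ∈ C_c^∞(D; ℝᵏ)`. -/
def IsTestField {d : ℕ} (D : PhysDomain d) {k : ℕ} (φ : Vec d → Vec k) : Prop :=
  ContDiff ℝ ∞ φ ∧ HasCompactSupport φ ∧ tsupport φ ⊆ D.carrier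

/-- The pairs `(φ, ∇φ)` with `φ ∈ C_c^∞(D; ℝᵏ)`, inside `L²(D; ℝᵏ) × L²(D; ℝᵏˣᵈ)`. -/
def testPairs {d : ℕ} (D : PhysDomain d) (k : ℕ) :
    Submodule ℝ (Lp (Vec k) 2 D.vol × Lp (Mat k d) 2 D.vol) where
  carrier := {w | ∃ φ : Vec d → Vec k, IsTestField D φ ∧
    w.1 =ᵐ[D.vol] φ ∧ w.2 =ᵐ[D.vol] jacobian φ}
  zero_mem' := by
    refine ⟨0, ⟨contDiff_const, HasCompactSupport.zero, by simp [tsupport]⟩,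
      Lp.coeFn_zero _ _ _, (Lp.coeFn_zero _ _ _).trans (.of_forall fun x => ?_)⟩
    ext ij
    simp [jacobian]
  add_mem' := by
    rintro v w ⟨φ, ⟨hφ, hφc, hφs⟩, h1, h2⟩ ⟨ψ, ⟨hψ, hψc, hψs⟩, h3, h4⟩
    refine ⟨φ + ψ, ⟨hφ.add hψ, hφc.add hψc,
      (tsupport_add φ ψ).trans (union_subset hφs hψs)⟩, ?_, ?_⟩
    · filter_upwards [Lp.coeFn_add v.1 w.1, h1, h3] with x a b c
      rw [Prod.fst_add, a, Pi.add_apply, b, c, Pi.add_apply]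
    · filter_upwards [Lp.coeFn_add v.2 w.2, h2, h4] with x a b c
      have e1 : DifferentiableAt ℝ φ x := (hφ.differentiable (by simp)) x
      have e2 : DifferentiableAt ℝ ψ x := (hψ.differentiable (by simp)) x
      rw [Prod.snd_add, a, Pi.add_apply, b, c]
      ext ij
      simp [jacobian, fderiv_add e1 e2]
  smul_mem' := by
    rintro c v ⟨φ, ⟨hφ, hφc, hφs⟩, h1, h2⟩
    refine ⟨c • φ, ⟨contDiff_const.smul hφ, hφc.smul_left (f := fun _ => c),
      (closure_mono (Function.support_const_smul_subset c φ)).trans hφs⟩, ?_, ?_⟩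
    · filter_upwards [Lp.coeFn_smul c v.1, h1] with x a b
      rw [Prod.smul_fst, a, Pi.smul_apply, b, Pi.smul_apply]
    · filter_upwards [Lp.coeFn_smul c v.2, h2] with x a b
      have e1 : DifferentiableAt ℝ φ x := (hφ.differentiable (by simp)) x
      rw [Prod.smul_snd, a, Pi.smul_apply, b]
      ext ij
      simp [jacobian, fderiv_const_smul e1 c]

/-- `H¹₀(D)ᵏ`: the closure of `C_c^∞(D; ℝᵏ)` in `H¹(D)ᵏ`, an element being the pair `(u, ∇u)`. -/
def H10 {d : ℕ} (D : PhysDomain d) (k : ℕ) : Type := ↥(testPairs D k).topologicalClosure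

noncomputable instance {d : ℕ} (D : PhysDomain d) (k : ℕ) : AddCommGroup (H10 D k) :=
  inferInstanceAs (AddCommGroup ↥(testPairs D k).topologicalClosure)

noncomputable instance {d : ℕ} (D : PhysDomain d) (k : ℕ) : Module ℝ (H10 D k) :=
  inferInstanceAs (Module ℝ ↥(testPairs D k).topologicalClosure)

/-- The function `u ∈ L²(D; ℝᵏ)` itself. -/
noncomputable def H10.val {d : ℕ} {D : PhysDomain d} {k : ℕ} :
    H10 D k →ₗ[ℝ] Lp (Vec k) 2 D.vol :=
  (LinearMap.fst ℝ _ _).comp (testPairs D k).topologicalClosure.subtype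

/-- The gradient `∇u ∈ L²(D; ℝᵏˣᵈ)`, with entries `(∇u)ᵢⱼ = ∂uᵢ/∂xⱼ`. -/
noncomputable def H10.grad {d : ℕ} {D : PhysDomain d} {k : ℕ} :
    H10 D k →ₗ[ℝ] Lp (Mat k d) 2 D.vol :=
  (LinearMap.snd ℝ _ _).comp (testPairs D k).topologicalClosure.subtype

set_option maxHeartbeats 400000 in
/-- Poincaré's inequality for test fields. -/
theorem poincare_test {d : ℕ} (D : PhysDomain d) {k : ℕ} {R : ℝ} (_hR : 0 ≤ R)
    (hD : ∀ x ∈ D.carrier, ‖x‖ ≤ R) {φ : Vec d → Vec k} (h : IsTestField D φ) :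
    ∫ x, ‖φ x‖ ^ 2 ∂D.vol ≤ 4 * R ^ 2 * ∫ x, ‖jacobian φ x‖ ^ 2 ∂D.vol := by
  obtain ⟨hφ, hc, hs⟩ := h
  have hd : 0 < d := by rcases D.dim with h | h | h <;> omega
  set i0 : Fin d := ⟨0, hd⟩
  set v0 : Vec d := EuclideanSpace.single i0 1
  have hdiff : Differentiable ℝ φ := hφ.differentiable (by simp)
  have hz : ∀ x, x ∉ D.carrier → φ x = 0 := fun x hx =>
    image_eq_zero_of_notMem_tsupport fun h' => hx (hs h')
  have hdz : ∀ x, x ∉ D.carrier → fderiv ℝ φ x = 0 := fun x hx =>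
    image_eq_zero_of_notMem_tsupport fun h' => hx (hs (tsupport_fderiv_subset ℝ h'))
  have hfc : Continuous (fderiv ℝ φ) := hφ.continuous_fderiv (by simp)
  have hfs : HasCompactSupport (fderiv ℝ φ) := hc.fderiv ℝ
  have hjc : Continuous (jacobian φ) := by
    unfold jacobian
    fun_prop
  have hjs : HasCompactSupport (jacobian φ) := by
    refine hfs.mono' (Function.support_subset_iff'.2 (fun x hx => ?_) |>.trans subset_rfl)
    have : fderiv ℝ φ x = 0 := image_eq_zero_of_notMem_tsupport hx
    ext ij
    simp [jacobian, this]
  have e1 : ∫ x, ‖φ x‖ ^ 2 ∂D.vol = ∫ x, ‖φ x‖ ^ 2 := by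
    unfold PhysDomain.vol
    exact setIntegral_eq_integral_of_forall_compl_eq_zero fun x hx => by simp [hz x hx]
  have e2 : ∫ x, ‖jacobian φ x‖ ^ 2 ∂D.vol = ∫ x, ‖jacobian φ x‖ ^ 2 := by
    unfold PhysDomain.vol
    refine setIntegral_eq_integral_of_forall_compl_eq_zero fun x hx => ?_
    have : jacobian φ x = 0 := by
      ext ij
      simp [jacobian, hdz x hx]
    simp [this]
  rw [e1, e2]
  have hcs : HasCompactSupport (fun x => ‖φ x‖ ^ 2) := by
    refine hc.mono fun x hx => ?_
    contrapose! hx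
    simp only [Function.mem_support, not_not] at hx ⊢
    simp [hx]
  have hjcs : HasCompactSupport (fun x => ‖jacobian φ x‖ ^ 2) := by
    refine hjs.mono fun x hx => ?_
    contrapose! hx
    simp only [Function.mem_support, not_not] at hx ⊢
    simp [hx]
  have hn1 : Continuous (fun x => ‖φ x‖ ^ 2) := hφ.continuous.norm.pow 2
  have hn2 : Continuous (fun x => ‖jacobian φ x‖ ^ 2) := hjc.norm.pow 2
  have i1 : Integrable (fun x => ‖φ x‖ ^ 2) := hn1.integrable_of_hasCompactSupport hcs
  have i2 : Integrable (fun x => ‖jacobian φ x‖ ^ 2) := hn2.integrable_of_hasCompactSupport hjcs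
  have hfd : ∀ x, fderiv ℝ (fun x => ‖φ x‖ ^ 2) x v0 = 2 * inner ℝ (φ x) (fderiv ℝ φ x v0) := by
    intro x
    have := ((hdiff x).hasFDerivAt.norm_sq).fderiv
    rw [this]
    simp
  have hg : ∀ x : Vec d, fderiv ℝ (fun x : Vec d => x i0) x v0 = 1 := by
    intro x
    have : (fun x : Vec d => x i0) = (EuclideanSpace.proj i0 : Vec d →L[ℝ] ℝ) := by
      ext; simp
    rw [this, ContinuousLinearMap.fderiv]
    simp [v0]
  have hgd : Differentiable ℝ (fun x : Vec d => x i0) := by fun_prop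
  have hgc : Continuous (fun x : Vec d => x i0) := by fun_prop
  have hic : Continuous (fun x => 2 * inner ℝ (φ x) (fderiv ℝ φ x v0) * x i0) := by
    have := hφ.continuous
    fun_prop
  have hii : Integrable (fun x => 2 * inner ℝ (φ x) (fderiv ℝ φ x v0) * x i0) := by
    refine hic.integrable_of_hasCompactSupport (hc.mono fun x hx => ?_)
    contrapose! hx
    simp only [Function.mem_support, not_not] at hx ⊢
    simp [hx]
  have key := integral_mul_fderiv_eq_neg_fderiv_mul_of_integrable (μ := (volume : Measure (Vec d)))
    (f := fun x => ‖φ x‖ ^ 2) (g := fun x : Vec d => x i0) (v := v0)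
    (by simpa only [hfd] using hii) (by simpa only [hg, mul_one] using i1)
    ((hn1.mul hgc).integrable_of_hasCompactSupport hcs.mul_right)
    (fun x _ => (hdiff x).norm_sq ℝ) (fun x _ => hgd x)
  simp only [hg, mul_one, hfd] at key
  have hpt : ∀ x, -(2 * inner ℝ (φ x) (fderiv ℝ φ x v0) * x i0) ≤
      (1 / 2) * ‖φ x‖ ^ 2 + 2 * R ^ 2 * ‖jacobian φ x‖ ^ 2 := by
    intro x
    by_cases hx : x ∈ D.carrier
    · have h1 : |x i0| ≤ R := (by simpa using EuclideanSpace.norm_eq x ▸ PiLp.norm_apply_le x i0 :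
        |x i0| ≤ ‖x‖).trans (hD x hx)
      have h2 := abs_real_inner_le_norm (φ x) (fderiv ℝ φ x v0)
      have h3 : ‖fderiv ℝ φ x v0‖ ^ 2 ≤ ‖jacobian φ x‖ ^ 2 := by
        rw [EuclideanSpace.norm_sq_eq, EuclideanSpace.norm_sq_eq, Fintype.sum_prod_type]
        refine Finset.sum_le_sum fun i _ => ?_
        refine le_trans (le_of_eq ?_) (Finset.single_le_sum
          (f := fun j => ‖jacobian φ x (i, j)‖ ^ 2) (fun _ _ => by positivity)
          (Finset.mem_univ i0))
        simp [jacobian, v0]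
      set a := ‖φ x‖
      set b := ‖fderiv ℝ φ x v0‖
      have ha : 0 ≤ a := norm_nonneg _
      have hb : 0 ≤ b := norm_nonneg _
      have h4 : -(2 * inner ℝ (φ x) (fderiv ℝ φ x v0) * x i0) ≤ 2 * (a * b * R) := by
        refine (neg_le_abs _).trans ?_
        rw [abs_mul, abs_mul, abs_two, mul_assoc]
        gcongr
      nlinarith [sq_nonneg (a - 2 * R * b), mul_le_mul_of_nonneg_left h3 (sq_nonneg R)]
    · simp only [hz x hx]
      simp
      positivity
  have fin : ∫ x, ‖φ x‖ ^ 2 ≤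
      (1 / 2) * (∫ x, ‖φ x‖ ^ 2) + 2 * R ^ 2 * ∫ x, ‖jacobian φ x‖ ^ 2 := by
    rw [← integral_const_mul, ← integral_const_mul,
      ← integral_add (i1.const_mul _) (i2.const_mul _)]
    nth_rewrite 1 [key]
    rw [← integral_neg]
    exact integral_mono hii.neg ((i1.const_mul _).add (i2.const_mul _)) hpt
  linarith

/-- Poincaré's inequality on `H¹₀(D)ᵏ`. -/
theorem H10.exists_norm_val_le {d : ℕ} (D : PhysDomain d) (k : ℕ) :
    ∃ C : ℝ, ∀ u : H10 D k, ‖u.val‖ ≤ C * ‖u.grad‖ := by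
  obtain ⟨R, hR⟩ := D.isBounded.exists_norm_le
  have hD : ∀ x ∈ D.carrier, ‖x‖ ≤ |R| := fun x hx => (hR x hx).trans (le_abs_self R)
  have hsq : ∀ {m : ℕ} (w : Lp (Vec m) 2 D.vol) (φ : Vec d → Vec m), w =ᵐ[D.vol] φ →
      ‖w‖ ^ 2 = ∫ x, ‖φ x‖ ^ 2 ∂D.vol := by
    intro m w φ h
    rw [← real_inner_self_eq_norm_sq, L2.inner_def]
    refine integral_congr_ae ?_
    filter_upwards [h] with x hx
    rw [hx, real_inner_self_eq_norm_sq]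
  have hsq' : ∀ (w : Lp (Mat k d) 2 D.vol) (φ : Vec d → Mat k d), w =ᵐ[D.vol] φ →
      ‖w‖ ^ 2 = ∫ x, ‖φ x‖ ^ 2 ∂D.vol := by
    intro w φ h
    rw [← real_inner_self_eq_norm_sq, L2.inner_def]
    refine integral_congr_ae ?_
    filter_upwards [h] with x hx
    rw [hx, real_inner_self_eq_norm_sq]
  have hle : ((testPairs D k).topologicalClosure :
      Set (Lp (Vec k) 2 D.vol × Lp (Mat k d) 2 D.vol)) ⊆
      {w | ‖w.1‖ ≤ 2 * |R| * ‖w.2‖} := by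
    refine closure_minimal ?_ (isClosed_le (by fun_prop) (by fun_prop))
    rintro w ⟨φ, hφ, h1, h2⟩
    have := poincare_test D (abs_nonneg R) hD hφ
    rw [← hsq _ _ h1, ← hsq' _ _ h2] at this
    change ‖w.1‖ ≤ 2 * |R| * ‖w.2‖
    refine (pow_le_pow_iff_left₀ (norm_nonneg _) (by positivity) two_ne_zero).1 ?_
    rw [mul_pow, mul_pow]
    linarith
  exact ⟨2 * |R|, fun u => hle u.2⟩

theorem H10.grad_injective {d : ℕ} (D : PhysDomain d) (k : ℕ) :
    Function.Injective (H10.grad : H10 D k →ₗ[ℝ] Lp (Mat k d) 2 D.vol) := by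
  rw [injective_iff_map_eq_zero]
  intro u hu
  obtain ⟨C, hC⟩ := H10.exists_norm_val_le D k
  have h1 : H10.val u = 0 := by
    have := hC u
    rw [hu, norm_zero, mul_zero] at this
    exact norm_le_zero_iff.1 this
  exact Subtype.ext (Prod.ext h1 hu)

/-- `H¹₀(D)ᵏ` carries the norm `‖u‖ = (∫_D |∇u|_F²)^{1/2}`. -/
noncomputable instance {d : ℕ} (D : PhysDomain d) (k : ℕ) : NormedAddCommGroup (H10 D k) :=
  NormedAddCommGroup.induced (H10 D k) (Lp (Mat k d) 2 D.vol) H10.grad (H10.grad_injective D k)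

/-- The Hilbert space structure `⟨u, v⟩ = ∫_D ∇u : ∇v`. -/
noncomputable instance {d : ℕ} (D : PhysDomain d) (k : ℕ) : InnerProductSpace ℝ (H10 D k) where
  inner u v := inner ℝ u.grad v.grad
  norm_smul_le c u := (NormedSpace.induced ℝ (H10 D k) (Lp (Mat k d) 2 D.vol)
    H10.grad).norm_smul_le c u
  norm_sq_eq_re_inner u := norm_sq_eq_re_inner (𝕜 := ℝ) u.grad
  conj_inner_symm u v := inner_conj_symm _ _
  add_left u v w := by rw [map_add]; exact inner_add_left _ _ _
  smul_left u v c := by rw [map_smul]; exact inner_smul_left _ _ _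

/-- `ℒ = L²(D)/ℝ`, realised as the functions in `L²(D)` with mean value zero. -/
noncomputable def L20 {d : ℕ} (D : PhysDomain d) : Submodule ℝ (Lp ℝ 2 D.vol) where
  carrier := {q | ∫ x, q x ∂D.vol = 0}
  zero_mem' := by
    change ∫ x, (0 : Lp ℝ 2 D.vol) x ∂D.vol = 0
    rw [integral_congr_ae (Lp.coeFn_zero _ _ _)]
    simp
  add_mem' := by
    intro p q hp hq
    change ∫ x, (p + q) x ∂D.vol = 0
    have h : ∀ r : Lp ℝ 2 D.vol, Integrable r D.vol := fun r =>
      (Lp.memLp r).integrable (by norm_num)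
    rw [integral_congr_ae (Lp.coeFn_add p q)]
    exact (integral_add (h p) (h q)).trans (by rw [hp, hq, add_zero])
  smul_mem' := by
    intro c p hp
    change ∫ x, (c • p) x ∂D.vol = 0
    rw [integral_congr_ae (Lp.coeFn_smul c p)]
    exact (integral_const_mul c _).trans (by rw [hp, mul_zero])

/-- `C₄` is a constant of the embedding `H¹₀(D) ↪ L⁴(D)` of scalar functions:
`‖u‖_{L⁴(D)} ≤ C₄ ‖u‖_{H¹₀(D)}`. -/
def IsL4EmbeddingConst {d : ℕ} (D : PhysDomain d) (C₄ : ℝ) : Prop :=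
  0 < C₄ ∧ ∀ u : H10 D 1, eLpNorm u.val 4 D.vol ≤ ENNReal.ofReal (C₄ * ‖u‖)

/-! ### The forms and the variational problem -/

/-- Matrix fields in `L^∞(D)^{d × d}`, with the norm `ess sup_x |A(x)|_F`. -/
abbrev MatField {d : ℕ} (D : PhysDomain d) : Type := Lp (Mat d d) ∞ D.vol

/-- The two conventions for the matrix `∇u` of a vector field: `(∇u)ᵢⱼ = ∂uᵢ/∂xⱼ` (Jacobian) or
`(∇u)ᵢⱼ = ∂uⱼ/∂xᵢ` (gradients of the components as columns). -/
inductive GradConvention where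
  | jacobian
  | columns

/-- The matrix `∇u(x)` obtained from the Jacobian matrix under either convention. -/
def GradConvention.apply {d : ℕ} (c : GradConvention) (G : Matrix (Fin d) (Fin d) ℝ) :
    Matrix (Fin d) (Fin d) ℝ :=
  match c with
  | .jacobian => G
  | .columns => G.transpose

/-- `a(u, v; A) = ∫_D tr(∇uᵀ Aᵀ ∇v)`, with `∇` read according to `c`. -/
noncomputable def formA {d : ℕ} {D : PhysDomain d} (c : GradConvention) (A : MatField D)
    (u v : H10 D d) : ℝ :=
  ∫ x, ((c.apply (u.grad x).toMatrix).transpose * (A x).toMatrix.transpose *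
    c.apply (v.grad x).toMatrix).trace ∂D.vol

/-- `b(v, p; B) = -∫_D tr(∇v B p)`. -/
noncomputable def formB {d : ℕ} {D : PhysDomain d} (B : MatField D)
    (v : H10 D d) (p : L20 D) : ℝ :=
  -∫ x, ((v.grad x).toMatrix * ((p : Lp ℝ 2 D.vol) x • (B x).toMatrix)).trace ∂D.vol

/-- `m(u, v, w; M) = ∫_D (∇v M u)ᵀ w`. -/
noncomputable def formM {d : ℕ} {D : PhysDomain d} (M : MatField D) (u v w : H10 D d) : ℝ :=
  ∫ x, dotProduct ((v.grad x).toMatrix.mulVec ((M x).toMatrix.mulVec (u.val x).ofLp))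
    (w.val x).ofLp ∂D.vol

/-- `(u, p)` solves the steady mixed Navier–Stokes problem with coefficients `A, B, M` and data
`f ∈ ℋ*`, `g ∈ ℒ`. -/
def IsNSSolution {d : ℕ} {D : PhysDomain d} (c : GradConvention) (A B M : MatField D)
    (f : StrongDual ℝ (H10 D d)) (g : L20 D) (u : H10 D d) (p : L20 D) : Prop :=
  (∀ v : H10 D d, formA c A u v + formM M u u v - formB B v p = f v) ∧
  (∀ q : L20 D, formB B u q = inner ℝ g q)

/-! ### Parametric derivatives and Gevrey classes -/

/-- The section of `U` through `y` in the direction of the `j`-th coordinate. -/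
def coordSection {ι : Type*} [DecidableEq ι] (U : Set (ι → ℝ)) (y : ι → ℝ) (j : ι) : Set ℝ :=
  {t | Function.update y j t ∈ U}

/-- Sets on which partial derivatives are meaningful: no point of `U` is isolated in its
coordinate sections. Open sets and boxes such as `[-1/2, 1/2]^ι` have this property. -/
def IsParamDomain {ι : Type*} [DecidableEq ι] (U : Set (ι → ℝ)) : Prop :=
  ∀ y ∈ U, ∀ j, UniqueDiffWithinAt ℝ (coordSection U y j) (y j)

/-- The partial derivative `∂f/∂y_j` on `U` (one-sided at end points of the sections). -/
noncomputable def partialOn {ι E : Type*} [DecidableEq ι] [NormedAddCommGroup E] [NormedSpace ℝ E]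
    (U : Set (ι → ℝ)) (j : ι) (f : (ι → ℝ) → E) (y : ι → ℝ) : E :=
  derivWithin (fun t => f (Function.update y j t)) (coordSection U y j) (y j)

/-- The iterated partial derivative `∂_{j₁} ∂_{j₂} ⋯ ∂_{jₙ} f` for `l = [j₁, …, jₙ]`. -/
noncomputable def iterPartialOn {ι E : Type*} [DecidableEq ι] [NormedAddCommGroup E]
    [NormedSpace ℝ E] (U : Set (ι → ℝ)) (f : (ι → ℝ) → E) : List ι → (ι → ℝ) → E
  | [] => f
  | j :: l => partialOn U j (iterPartialOn U f l)

/-- All partial derivatives of `f`, of every order, exist and are continuous on `U`. -/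
def PartialSmoothOn {ι E : Type*} [DecidableEq ι] [NormedAddCommGroup E] [NormedSpace ℝ E]
    (U : Set (ι → ℝ)) (f : (ι → ℝ) → E) : Prop :=
  ∀ l : List ι, ContinuousOn (iterPartialOn U f l) U ∧
    ∀ y ∈ U, ∀ j, DifferentiableWithinAt ℝ (fun t => iterPartialOn U f l (Function.update y j t))
      (coordSection U y j) (y j)

/-- `‖∂^ν f(y)‖ ≤ C (|ν|!)^δ / R^ν` for all `y ∈ V` and all finitely supported multi-indices `ν`,
where `∂^ν` takes `ν_j` derivatives in `y_j` for each `j`, in any order. -/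
def GevreyBound {ι E : Type*} [DecidableEq ι] [NormedAddCommGroup E] [NormedSpace ℝ E]
    (δ C : ℝ) (R : ι → ℝ) (U V : Set (ι → ℝ)) (f : (ι → ℝ) → E) : Prop :=
  ∀ y ∈ V, ∀ ν : ι →₀ ℕ, ∀ l : List ι, (∀ j, l.count j = ν j) →
    ‖iterPartialOn U f l y‖ ≤ C * (ν.degree.factorial : ℝ) ^ δ / ν.prod fun j n => R j ^ n

/-- The Gevrey class `G^δ(U, E)`. -/
def GevreyClass {ι E : Type*} [DecidableEq ι] [NormedAddCommGroup E] [NormedSpace ℝ E]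
    (δ : ℝ) (U : Set (ι → ℝ)) (f : (ι → ℝ) → E) : Prop :=
  PartialSmoothOn U f ∧ ∀ y₀ ∈ U, ∃ O : Set (ι → ℝ), IsOpen O ∧ y₀ ∈ O ∧
    ∃ C > 0, ∃ R : ι → ℝ, (∀ j, 0 < R j) ∧ GevreyBound δ C R U (O ∩ U) f

/-! ### The assumptions -/

/-- The constants `ā, b̄, m̄, f̄, ḡ, α, β`. -/
structure NSConstants where
  abar : ℝ
  bbar : ℝ
  mbar : ℝ
  fbar : ℝ
  gbar : ℝ
  α : ℝ
  β : ℝ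
  abar_pos : 0 < abar
  bbar_pos : 0 < bbar
  mbar_pos : 0 < mbar
  α_pos : 0 < α
  β_pos : 0 < β

/-- The small data condition `f̄/α + ḡ/β < α/m̄`. -/
def NSConstants.SmallData (K : NSConstants) : Prop :=
  K.fbar / K.α + K.gbar / K.β < K.α / K.mbar

/-- The radius `γ ∈ [0, α/m̄)` with `f̄/(2α) + ḡ/(2β) + m̄ γ²/(2α) = γ`. -/
noncomputable def NSConstants.γ (K : NSConstants) : ℝ :=
  K.α / K.mbar * (1 - Real.sqrt (1 - K.mbar / K.α * (K.fbar / K.α + K.gbar / K.β)))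

/-- Algebraic conditions: for every `y ∈ U` and a.e. `x ∈ D` the matrices `A, B, M` are
non-singular and `A` is symmetric. -/
def CoeffAdmissible {d : ℕ} {D : PhysDomain d} {ι : Type*} (U : Set (ι → ℝ))
    (A B M : (ι → ℝ) → MatField D) : Prop :=
  ∀ y ∈ U, ∀ᵐ x ∂D.vol, (A y x).toMatrix.IsSymm ∧ IsUnit (A y x).toMatrix.det ∧
    IsUnit (B y x).toMatrix.det ∧ IsUnit (M y x).toMatrix.det

/-- Uniform coercivity of `a` with constant `α`. -/
def UniformlyCoercive {d : ℕ} {D : PhysDomain d} {ι : Type*} (c : GradConvention) (α : ℝ)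
    (U : Set (ι → ℝ)) (A : (ι → ℝ) → MatField D) : Prop :=
  ∀ y ∈ U, ∀ u : H10 D d, α * ‖u‖ ^ 2 ≤ formA c (A y) u u

/-- The uniform inf-sup condition for `b` with constant `β`. -/
def UniformInfSup {d : ℕ} {D : PhysDomain d} {ι : Type*} (β : ℝ)
    (U : Set (ι → ℝ)) (B : (ι → ℝ) → MatField D) : Prop :=
  ∀ y ∈ U, ∀ p : L20 D, p ≠ 0 →
    β ≤ ⨆ u : {u : H10 D d // u ≠ 0}, formB (B y) u.1 p / (‖u.1‖ * ‖p‖)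

/-- The data `A, B, M, f, g` are of Gevrey class `δ` on `U`, with bounds in terms of
`ā, b̄, m̄, f̄, ḡ`, `C₄` and the sequence `2R`. At `ν = 0` these are the uniform bounds
`‖A‖ ≤ ā/2`, `‖B‖ ≤ b̄/2`, `‖M‖ ≤ C₄⁻² m̄/2`, `‖f‖ ≤ f̄/2` and `‖g‖ ≤ ḡ/2`. -/
structure GevreyData {d : ℕ} {D : PhysDomain d} {ι : Type*} [DecidableEq ι] (K : NSConstants)
    (C₄ δ : ℝ) (R : ι → ℝ) (U : Set (ι → ℝ)) (A B M : (ι → ℝ) → MatField D)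
    (f : (ι → ℝ) → StrongDual ℝ (H10 D d)) (g : (ι → ℝ) → L20 D) : Prop where
  smoothA : PartialSmoothOn U A
  smoothB : PartialSmoothOn U B
  smoothM : PartialSmoothOn U M
  smoothf : PartialSmoothOn U f
  smoothg : PartialSmoothOn U g
  boundA : GevreyBound δ (K.abar / 2) (fun j => 2 * R j) U U A
  boundB : GevreyBound δ (K.bbar / 2) (fun j => 2 * R j) U U B
  boundM : GevreyBound δ ((C₄ ^ 2)⁻¹ * (K.mbar / 2)) (fun j => 2 * R j) U U M
  boundf : GevreyBound δ (K.fbar / 2) (fun j => 2 * R j) U U f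
  boundg : GevreyBound δ (K.gbar / 2) (fun j => 2 * R j) U U g

/-- The solution in the ball of radius `γ`, i.e. a solution `(u, p)` with `‖u‖_ℋ ≤ γ`. -/
def IsSmallSolution {d : ℕ} {D : PhysDomain d} (K : NSConstants) (c : GradConvention)
    (A B M : MatField D) (f : StrongDual ℝ (H10 D d)) (g : L20 D)
    (u : H10 D d) (p : L20 D) : Prop :=
  IsNSSolution c A B M f g u p ∧ ‖u‖ ≤ K.γ

/-- `w` is the lifting of `g` by `b(·, ·; B)` that is orthogonal, with respect to `a(·, ·; A)`, to
the kernel `{v | b(v, q; B) = 0 for all q}`. -/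
def IsOrthLift {d : ℕ} {D : PhysDomain d} (c : GradConvention) (A B : MatField D) (g : L20 D)
    (w : H10 D d) : Prop :=
  (∀ q : L20 D, formB B w q = inner ℝ g q) ∧
  ∀ v : H10 D d, (∀ q : L20 D, formB B v q = 0) → formA c A w v = 0

/-!
The velocity and the pressure together solve a quadratic equation `L(y) x + Q(y)(x, x) = F(y)`
between Banach spaces, whose data depend linearly and continuously on `A, B, M, f, g`. Hölder's
inequality, with the embedding `H¹₀ ↪ L⁴` for `m`, makes the three forms continuous multilinear
maps of the coefficients and their arguments (`formACLM`, `formBCLM`, `formMCLM`), and gives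
`|m(u, v, w; M)| ≤ (m̄/2) ‖u‖ ‖v‖ ‖w‖`.

The small data condition says `m̄ γ < α`. Therefore the Oseen form
`a(u, v) + m(u, z, v) + m(z', u, v)` is coercive for all `z, z'` in the ball of radius `γ`, and
with the inf-sup condition the saddle point problem for this form and `b` is well-posed, uniformly
in the parameter (`exists_saddlePoint_solution`, `saddlePoint_norm_le`). Since `z` and `z'` may
differ, this is a statement about differences of solutions: it gives uniqueness
(`mixedProblem_unique`) and, for solutions at different parameters, Lipschitz dependence on the
data. Existence is the contraction principle in the ball of radius `γ`, which is mapped to itself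
because `γ` is the smaller root of the quadratic equation of the energy estimate
(`exists_mixedProblem_solution`, `NSConstants.γ_eq`).

The same operators yield the regularity in the parameter (`StableQuadraticFamily`). Difference
quotients of the solution are obtained from difference quotients of the data by inverting them, so
that `∂_j x = S⁻¹(∂_j F - (∂_j L) x - (∂_j Q)(x, x))` with the linearised operator `S`; this
formula may be differentiated again, whence smoothness. For the bounds, `∂^l` is applied to
`S ∂_j x = ∂_j F - (∂_j L) x - (∂_j Q)(x, x)`. The top order term is controlled by the stability of
`S`, and all other terms are Leibniz sums of derivatives of lower order. They are estimated against
the majorant `K (n!)^δ ρⁿ⁻¹ Cₙ₋₁` with the Catalan numbers `Cₙ`: by the Catalan recursion the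
Leibniz sum of two such sequences is again a multiple of the sequence, with a gain of `ρ⁻¹` for the
terms in which both factors are differentiated. The quadratic terms in the unknown `K` all carry
this gain, so that a large `ρ` closes the induction (`StableQuadraticFamily.derivBound`). Since
`Cₙ ≤ 4ⁿ`, this is a Gevrey bound with the radii divided by `4ρ`.

For `δ = 1` and finitely many parameters, continuity of the partial derivatives on an open set
gives total derivatives of all orders, and the bounds give convergence of Taylor's series
(`GevreyBound.analyticOnNhd`).
-/

/-! ### Calculus of coordinate-wise derivatives -/

section PartialCalculus

variable {ι : Type*} [DecidableEq ι] {U : Set (ι → ℝ)}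
  {E F G : Type*} [NormedAddCommGroup E] [NormedSpace ℝ E] [NormedAddCommGroup F]
  [NormedSpace ℝ F] [NormedAddCommGroup G] [NormedSpace ℝ G]

/-- `f` has partial derivative `f'` in the direction `j` at `y`, within the section of `U`. -/
def HasPartialOn (U : Set (ι → ℝ)) (j : ι) (f : (ι → ℝ) → E) (f' : E) (y : ι → ℝ) : Prop :=
  HasDerivWithinAt (fun t => f (Function.update y j t)) f' (coordSection U y j) (y j)

/-- `f` has a partial derivative in the direction `j` at every point of `U`. -/
def PartiallyDifferentiableOn (U : Set (ι → ℝ)) (j : ι) (f : (ι → ℝ) → E) : Prop :=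
  ∀ y ∈ U, DifferentiableWithinAt ℝ (fun t => f (Function.update y j t))
    (coordSection U y j) (y j)

theorem PartiallyDifferentiableOn.hasPartialOn {j : ι} {f : (ι → ℝ) → E}
    (h : PartiallyDifferentiableOn U j f) {y : ι → ℝ} (hy : y ∈ U) :
    HasPartialOn U j f (partialOn U j f y) y :=
  (h y hy).hasDerivWithinAt

theorem HasPartialOn.partialOn_eq (hU : IsParamDomain U) {j : ι} {f : (ι → ℝ) → E} {f' : E}
    {y : ι → ℝ} (hy : y ∈ U) (h : HasPartialOn U j f f' y) : partialOn U j f y = f' :=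
  h.derivWithin (hU y hy j)

theorem partialOn_congr {j : ι} {f g : (ι → ℝ) → E} (h : EqOn f g U) :
    EqOn (partialOn U j f) (partialOn U j g) U := fun y hy =>
  derivWithin_congr (fun t ht => h ht) (by simpa using h hy)

theorem PartiallyDifferentiableOn.congr {j : ι} {f g : (ι → ℝ) → E}
    (hf : PartiallyDifferentiableOn U j f) (h : EqOn f g U) :
    PartiallyDifferentiableOn U j g := fun y hy =>
  (hf y hy).congr (fun t ht => (h ht).symm) (by simpa using (h hy).symm)

/-- Moving along a coordinate section is a way of approaching `y` within `U`. -/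
theorem tendsto_update_coordSection {y : ι → ℝ} (j : ι) :
    Tendsto (fun t => Function.update y j t) (𝓝[coordSection U y j] (y j)) (𝓝[U] y) := by
  refine tendsto_nhdsWithin_iff.2 ⟨?_, eventually_mem_nhdsWithin.mono fun t ht => ht⟩
  have : Continuous fun t : ℝ => Function.update y j t := continuous_const.update j continuous_id
  have h := this.continuousWithinAt (s := coordSection U y j) (x := y j)
  rwa [ContinuousWithinAt, Function.update_eq_self] at h

theorem iterPartialOn_congr {f g : (ι → ℝ) → E} (h : EqOn f g U) (l : List ι) :
    EqOn (iterPartialOn U f l) (iterPartialOn U g l) U := by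
  induction l with
  | nil => exact h
  | cons j l ih => exact partialOn_congr ih

theorem iterPartialOn_append (f : (ι → ℝ) → E) (l l' : List ι) :
    iterPartialOn U f (l ++ l') = iterPartialOn U (iterPartialOn U f l') l := by
  induction l with
  | nil => rfl
  | cons j l ih => simp only [List.cons_append, iterPartialOn, ih]

theorem iterPartialOn_concat (f : (ι → ℝ) → E) (l : List ι) (j : ι) :
    iterPartialOn U f (l ++ [j]) = iterPartialOn U (partialOn U j f) l :=
  iterPartialOn_append f l [j]

/-- The partial derivatives of `f` on `U` of order at most `n` exist and are continuous. The
recursion differentiates `f` first, which is what induction on the order of smoothness needs;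
`iterPartialOn` puts the new derivative on the outside. -/
def PartialContDiffOn (U : Set (ι → ℝ)) : ℕ → ((ι → ℝ) → E) → Prop
  | 0, f => ContinuousOn f U
  | n + 1, f => ContinuousOn f U ∧
      ∀ j, PartiallyDifferentiableOn U j f ∧ PartialContDiffOn U n (partialOn U j f)

theorem PartialContDiffOn.congr {n : ℕ} {f g : (ι → ℝ) → E} (hf : PartialContDiffOn U n f)
    (h : EqOn f g U) : PartialContDiffOn U n g := by
  induction n generalizing f g with
  | zero => exact ContinuousOn.congr hf h.symm
  | succ n ih =>
    exact ⟨hf.1.congr h.symm, fun j => ⟨(hf.2 j).1.congr h, ih (hf.2 j).2 (partialOn_congr h)⟩⟩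

theorem PartialContDiffOn.of_succ {n : ℕ} {f : (ι → ℝ) → E}
    (h : PartialContDiffOn U (n + 1) f) : PartialContDiffOn U n f := by
  induction n generalizing f with
  | zero => exact h.1
  | succ n ih => exact ⟨h.1, fun j => ⟨(h.2 j).1, ih (h.2 j).2⟩⟩

theorem partialSmoothOn_iff {f : (ι → ℝ) → E} :
    PartialSmoothOn U f ↔ ∀ n, PartialContDiffOn U n f := by
  constructor
  · intro h n
    induction n generalizing f with
    | zero => exact (h []).1
    | succ n ih =>
      refine ⟨(h []).1, fun j => ⟨fun y hy => (h []).2 y hy j, ih fun l => ?_⟩⟩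
      rw [← iterPartialOn_concat]
      exact h (l ++ [j])
  · intro h l
    induction l using List.reverseRecOn generalizing f with
    | nil => exact ⟨h 0, fun y hy j => ((h 1).2 j).1 y hy⟩
    | append_singleton l j ih =>
      rw [iterPartialOn_concat]
      exact ih fun n => ((h (n + 1)).2 j).2

theorem PartialSmoothOn.partialOn {f : (ι → ℝ) → E} (h : PartialSmoothOn U f) (j : ι) :
    PartialSmoothOn U (partialOn U j f) :=
  partialSmoothOn_iff.2 fun n => ((partialSmoothOn_iff.1 h (n + 1)).2 j).2

theorem PartialSmoothOn.continuousOn {f : (ι → ℝ) → E} (h : PartialSmoothOn U f) :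
    ContinuousOn f U :=
  (h []).1

theorem PartialSmoothOn.partiallyDifferentiableOn {f : (ι → ℝ) → E} (h : PartialSmoothOn U f)
    (j : ι) : PartiallyDifferentiableOn U j f := fun y hy => (h []).2 y hy j

theorem HasPartialOn.clm {j : ι} {f : (ι → ℝ) → E} {f' : E} {y : ι → ℝ} (T : E →L[ℝ] F)
    (h : HasPartialOn U j f f' y) : HasPartialOn U j (fun y => T (f y)) (T f') y :=
  T.hasFDerivAt.comp_hasDerivWithinAt _ h

theorem PartiallyDifferentiableOn.clm {j : ι} {f : (ι → ℝ) → E} (T : E →L[ℝ] F)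
    (h : PartiallyDifferentiableOn U j f) : PartiallyDifferentiableOn U j (fun y => T (f y)) :=
  fun _ hy => ((h.hasPartialOn hy).clm T).differentiableWithinAt

theorem partialOn_clm (hU : IsParamDomain U) {j : ι} {f : (ι → ℝ) → E} (T : E →L[ℝ] F)
    (h : PartiallyDifferentiableOn U j f) :
    EqOn (partialOn U j fun y => T (f y)) (fun y => T (partialOn U j f y)) U :=
  fun _ hy => ((h.hasPartialOn hy).clm T).partialOn_eq hU hy

theorem PartialContDiffOn.clm (hU : IsParamDomain U) {n : ℕ} {f : (ι → ℝ) → E} (T : E →L[ℝ] F)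
    (h : PartialContDiffOn U n f) : PartialContDiffOn U n (fun y => T (f y)) := by
  induction n generalizing f with
  | zero => exact T.continuous.comp_continuousOn h
  | succ n ih =>
    exact ⟨T.continuous.comp_continuousOn h.1, fun j => ⟨(h.2 j).1.clm T,
      (ih (h.2 j).2).congr (partialOn_clm hU T (h.2 j).1).symm⟩⟩

theorem PartialSmoothOn.clm (hU : IsParamDomain U) {f : (ι → ℝ) → E} (T : E →L[ℝ] F)
    (h : PartialSmoothOn U f) : PartialSmoothOn U (fun y => T (f y)) :=
  partialSmoothOn_iff.2 fun n => (partialSmoothOn_iff.1 h n).clm hU T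

theorem iterPartialOn_clm (hU : IsParamDomain U) {f : (ι → ℝ) → E} (T : E →L[ℝ] F)
    (h : PartialSmoothOn U f) (l : List ι) :
    EqOn (iterPartialOn U (fun y => T (f y)) l) (fun y => T (iterPartialOn U f l y)) U := by
  induction l with
  | nil => exact fun y _ => rfl
  | cons j l ih =>
    exact (partialOn_congr ih).trans (partialOn_clm hU T fun y hy => (h l).2 y hy j)

theorem HasPartialOn.add {j : ι} {f g : (ι → ℝ) → E} {f' g' : E} {y : ι → ℝ}
    (hf : HasPartialOn U j f f' y) (hg : HasPartialOn U j g g' y) :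
    HasPartialOn U j (fun y => f y + g y) (f' + g') y :=
  HasDerivWithinAt.add hf hg

theorem PartialContDiffOn.add (hU : IsParamDomain U) {n : ℕ} {f g : (ι → ℝ) → E}
    (hf : PartialContDiffOn U n f) (hg : PartialContDiffOn U n g) :
    PartialContDiffOn U n (fun y => f y + g y) := by
  induction n generalizing f g with
  | zero => exact ContinuousOn.add hf hg
  | succ n ih =>
    refine ⟨hf.1.add hg.1, fun j => ⟨fun y hy => ((hf.2 j).1 y hy).add ((hg.2 j).1 y hy), ?_⟩⟩
    refine (ih (hf.2 j).2 (hg.2 j).2).congr fun y hy => ?_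
    exact ((((hf.2 j).1.hasPartialOn hy).add ((hg.2 j).1.hasPartialOn hy)).partialOn_eq hU hy).symm

theorem PartialSmoothOn.add (hU : IsParamDomain U) {f g : (ι → ℝ) → E}
    (hf : PartialSmoothOn U f) (hg : PartialSmoothOn U g) :
    PartialSmoothOn U (fun y => f y + g y) :=
  partialSmoothOn_iff.2 fun n =>
    (partialSmoothOn_iff.1 hf n).add hU (partialSmoothOn_iff.1 hg n)

theorem PartialSmoothOn.neg (hU : IsParamDomain U) {f : (ι → ℝ) → E}
    (hf : PartialSmoothOn U f) : PartialSmoothOn U (fun y => -f y) :=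
  hf.clm hU (-ContinuousLinearMap.id ℝ E)

theorem iterPartialOn_add (hU : IsParamDomain U) {f g : (ι → ℝ) → E}
    (hf : PartialSmoothOn U f) (hg : PartialSmoothOn U g) (l : List ι) :
    EqOn (iterPartialOn U (fun y => f y + g y) l)
      (fun y => iterPartialOn U f l y + iterPartialOn U g l y) U := by
  induction l with
  | nil => exact fun y _ => rfl
  | cons j l ih =>
    refine (partialOn_congr ih).trans fun y hy => ?_
    exact HasPartialOn.partialOn_eq hU hy (HasPartialOn.add
      (PartiallyDifferentiableOn.hasPartialOn (fun y hy => (hf l).2 y hy j) hy)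
      (PartiallyDifferentiableOn.hasPartialOn (fun y hy => (hg l).2 y hy j) hy))

theorem iterPartialOn_neg (hU : IsParamDomain U) {f : (ι → ℝ) → E}
    (hf : PartialSmoothOn U f) (l : List ι) :
    EqOn (iterPartialOn U (fun y => -f y) l) (fun y => -iterPartialOn U f l y) U :=
  iterPartialOn_clm hU (-ContinuousLinearMap.id ℝ E) hf l

theorem HasPartialOn.bilin {j : ι} {f : (ι → ℝ) → E} {g : (ι → ℝ) → F} {f' : E} {g' : F}
    {y : ι → ℝ} (T : E →L[ℝ] F →L[ℝ] G) (hf : HasPartialOn U j f f' y)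
    (hg : HasPartialOn U j g g' y) :
    HasPartialOn U j (fun y => T (f y) (g y)) (T f' (g y) + T (f y) g') y := by
  have := T.hasDerivWithinAt_of_bilinear hf hg
  simp only [Function.update_eq_self] at this
  rwa [add_comm] at this

theorem partialOn_bilin (hU : IsParamDomain U) {j : ι} {f : (ι → ℝ) → E} {g : (ι → ℝ) → F}
    (T : E →L[ℝ] F →L[ℝ] G) (hf : PartiallyDifferentiableOn U j f)
    (hg : PartiallyDifferentiableOn U j g) :
    EqOn (partialOn U j fun y => T (f y) (g y))
      (fun y => T (partialOn U j f y) (g y) + T (f y) (partialOn U j g y)) U :=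
  fun _ hy => ((hf.hasPartialOn hy).bilin T (hg.hasPartialOn hy)).partialOn_eq hU hy

theorem PartialContDiffOn.bilin (hU : IsParamDomain U) {n : ℕ} {f : (ι → ℝ) → E}
    {g : (ι → ℝ) → F} (T : E →L[ℝ] F →L[ℝ] G) (hf : PartialContDiffOn U n f)
    (hg : PartialContDiffOn U n g) : PartialContDiffOn U n (fun y => T (f y) (g y)) := by
  induction n generalizing f g with
  | zero => exact (T.continuous.comp_continuousOn hf).clm_apply hg
  | succ n ih =>
    refine ⟨(T.continuous.comp_continuousOn hf.1).clm_apply hg.1, fun j => ⟨fun y hy =>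
      (((hf.2 j).1.hasPartialOn hy).bilin T ((hg.2 j).1.hasPartialOn hy)).differentiableWithinAt,
      ?_⟩⟩
    exact ((ih (hf.2 j).2 hg.of_succ).add hU (ih hf.of_succ (hg.2 j).2)).congr
      (partialOn_bilin hU T (hf.2 j).1 (hg.2 j).1).symm

theorem PartialSmoothOn.bilin (hU : IsParamDomain U) {f : (ι → ℝ) → E} {g : (ι → ℝ) → F}
    (T : E →L[ℝ] F →L[ℝ] G) (hf : PartialSmoothOn U f) (hg : PartialSmoothOn U g) :
    PartialSmoothOn U (fun y => T (f y) (g y)) :=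
  partialSmoothOn_iff.2 fun n =>
    (partialSmoothOn_iff.1 hf n).bilin hU T (partialSmoothOn_iff.1 hg n)

theorem PartialContDiffOn.clm_apply (hU : IsParamDomain U) {n : ℕ} {T : (ι → ℝ) → E →L[ℝ] F}
    {f : (ι → ℝ) → E} (hT : PartialContDiffOn U n T) (hf : PartialContDiffOn U n f) :
    PartialContDiffOn U n (fun y => T y (f y)) :=
  PartialContDiffOn.bilin hU (ContinuousLinearMap.id ℝ (E →L[ℝ] F)) hT hf

theorem PartialSmoothOn.clm_apply (hU : IsParamDomain U) {T : (ι → ℝ) → E →L[ℝ] F}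
    {f : (ι → ℝ) → E} (hT : PartialSmoothOn U T) (hf : PartialSmoothOn U f) :
    PartialSmoothOn U (fun y => T y (f y)) :=
  PartialSmoothOn.bilin hU (ContinuousLinearMap.id ℝ (E →L[ℝ] F)) hT hf

/-- Interchange of the two arguments, as a continuous linear map on bilinear maps. -/
noncomputable def flipCLM (E F G : Type*) [NormedAddCommGroup E] [NormedSpace ℝ E]
    [NormedAddCommGroup F] [NormedSpace ℝ F] [NormedAddCommGroup G] [NormedSpace ℝ G] :
    (E →L[ℝ] F →L[ℝ] G) →L[ℝ] (F →L[ℝ] E →L[ℝ] G) :=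
  (ContinuousLinearMap.flipₗᵢ ℝ E F G).toContinuousLinearEquiv

theorem PartialContDiffOn.flip (hU : IsParamDomain U) {n : ℕ}
    {B : (ι → ℝ) → E →L[ℝ] F →L[ℝ] G} (hB : PartialContDiffOn U n B) :
    PartialContDiffOn U n (fun y => (B y).flip) :=
  PartialContDiffOn.clm (E := E →L[ℝ] F →L[ℝ] G) (F := F →L[ℝ] E →L[ℝ] G) hU (flipCLM E F G) hB

theorem PartialSmoothOn.flip (hU : IsParamDomain U) {B : (ι → ℝ) → E →L[ℝ] F →L[ℝ] G}
    (hB : PartialSmoothOn U B) : PartialSmoothOn U (fun y => (B y).flip) :=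
  partialSmoothOn_iff.2 fun n => (partialSmoothOn_iff.1 hB n).flip hU

theorem iterPartialOn_flip (hU : IsParamDomain U) {B : (ι → ℝ) → E →L[ℝ] F →L[ℝ] G}
    (hB : PartialSmoothOn U B) (l : List ι) :
    EqOn (iterPartialOn U (fun y => (B y).flip) l) (fun y => (iterPartialOn U B l y).flip) U :=
  iterPartialOn_clm (E := E →L[ℝ] F →L[ℝ] G) (F := F →L[ℝ] E →L[ℝ] G) hU (flipCLM E F G) hB l

open ContinuousLinearMap in
/-- The pointwise inverse of a family of invertible operators is as smooth as the family:
`∂_j S⁻¹ = -S⁻¹ (∂_j S) S⁻¹`. -/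
theorem PartialContDiffOn.inverse [CompleteSpace E] (hU : IsParamDomain U) {n : ℕ}
    {S : (ι → ℝ) → E →L[ℝ] F} (hinv : ∀ y ∈ U, (S y).IsInvertible)
    (hS : PartialContDiffOn U n S) :
    PartialContDiffOn U n (fun y => ContinuousLinearMap.inverse (S y)) := by
  have hc : ContinuousOn S U → ContinuousOn (fun y => ContinuousLinearMap.inverse (S y)) U :=
    fun h y hy => ((hinv y hy).contDiffAt_map_inverse (n := 0)).continuousAt.comp_continuousWithinAt
      (h y hy)
  induction n with
  | zero => exact hc hS
  | succ n ih =>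
    have key : ∀ y ∈ U, ∀ j, HasPartialOn U j (fun y => ContinuousLinearMap.inverse (S y))
        (-(ContinuousLinearMap.inverse (S y) ∘L partialOn U j S y ∘L
          ContinuousLinearMap.inverse (S y))) y := by
      intro y hy j
      have h1 : DifferentiableWithinAt ℝ
          (fun t => ContinuousLinearMap.inverse (S (Function.update y j t)))
          (coordSection U y j) (y j) := by
        have h2 : DifferentiableAt ℝ (ContinuousLinearMap.inverse : (E →L[ℝ] F) → _)
            (S (Function.update y j (y j))) := by
          rw [Function.update_eq_self]
          exact ((hinv y hy).contDiffAt_map_inverse (n := 1)).differentiableAt (by simp)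
        exact h2.comp_differentiableWithinAt (y j) ((hS.2 j).1 y hy)
      have h3 : HasPartialOn U j (fun y => ContinuousLinearMap.inverse (S y)) _ y :=
        h1.hasDerivWithinAt
      have h4 := HasPartialOn.bilin (compL ℝ E F E) h3 ((hS.2 j).1.hasPartialOn hy)
      have h5 : HasPartialOn U j (fun y => compL ℝ E F E (ContinuousLinearMap.inverse (S y)) (S y))
          0 y := by
        refine (hasDerivWithinAt_const (y j) (coordSection U y j)
          (ContinuousLinearMap.id ℝ E)).congr (fun t ht => ?_) ?_
        · exact (hinv _ ht).inverse_comp_self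
        · simpa using (hinv _ hy).inverse_comp_self
      have h6 := (h4.partialOn_eq hU hy).symm.trans (h5.partialOn_eq hU hy)
      refine HasDerivWithinAt.congr_deriv h3 ?_
      simp only [compL_apply] at h6
      have h7 := congrArg (fun V : E →L[ℝ] E => V ∘L ContinuousLinearMap.inverse (S y)) h6
      simp only [add_comp, zero_comp, comp_assoc, (hinv y hy).self_comp_inverse, comp_id] at h7
      exact eq_neg_of_add_eq_zero_left h7
    refine ⟨hc hS.1, fun j => ⟨fun y hy => (key y hy j).differentiableWithinAt, ?_⟩⟩
    have hI := ih hS.of_succ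
    have h1 := (hS.2 j).2.bilin hU (compL ℝ F E F) hI
    have h2 := (hI.bilin hU (compL ℝ F F E) h1).clm hU (-ContinuousLinearMap.id ℝ (F →L[ℝ] E))
    exact h2.congr fun y hy => ((key y hy j).partialOn_eq hU hy).symm

end PartialCalculus

/-! ### Leibniz sums and a Catalan majorant -/

section Majorant

/-- The Leibniz sum `∑ᵢ (n choose i) aᵢ bₙ₋ᵢ`, in the recursive form in which it arises from
`∂(fg) = (∂f)g + f(∂g)`. -/
def leibnizSum : (ℕ → ℝ) → (ℕ → ℝ) → ℕ → ℝ
  | a, b, 0 => a 0 * b 0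
  | a, b, n + 1 => leibnizSum (fun k => a (k + 1)) b n + leibnizSum a (fun k => b (k + 1)) n

theorem leibnizSum_eq (a b : ℕ → ℝ) (n : ℕ) :
    leibnizSum a b n =
      ∑ ij ∈ Finset.HasAntidiagonal.antidiagonal n, (n.choose ij.1 : ℝ) * (a ij.1 * b ij.2) := by
  induction n generalizing a b with
  | zero => simp [leibnizSum]
  | succ n ih =>
    rw [leibnizSum, ih, ih, Finset.sum_antidiagonal_choose_succ_mul (fun i j => a i * b j),
      add_comm]
    congr 1
    refine Finset.sum_congr rfl fun ij hij => ?_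
    rw [← Finset.HasAntidiagonal.mem_antidiagonal.1 hij, Nat.choose_symm_add]

theorem leibnizSum_const_mul_left (c : ℝ) (a b : ℕ → ℝ) (n : ℕ) :
    leibnizSum (fun k => c * a k) b n = c * leibnizSum a b n := by
  rw [leibnizSum_eq, leibnizSum_eq, Finset.mul_sum]
  exact Finset.sum_congr rfl fun _ _ => by ring

theorem leibnizSum_const_mul_right (c : ℝ) (a b : ℕ → ℝ) (n : ℕ) :
    leibnizSum a (fun k => c * b k) n = c * leibnizSum a b n := by
  rw [leibnizSum_eq, leibnizSum_eq, Finset.mul_sum]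
  exact Finset.sum_congr rfl fun _ _ => by ring

/-- The sequence `1, 1, ρ, 2ρ², 5ρ³, …`, that is `ρⁿ⁻¹ Cₙ₋₁` with the Catalan numbers `Cₙ` for
`n ≥ 1`. In the convolution of the sequence with itself, the terms that do not involve the entry
of index `0` add up to `ρ⁻¹` times the sequence, and `ρ` can be taken large. -/
def catalanWeight (ρ : ℝ) : ℕ → ℝ
  | 0 => 1
  | n + 1 => ρ ^ n * catalan n

/-- The majorant `(n!)^δ ρⁿ⁻¹ Cₙ₋₁` (`1` for `n = 0`) of derivatives of order `n`. -/
noncomputable def gevreyMajorant (δ ρ : ℝ) (n : ℕ) : ℝ :=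
  (n.factorial : ℝ) ^ δ * catalanWeight ρ n

variable {δ ρ : ℝ}

theorem catalanWeight_nonneg (hρ : 0 ≤ ρ) (n : ℕ) : 0 ≤ catalanWeight ρ n := by
  cases n <;> simp only [catalanWeight] <;> positivity

theorem gevreyMajorant_nonneg (hρ : 0 ≤ ρ) (n : ℕ) : 0 ≤ gevreyMajorant δ ρ n :=
  mul_nonneg (by positivity) (catalanWeight_nonneg hρ n)

theorem gevreyMajorant_zero : gevreyMajorant δ ρ 0 = 1 := by
  simp [gevreyMajorant, catalanWeight]

theorem one_le_catalan (n : ℕ) : 1 ≤ catalan n := by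
  have h1 := succ_mul_catalan_eq_centralBinom n
  have h2 := n.centralBinom_pos
  by_contra! h
  interval_cases catalan n
  omega

theorem factorial_rpow_le_gevreyMajorant (hρ : 1 ≤ ρ) (n : ℕ) :
    (n.factorial : ℝ) ^ δ ≤ gevreyMajorant δ ρ n := by
  refine le_mul_of_one_le_right (by positivity) ?_
  cases n with
  | zero => exact le_rfl
  | succ n =>
    exact one_le_mul_of_one_le_of_one_le (one_le_pow₀ hρ) (by exact_mod_cast one_le_catalan n)

theorem gevreyMajorant_le (hρ : 1 ≤ ρ) (n : ℕ) :
    gevreyMajorant δ ρ n ≤ (n.factorial : ℝ) ^ δ * (4 * ρ) ^ n := by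
  refine mul_le_mul_of_nonneg_left ?_ (by positivity)
  cases n with
  | zero => simp [catalanWeight]
  | succ n =>
    have h1 : catalan n ≤ 4 ^ n := by
      rw [catalan_eq_centralBinom_div]
      exact (Nat.div_le_self _ _).trans n.centralBinom_le_four_pow
    have h2 : (catalan n : ℝ) ≤ 4 ^ n := by exact_mod_cast h1
    calc ρ ^ n * (catalan n : ℝ) ≤ ρ ^ n * 4 ^ n := by gcongr
      _ = (4 * ρ) ^ n := by rw [mul_pow, mul_comm]
      _ ≤ (4 * ρ) ^ (n + 1) := pow_le_pow_right₀ (by linarith) (Nat.le_succ n)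

/-- `(i + j choose i) (i!)^δ (j!)^δ ≤ ((i + j)!)^δ` for `δ ≥ 1`. -/
theorem choose_mul_factorial_rpow_le (hδ : 1 ≤ δ) (i j : ℕ) :
    ((i + j).choose i : ℝ) * ((i.factorial : ℝ) ^ δ * (j.factorial : ℝ) ^ δ) ≤
      ((i + j).factorial : ℝ) ^ δ := by
  have h : ((i + j).choose i : ℝ) * (i.factorial * j.factorial) = (i + j).factorial := by
    have := Nat.choose_mul_factorial_mul_factorial (Nat.le_add_right i j)
    rw [Nat.add_sub_cancel_left] at this
    rw [← mul_assoc]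
    exact_mod_cast this
  have hi : (0 : ℝ) ≤ (i.factorial : ℝ) := by positivity
  have hj : (0 : ℝ) ≤ (j.factorial : ℝ) := by positivity
  rw [← Real.mul_rpow hi hj, ← h, Real.mul_rpow (by positivity) (mul_nonneg hi hj)]
  refine mul_le_mul_of_nonneg_right ?_ (by positivity)
  have h1 : (1 : ℝ) ≤ ((i + j).choose i : ℝ) := by
    exact_mod_cast Nat.choose_pos (Nat.le_add_right i j)
  simpa using Real.rpow_le_rpow_of_exponent_le h1 hδ

/-- The Catalan recursion. -/
theorem sum_catalanWeight_interior (hρ : 0 < ρ) (n : ℕ) :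
    ∑ ij ∈ Finset.HasAntidiagonal.antidiagonal n,
      catalanWeight ρ (ij.1 + 1) * catalanWeight ρ (ij.2 + 1) =
      catalanWeight ρ (n + 2) / ρ := by
  simp only [catalanWeight]
  rw [catalan_succ', Nat.cast_sum, Finset.mul_sum, Finset.sum_div]
  refine Finset.sum_congr rfl fun ij hij => ?_
  rw [← Finset.HasAntidiagonal.mem_antidiagonal.1 hij]
  push_cast
  field_simp
  ring

/-- The Leibniz sum for a product whose first factor is differentiated at least once. Only the
bound `X₀` of the second factor itself and the quotient `X / ρ` enter, so that the constant stays
bounded as `X` and `ρ` grow. -/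
theorem leibnizSum_shift_left (hδ : 1 ≤ δ) (hρ : 0 < ρ) {X₀ X : ℝ} (hX : 0 ≤ X)
    {b : ℕ → ℝ} (hb0 : b 0 ≤ X₀) (n : ℕ)
    (hb : ∀ k, 1 ≤ k → k ≤ n → b k ≤ X * gevreyMajorant δ ρ k) :
    leibnizSum (fun k => gevreyMajorant δ ρ (k + 1)) b n ≤
      (X₀ + X / ρ) * gevreyMajorant δ ρ (n + 1) := by
  have hch : ∀ i j : ℕ, ((i + j).choose i : ℝ) * (((i + 1).factorial : ℝ) ^ δ *
      (j.factorial : ℝ) ^ δ) ≤ ((i + j + 1).factorial : ℝ) ^ δ := by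
    intro i j
    have h1 := choose_mul_factorial_rpow_le hδ (i + 1) j
    rw [show i + 1 + j = i + j + 1 by ring] at h1
    refine le_trans (mul_le_mul_of_nonneg_right ?_ (by positivity)) h1
    rw [Nat.choose_succ_succ]
    exact_mod_cast Nat.le_add_right _ _
  have hw := catalanWeight_nonneg hρ.le
  rw [leibnizSum_eq]
  cases n with
  | zero =>
    simp only [Finset.Nat.antidiagonal_zero, Finset.sum_singleton, Nat.choose_self, Nat.cast_one,
      one_mul, zero_add]
    rw [mul_comm]
    exact mul_le_mul_of_nonneg_right (hb0.trans (le_add_of_nonneg_right (div_nonneg hX hρ.le)))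
      (gevreyMajorant_nonneg hρ.le _)
  | succ n =>
    rw [Finset.Nat.antidiagonal_succ', Finset.sum_cons, Finset.sum_map, add_mul]
    refine add_le_add ?_ ?_
    · simp only [Nat.choose_self, Nat.cast_one, one_mul]
      rw [mul_comm]
      exact mul_le_mul_of_nonneg_right hb0 (gevreyMajorant_nonneg hρ.le _)
    · have : X / ρ * gevreyMajorant δ ρ (n + 1 + 1) =
          ∑ ij ∈ Finset.HasAntidiagonal.antidiagonal n, X * (((n + 1 + 1).factorial : ℝ) ^ δ *
            (catalanWeight ρ (ij.1 + 1) * catalanWeight ρ (ij.2 + 1))) := by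
        rw [← Finset.mul_sum, ← Finset.mul_sum, sum_catalanWeight_interior hρ, gevreyMajorant]
        ring
      rw [this]
      refine Finset.sum_le_sum fun ij hij => ?_
      have hij' := Finset.HasAntidiagonal.mem_antidiagonal.1 hij
      have h1 := hch ij.1 (ij.2 + 1)
      rw [← hij']
      rw [show ij.1 + ij.2 + 1 + 1 = ij.1 + (ij.2 + 1) + 1 by ring]
      have h2 := hb (ij.2 + 1) (by omega) (by omega)
      change ((ij.1 + ij.2 + 1).choose ij.1 : ℝ) *
        (gevreyMajorant δ ρ (ij.1 + 1) * b (ij.2 + 1)) ≤ _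
      calc ((ij.1 + ij.2 + 1).choose ij.1 : ℝ) * (gevreyMajorant δ ρ (ij.1 + 1) * b (ij.2 + 1))
          ≤ ((ij.1 + (ij.2 + 1)).choose ij.1 : ℝ) * (gevreyMajorant δ ρ (ij.1 + 1) *
            (X * gevreyMajorant δ ρ (ij.2 + 1))) := by
            have := gevreyMajorant_nonneg (δ := δ) hρ.le (ij.1 + 1)
            rw [add_assoc]
            gcongr
        _ = X * ((((ij.1 + (ij.2 + 1)).choose ij.1 : ℝ) * (((ij.1 + 1).factorial : ℝ) ^ δ *
            ((ij.2 + 1).factorial : ℝ) ^ δ)) *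
            (catalanWeight ρ (ij.1 + 1) * catalanWeight ρ (ij.2 + 1))) := by
            simp only [gevreyMajorant]; ring
        _ ≤ _ := by
            have := mul_nonneg (hw (ij.1 + 1)) (hw (ij.2 + 1))
            gcongr

theorem leibnizSum_symm (a b : ℕ → ℝ) (n : ℕ) : leibnizSum a b n = leibnizSum b a n := by
  induction n generalizing a b with
  | zero => exact mul_comm _ _
  | succ n ih => rw [leibnizSum, leibnizSum, ih, ih a, add_comm]

/-- The majorant is, up to a factor, closed under products. -/
theorem leibnizSum_gevreyMajorant_le (hδ : 1 ≤ δ) (hρ : 1 ≤ ρ) {X : ℝ} (hX : 0 ≤ X)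
    {b : ℕ → ℝ} (n : ℕ) (hb : ∀ k ≤ n, b k ≤ X * gevreyMajorant δ ρ k) :
    leibnizSum (gevreyMajorant δ ρ) b n ≤ 3 * X * gevreyMajorant δ ρ n := by
  have hρ0 : 0 < ρ := by linarith
  have hg := gevreyMajorant_nonneg (δ := δ) hρ0.le
  have h1 : leibnizSum (gevreyMajorant δ ρ) b n ≤
      X * leibnizSum (gevreyMajorant δ ρ) (gevreyMajorant δ ρ) n := by
    rw [leibnizSum_eq, leibnizSum_eq, Finset.mul_sum]
    refine Finset.sum_le_sum fun ij hij => ?_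
    have h := Finset.HasAntidiagonal.mem_antidiagonal.1 hij
    have h1 := hb ij.2 (by omega)
    have h2 := hg ij.1
    calc (n.choose ij.1 : ℝ) * (gevreyMajorant δ ρ ij.1 * b ij.2)
        ≤ (n.choose ij.1 : ℝ) * (gevreyMajorant δ ρ ij.1 * (X * gevreyMajorant δ ρ ij.2)) := by
          gcongr
      _ = _ := by ring
  refine h1.trans ?_
  suffices leibnizSum (gevreyMajorant δ ρ) (gevreyMajorant δ ρ) n ≤
      3 * gevreyMajorant δ ρ n by nlinarith [mul_le_mul_of_nonneg_left this hX]
  -- bound each term by the corresponding product of weights and sum these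
  have h2 : leibnizSum (gevreyMajorant δ ρ) (gevreyMajorant δ ρ) n ≤
      (n.factorial : ℝ) ^ δ *
        ∑ ij ∈ Finset.HasAntidiagonal.antidiagonal n,
          catalanWeight ρ ij.1 * catalanWeight ρ ij.2 := by
    rw [leibnizSum_eq, Finset.mul_sum]
    refine Finset.sum_le_sum fun ij hij => ?_
    have h3 := choose_mul_factorial_rpow_le hδ ij.1 ij.2
    rw [Finset.HasAntidiagonal.mem_antidiagonal.1 hij] at h3
    calc _ = ((n.choose ij.1 : ℝ) * ((ij.1.factorial : ℝ) ^ δ * (ij.2.factorial : ℝ) ^ δ)) *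
          (catalanWeight ρ ij.1 * catalanWeight ρ ij.2) := by simp only [gevreyMajorant]; ring
      _ ≤ _ := mul_le_mul_of_nonneg_right h3
          (mul_nonneg (catalanWeight_nonneg hρ0.le _) (catalanWeight_nonneg hρ0.le _))
  refine h2.trans ?_
  rw [gevreyMajorant, mul_left_comm]
  refine mul_le_mul_of_nonneg_left ?_ (by positivity)
  match n with
  | 0 => simp [catalanWeight]
  | 1 => simp [catalanWeight, Finset.HasAntidiagonal.antidiagonal]; norm_num
  | n + 2 =>
    rw [Finset.Nat.antidiagonal_succ, Finset.sum_cons, Finset.sum_map,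
      Finset.Nat.antidiagonal_succ', Finset.sum_cons, Finset.sum_map]
    simp only [Function.Embedding.prodMap, Function.Embedding.coeFn_mk,
      Function.Embedding.refl_apply, Prod.map, Nat.succ_eq_add_one]
    rw [sum_catalanWeight_interior hρ0]
    have h0 : catalanWeight ρ 0 = 1 := rfl
    have h3 : catalanWeight ρ (n + 2) / ρ ≤ catalanWeight ρ (n + 2) :=
      div_le_self (catalanWeight_nonneg hρ0.le _) hρ
    rw [h0]
    simp only [one_mul, mul_one]
    linarith

/-- The Leibniz sum of the commutator in the differentiated equation: both factors are
differentiated at least once, which gains the factor `ρ⁻¹`. -/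
theorem leibnizSum_interior (hδ : 1 ≤ δ) (hρ : 0 < ρ) (n : ℕ) :
    leibnizSum (fun k => if k = 0 then 0 else gevreyMajorant δ ρ k)
      (fun k => gevreyMajorant δ ρ (k + 1)) n ≤ gevreyMajorant δ ρ (n + 1) / ρ := by
  rw [leibnizSum_symm]
  have := leibnizSum_shift_left hδ hρ zero_le_one (X₀ := 0)
    (b := fun k => if k = 0 then 0 else gevreyMajorant δ ρ k) (by simp) n (fun k hk _ => by
      rw [if_neg (by omega), one_mul])
  rwa [zero_add, one_div, inv_mul_eq_div] at this

end Majorant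

/-! ### Bounds of iterated partial derivatives -/

section Leibniz

variable {ι : Type*} [DecidableEq ι] {U : Set (ι → ℝ)}
  {E F G : Type*} [NormedAddCommGroup E] [NormedSpace ℝ E] [NormedAddCommGroup F]
  [NormedSpace ℝ F] [NormedAddCommGroup G] [NormedSpace ℝ G]

/-- The weighted bound `R^l ‖∂^l f‖ ≤ a_{|l|}` on `U` for iterated partial derivatives with
`m ≤ |l| ≤ n`. -/
def DerivBound (R : ι → ℝ) (U : Set (ι → ℝ)) (m n : ℕ) (a : ℕ → ℝ) (f : (ι → ℝ) → E) : Prop :=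
  ∀ l : List ι, m ≤ l.length → l.length ≤ n → ∀ y ∈ U,
    (l.map R).prod * ‖iterPartialOn U f l y‖ ≤ a l.length

variable {R : ι → ℝ}

theorem weight_nonneg {ι : Type*} {R : ι → ℝ} (hR : ∀ j, 0 < R j) (l : List ι) :
    0 ≤ (l.map R).prod :=
  List.prod_nonneg fun x hx => by
    obtain ⟨j, _, rfl⟩ := List.mem_map.1 hx
    exact (hR j).le

theorem DerivBound.mono {m n m' n' : ℕ} {a : ℕ → ℝ} {f : (ι → ℝ) → E}
    (h : DerivBound R U m n a f) (hm : m ≤ m') (hn : n' ≤ n) : DerivBound R U m' n' a f :=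
  fun l h1 h2 => h l (hm.trans h1) (h2.trans hn)

theorem DerivBound.mono_fun {m n : ℕ} {a a' : ℕ → ℝ} {f : (ι → ℝ) → E}
    (h : DerivBound R U m n a f) (ha : ∀ k, m ≤ k → k ≤ n → a k ≤ a' k) :
    DerivBound R U m n a' f :=
  fun l h1 h2 y hy => (h l h1 h2 y hy).trans (ha _ h1 h2)

/-- A bound for `f` gives a bound for `∂_j f` with the shifted sequence. -/
theorem DerivBound.partialOn (hR : ∀ j, 0 < R j) {m n : ℕ} {a : ℕ → ℝ} {f : (ι → ℝ) → E}
    (h : DerivBound R U m n a f) (j : ι) {m' n' : ℕ} (hm : m ≤ m' + 1) (hn : n' + 1 ≤ n) :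
    DerivBound R U m' n' (fun k => (R j)⁻¹ * a (k + 1)) (partialOn U j f) := by
  intro l h1 h2 y hy
  have h3 := h (l ++ [j]) (by simp; omega) (by simp; omega) y hy
  rw [iterPartialOn_concat] at h3
  simp only [List.map_append, List.prod_append, List.map_cons, List.map_nil, List.prod_cons,
    List.prod_nil, mul_one, List.length_append, List.length_cons, List.length_nil] at h3
  rw [le_inv_mul_iff₀ (hR j)]
  calc _ = (l.map R).prod * R j * ‖iterPartialOn U (_root_.partialOn U j f) l y‖ := by ring
    _ ≤ _ := by simpa using h3

theorem DerivBound.add (hU : IsParamDomain U) (hR : ∀ j, 0 < R j) {m n : ℕ} {a b : ℕ → ℝ}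
    {f g : (ι → ℝ) → E} (hf : PartialSmoothOn U f) (hg : PartialSmoothOn U g)
    (ha : DerivBound R U m n a f) (hb : DerivBound R U m n b g) :
    DerivBound R U m n (fun k => a k + b k) (fun y => f y + g y) := by
  intro l h1 h2 y hy
  rw [iterPartialOn_add hU hf hg l hy]
  refine le_trans (mul_le_mul_of_nonneg_left (norm_add_le _ _) (weight_nonneg hR l)) ?_
  rw [mul_add]
  exact add_le_add (ha l h1 h2 y hy) (hb l h1 h2 y hy)

theorem DerivBound.neg (hU : IsParamDomain U) {m n : ℕ} {a : ℕ → ℝ} {f : (ι → ℝ) → E}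
    (hf : PartialSmoothOn U f) (ha : DerivBound R U m n a f) :
    DerivBound R U m n a (fun y => -f y) := by
  intro l h1 h2 y hy
  rw [iterPartialOn_neg hU hf l hy, norm_neg]
  exact ha l h1 h2 y hy

theorem DerivBound.clm (hU : IsParamDomain U) (hR : ∀ j, 0 < R j) {m n : ℕ} {a : ℕ → ℝ}
    {f : (ι → ℝ) → E} (hf : PartialSmoothOn U f) (T : E →L[ℝ] F) (ha : DerivBound R U m n a f) :
    DerivBound R U m n (fun k => ‖T‖ * a k) (fun y => T (f y)) := by
  intro l h1 h2 y hy
  rw [iterPartialOn_clm hU T hf l hy]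
  refine le_trans (mul_le_mul_of_nonneg_left (T.le_opNorm _) (weight_nonneg hR l)) ?_
  rw [mul_left_comm]
  exact mul_le_mul_of_nonneg_left (ha l h1 h2 y hy) (norm_nonneg _)

/-- The product rule for the innermost derivative. -/
theorem iterPartialOn_bilin_concat (hU : IsParamDomain U) {f : (ι → ℝ) → E} {g : (ι → ℝ) → F}
    (T : E →L[ℝ] F →L[ℝ] G) (hf : PartialSmoothOn U f) (hg : PartialSmoothOn U g)
    (l : List ι) (j : ι) :
    EqOn (iterPartialOn U (fun y => T (f y) (g y)) (l ++ [j]))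
      (fun y => iterPartialOn U (fun y => T (partialOn U j f y) (g y)) l y +
        iterPartialOn U (fun y => T (f y) (partialOn U j g y)) l y) U := by
  rw [iterPartialOn_concat]
  refine (iterPartialOn_congr (partialOn_bilin hU T (hf.partiallyDifferentiableOn j)
    (hg.partiallyDifferentiableOn j)) l).trans ?_
  exact iterPartialOn_add hU ((hf.partialOn j).bilin hU T hg) (hf.bilin hU T (hg.partialOn j)) l

/-- Leibniz bound for a product. -/
theorem DerivBound.bilin (hU : IsParamDomain U) (hR : ∀ j, 0 < R j) (T : E →L[ℝ] F →L[ℝ] G)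
    (hT : ∀ u v, ‖T u v‖ ≤ ‖u‖ * ‖v‖) {n : ℕ} {a b : ℕ → ℝ} {f : (ι → ℝ) → E}
    {g : (ι → ℝ) → F} (hf : PartialSmoothOn U f) (hg : PartialSmoothOn U g)
    (ha : DerivBound R U 0 n a f) (hb : DerivBound R U 0 n b g) :
    DerivBound R U 0 n (leibnizSum a b) (fun y => T (f y) (g y)) := by
  intro l _ hl y hy
  induction l using List.reverseRecOn generalizing n a b f g with
  | nil =>
    have h1 := ha [] le_rfl (Nat.zero_le _) y hy
    have h2 := hb [] le_rfl (Nat.zero_le _) y hy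
    simp only [List.map_nil, List.prod_nil, one_mul, List.length_nil, iterPartialOn] at h1 h2 ⊢
    exact (hT _ _).trans (mul_le_mul h1 h2 (norm_nonneg _) ((norm_nonneg _).trans h1))
  | append_singleton l j ih =>
    rw [iterPartialOn_bilin_concat hU T hf hg l j hy]
    simp only [List.length_append, List.length_cons, List.length_nil, zero_add] at hl ⊢
    have h1 := ih (hf.partialOn j) hg (ha.partialOn hR j (Nat.zero_le _) hl)
      (hb.mono le_rfl (Nat.le_of_succ_le hl)) (Nat.zero_le _) le_rfl
    have h2 := ih hf (hg.partialOn j) (ha.mono le_rfl (Nat.le_of_succ_le hl))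
      (hb.partialOn hR j (Nat.zero_le _) hl) (Nat.zero_le _) le_rfl
    rw [leibnizSum_const_mul_left, le_inv_mul_iff₀ (hR j)] at h1
    rw [leibnizSum_const_mul_right, le_inv_mul_iff₀ (hR j)] at h2
    simp only [List.map_append, List.prod_append, List.map_cons, List.map_nil, List.prod_cons,
      List.prod_nil, mul_one, leibnizSum]
    refine le_trans (mul_le_mul_of_nonneg_left (norm_add_le _ _)
      (mul_nonneg (weight_nonneg hR l) (hR j).le)) ?_
    linarith

theorem DerivBound.clm_apply (hU : IsParamDomain U) (hR : ∀ j, 0 < R j)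
    {n : ℕ} {a b : ℕ → ℝ} {T : (ι → ℝ) → E →L[ℝ] F} {f : (ι → ℝ) → E}
    (hT : PartialSmoothOn U T) (hf : PartialSmoothOn U f)
    (ha : DerivBound R U 0 n a T) (hb : DerivBound R U 0 n b f) :
    DerivBound R U 0 n (leibnizSum a b) (fun y => T y (f y)) :=
  DerivBound.bilin hU hR (ContinuousLinearMap.id ℝ (E →L[ℝ] F)) (fun S v => S.le_opNorm v)
    hT hf ha hb

theorem DerivBound.flip (hU : IsParamDomain U) {m n : ℕ} {a : ℕ → ℝ}
    {B : (ι → ℝ) → E →L[ℝ] F →L[ℝ] G} (hB : PartialSmoothOn U B)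
    (ha : DerivBound R U m n a B) : DerivBound R U m n a (fun y => (B y).flip) := by
  intro l h1 h2 y hy
  have h3 := iterPartialOn_flip hU hB l hy
  rw [h3, ContinuousLinearMap.opNorm_flip]
  exact ha l h1 h2 y hy

/-- Leibniz bound for the commutator `∂^l T(f, g) - T(f, ∂^l g)`, which does not involve the
derivatives of `g` of top order. -/
theorem DerivBound.bilin_sub (hU : IsParamDomain U) (hR : ∀ j, 0 < R j) (T : E →L[ℝ] F →L[ℝ] G)
    (hT : ∀ u v, ‖T u v‖ ≤ ‖u‖ * ‖v‖) {a b : ℕ → ℝ} {f : (ι → ℝ) → E}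
    {g : (ι → ℝ) → F} (hf : PartialSmoothOn U f) (hg : PartialSmoothOn U g) (ha0 : a 0 = 0)
    (l : List ι) (ha : DerivBound R U 1 l.length a f)
    (hb : ∀ m < l.length, DerivBound R U 0 m b g) {y : ι → ℝ} (hy : y ∈ U) :
    (l.map R).prod * ‖iterPartialOn U (fun y => T (f y) (g y)) l y -
      T (f y) (iterPartialOn U g l y)‖ ≤ leibnizSum a b l.length := by
  induction l using List.reverseRecOn generalizing b g with
  | nil => simp [iterPartialOn, leibnizSum, ha0]
  | append_singleton l j ih =>
    simp only [List.length_append, List.length_cons, List.length_nil, zero_add] at ha hb ⊢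
    rw [iterPartialOn_bilin_concat hU T hf hg l j hy, add_sub_assoc, iterPartialOn_concat]
    have h1 := DerivBound.bilin hU hR T hT (hf.partialOn j) hg
      (ha.partialOn hR j le_rfl le_rfl) (hb _ (Nat.lt_succ_self _)) l (Nat.zero_le _) le_rfl y hy
    have h2 := ih (hg.partialOn j) (ha.mono le_rfl (Nat.le_succ _))
      (b := fun k => (R j)⁻¹ * b (k + 1))
      (fun m hm => (hb (m + 1) (by omega)).partialOn hR j (Nat.zero_le _) le_rfl)
    rw [leibnizSum_const_mul_left, le_inv_mul_iff₀ (hR j)] at h1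
    rw [leibnizSum_const_mul_right, le_inv_mul_iff₀ (hR j)] at h2
    simp only [List.map_append, List.prod_append, List.map_cons, List.map_nil, List.prod_cons,
      List.prod_nil, mul_one, leibnizSum]
    refine le_trans (mul_le_mul_of_nonneg_left (norm_add_le _ _)
      (mul_nonneg (weight_nonneg hR l) (hR j).le)) ?_
    linarith

end Leibniz

/-! ### Parametric quadratic equations -/

section QuadraticEquation

variable {ι : Type*} [DecidableEq ι] {U : Set (ι → ℝ)}
  {X Y : Type*} [NormedAddCommGroup X] [NormedSpace ℝ X] [NormedAddCommGroup Y] [NormedSpace ℝ Y]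

/-- The equation `L(y) x + Q(y)(x, x) = F(y)` with smooth data and solution `x = x(y)` for `y ∈ U`,
where the operators `w ↦ L(y')w + Q(y')(w, x(y)) + Q(y')(x(y'), w)`, `y, y' ∈ U`, are onto and
bounded below by `C⁻¹`. Two different parameters occur since these are the operators that control
the difference `x(y') - x(y)`. -/
structure StableQuadraticFamily (U : Set (ι → ℝ)) (L : (ι → ℝ) → X →L[ℝ] Y)
    (Q : (ι → ℝ) → X →L[ℝ] X →L[ℝ] Y) (F : (ι → ℝ) → Y) (C : ℝ) (x : (ι → ℝ) → X) : Prop where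
  smooth_lin : PartialSmoothOn U L
  smooth_quad : PartialSmoothOn U Q
  smooth_rhs : PartialSmoothOn U F
  eqn : ∀ y ∈ U, L y (x y) + Q y (x y) (x y) = F y
  norm_le : ∀ y ∈ U, ∀ y' ∈ U, ∀ w, ‖w‖ ≤ C * ‖L y' w + Q y' w (x y) + Q y' (x y') w‖
  surj : ∀ y ∈ U, ∀ y' ∈ U, Function.Surjective fun w => L y' w + Q y' w (x y) + Q y' (x y') w

/-- The operator `w ↦ L(y')w + Q(y')(w, x(y)) + Q(y')(x(y'), w)`. -/
noncomputable def secantOp (L : (ι → ℝ) → X →L[ℝ] Y)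
    (Q : (ι → ℝ) → X →L[ℝ] X →L[ℝ] Y) (x : (ι → ℝ) → X) (y y' : ι → ℝ) : X →L[ℝ] Y :=
  L y' + (Q y').flip (x y) + Q y' (x y')

namespace StableQuadraticFamily

variable {L : (ι → ℝ) → X →L[ℝ] Y} {Q : (ι → ℝ) → X →L[ℝ] X →L[ℝ] Y} {F : (ι → ℝ) → Y}
  {C : ℝ} {x : (ι → ℝ) → X}

/-- The equation for the difference of two solutions. Its right hand side is the residual at `y'`
of the solution at `y`. -/
theorem secantOp_sub (h : StableQuadraticFamily U L Q F C x) {y y' : ι → ℝ} (hy' : y' ∈ U) :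
    secantOp L Q x y y' (x y' - x y) = F y' - L y' (x y) - Q y' (x y) (x y) := by
  rw [← h.eqn y' hy']
  simp only [secantOp, map_sub, add_apply, ContinuousLinearMap.flip_apply]
  abel

theorem isInvertible_secantOp [CompleteSpace X] [CompleteSpace Y]
    (h : StableQuadraticFamily U L Q F C x) {y y' : ι → ℝ} (hy : y ∈ U) (hy' : y' ∈ U) :
    (secantOp L Q x y y').IsInvertible := by
  have hinj : Function.Injective (secantOp L Q x y y') := by
    rw [injective_iff_map_eq_zero]
    intro w hw
    have h1 := h.norm_le y hy y' hy' w
    rw [show L y' w + Q y' w (x y) + Q y' (x y') w = 0 from hw, norm_zero, mul_zero] at h1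
    exact norm_le_zero_iff.1 h1
  exact ⟨ContinuousLinearEquiv.ofBijective _ (LinearMap.ker_eq_bot.2 hinj)
    (LinearMap.range_eq_top.2 (h.surj y hy y' hy')), rfl⟩

theorem continuousOn (h : StableQuadraticFamily U L Q F C x) : ContinuousOn x U := by
  intro y hy
  have hr : Tendsto (fun y' => F y' - L y' (x y) - Q y' (x y) (x y)) (𝓝[U] y) (𝓝 0) := by
    have h1 : ContinuousWithinAt (fun y' => F y' - L y' (x y) - Q y' (x y) (x y)) U y :=
      ((h.smooth_rhs.continuousOn y hy).sub
        ((h.smooth_lin.continuousOn y hy).clm_apply continuousWithinAt_const)).sub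
        (((h.smooth_quad.continuousOn y hy).clm_apply continuousWithinAt_const).clm_apply
          continuousWithinAt_const)
    have h2 := h1.tendsto
    rwa [← h.eqn y hy, show L y (x y) + Q y (x y) (x y) - L y (x y) - Q y (x y) (x y) = 0 by abel]
      at h2
  rw [ContinuousWithinAt, tendsto_iff_norm_sub_tendsto_zero]
  refine squeeze_zero' (Eventually.of_forall fun _ => norm_nonneg _)
    (eventually_mem_nhdsWithin.mono fun y' hy' => ?_) (by simpa using hr.norm.const_mul C)
  rw [← h.secantOp_sub hy']
  exact h.norm_le y hy y' hy' _

/-- The solution has partial derivatives, given by the linearised equation. No implicit function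
theorem is needed: the difference quotients of the solution are the inverse secant operators applied
to the difference quotients of the residual. -/
theorem hasPartialOn [CompleteSpace X] [CompleteSpace Y]
    (h : StableQuadraticFamily U L Q F C x) {y : ι → ℝ} (hy : y ∈ U) (j : ι) :
    HasPartialOn U j x (ContinuousLinearMap.inverse (secantOp L Q x y y)
      (partialOn U j F y - partialOn U j L y (x y) - partialOn U j Q y (x y) (x y))) y := by
  set r : (ι → ℝ) → Y := fun y' => F y' - L y' (x y) - Q y' (x y) (x y)
  have hr : HasPartialOn U j r
      (partialOn U j F y - partialOn U j L y (x y) - partialOn U j Q y (x y) (x y)) y := by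
    have h1 := (h.smooth_rhs.partiallyDifferentiableOn j).hasPartialOn hy
    have h2 := ((h.smooth_lin.partiallyDifferentiableOn j).hasPartialOn hy).clm
      (ContinuousLinearMap.apply ℝ Y (x y))
    have h3 := (((h.smooth_quad.partiallyDifferentiableOn j).hasPartialOn hy).clm
      (ContinuousLinearMap.apply ℝ (X →L[ℝ] Y) (x y))).clm (ContinuousLinearMap.apply ℝ Y (x y))
    exact (HasDerivWithinAt.sub h1 h2).sub h3
  have hr0 : r y = 0 := by
    simp only [r]
    rw [← h.eqn y hy]
    abel
  rw [HasPartialOn, hasDerivWithinAt_iff_tendsto_slope] at hr ⊢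
  have hmono : 𝓝[coordSection U y j \ {y j}] (y j) ≤ 𝓝[coordSection U y j] (y j) :=
    nhdsWithin_mono _ sdiff_subset
  have hu := (tendsto_update_coordSection (U := U) (y := y) j).mono_left hmono
  have hS : Tendsto (fun t => secantOp L Q x y (Function.update y j t))
      (𝓝[coordSection U y j \ {y j}] (y j)) (𝓝 (secantOp L Q x y y)) := by
    have h1 : ContinuousWithinAt (fun y' => secantOp L Q x y y') U y := by
      have hQ := h.smooth_quad.continuousOn y hy
      have hfl : ContinuousWithinAt (fun y' => (Q y').flip) U y :=
        (ContinuousLinearMap.flipₗᵢ ℝ X X Y).continuous.continuousAt.comp_continuousWithinAt hQ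
      exact ((h.smooth_lin.continuousOn y hy).add
        (hfl.clm_apply continuousWithinAt_const)).add (hQ.clm_apply (h.continuousOn y hy))
    exact h1.tendsto.comp hu
  have hI : Tendsto (fun t => ContinuousLinearMap.inverse
      (secantOp L Q x y (Function.update y j t)))
      (𝓝[coordSection U y j \ {y j}] (y j))
      (𝓝 (ContinuousLinearMap.inverse (secantOp L Q x y y))) :=
    ((h.isInvertible_secantOp hy hy).contDiffAt_map_inverse
      (n := 0)).continuousAt.tendsto.comp hS
  refine ((isBoundedBilinearMap_apply.continuous.tendsto _).comp
    (hI.prodMk_nhds hr)).congr' ?_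
  filter_upwards [eventually_mem_nhdsWithin] with t ht
  have htU : Function.update y j t ∈ U := ht.1
  simp only [Function.comp_apply, slope, vsub_eq_sub, Function.update_eq_self, hr0, sub_zero,
    map_smul]
  congr 1
  simp only [r]
  rw [← h.secantOp_sub htU]
  exact DFunLike.congr_fun (h.isInvertible_secantOp hy htU).inverse_comp_self _

/-- The derivative of the solution is a smooth expression in the data and the solution, which
improves the smoothness of the solution order by order. -/
theorem partialSmoothOn [CompleteSpace X] [CompleteSpace Y] (hU : IsParamDomain U)
    (h : StableQuadraticFamily U L Q F C x) : PartialSmoothOn U x := by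
  rw [partialSmoothOn_iff]
  intro n
  induction n with
  | zero => exact h.continuousOn
  | succ n ih =>
    refine ⟨h.continuousOn, fun j => ⟨fun y hy => (h.hasPartialOn hy j).differentiableWithinAt,
      ?_⟩⟩
    have hL := partialSmoothOn_iff.1 h.smooth_lin n
    have hQ := partialSmoothOn_iff.1 h.smooth_quad n
    have hL' := partialSmoothOn_iff.1 (h.smooth_lin.partialOn j) n
    have hQ' := partialSmoothOn_iff.1 (h.smooth_quad.partialOn j) n
    have hF' := partialSmoothOn_iff.1 (h.smooth_rhs.partialOn j) n
    have hS : PartialContDiffOn U n fun y => secantOp L Q x y y :=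
      (hL.add hU ((hQ.flip hU).clm_apply hU ih)).add hU (hQ.clm_apply hU ih)
    have hI := hS.inverse hU fun y hy => h.isInvertible_secantOp hy hy
    have hG : PartialContDiffOn U n fun y =>
        partialOn U j F y - partialOn U j L y (x y) - partialOn U j Q y (x y) (x y) := by
      have h1 := (hL'.clm_apply hU ih).clm hU
        (-ContinuousLinearMap.id ℝ Y)
      have h2 := ((hQ'.clm_apply hU ih).bilin hU
        (ContinuousLinearMap.id ℝ _) ih).clm hU (-ContinuousLinearMap.id ℝ Y)
      refine ((hF'.add hU h1).add hU h2).congr fun y _ => ?_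
      simp [sub_eq_add_neg]
    exact (hI.clm_apply hU hG).congr fun y hy =>
      ((h.hasPartialOn hy j).partialOn_eq hU hy).symm

/-- The differentiated equation. -/
theorem secantOp_partialOn [CompleteSpace X] [CompleteSpace Y] (hU : IsParamDomain U)
    (h : StableQuadraticFamily U L Q F C x) {y : ι → ℝ} (hy : y ∈ U) (j : ι) :
    secantOp L Q x y y (partialOn U j x y) =
      partialOn U j F y - partialOn U j L y (x y) - partialOn U j Q y (x y) (x y) := by
  rw [(h.hasPartialOn hy j).partialOn_eq hU hy]
  exact DFunLike.congr_fun (h.isInvertible_secantOp hy hy).self_comp_inverse _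

variable {R : ι → ℝ} {δ ρ : ℝ}

/-- The majorant bound, by induction on the order: `∂_j x` solves the linearised equation, and `∂^l`
of this equation has the linearised operator applied to `∂^l ∂_j x` on the left, up to a commutator
with derivatives of lower order. The hypothesis `hKρ` is the condition for the induction to
close. -/
theorem derivBound [CompleteSpace X] [CompleteSpace Y] (hU : IsParamDomain U)
    (hR : ∀ j, 0 < R j) (h : StableQuadraticFamily U L Q F C x) (hδ : 1 ≤ δ) (hρ : 1 ≤ ρ)
    (hC : 0 ≤ C) {c K₀ K : ℝ} (hc : 0 ≤ c) (hK₀ : 0 ≤ K₀) (hK : K₀ ≤ K)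
    (hKρ : C * (c + c * (K₀ + K / ρ) + c * (K₀ + K / ρ) ^ 2 + c * (1 + 6 * K) * (K / ρ)) ≤ K)
    (hL : ∀ n, DerivBound R U 0 n (fun k => c * (k.factorial : ℝ) ^ δ) L)
    (hQ : ∀ n, DerivBound R U 0 n (fun k => c * (k.factorial : ℝ) ^ δ) Q)
    (hF : ∀ n, DerivBound R U 0 n (fun k => c * (k.factorial : ℝ) ^ δ) F)
    (hx : ∀ y ∈ U, ‖x y‖ ≤ K₀) (n : ℕ) :
    DerivBound R U 0 n (fun k => if k = 0 then K₀ else K * gevreyMajorant δ ρ k) x := by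
  have hρ0 : 0 < ρ := by linarith
  have hK0 : 0 ≤ K := hK₀.trans hK
  set φ := gevreyMajorant δ ρ with hφ
  have hφ0 : ∀ k, 0 ≤ φ k := gevreyMajorant_nonneg hρ0.le
  have hcφ : ∀ k, c * (k.factorial : ℝ) ^ δ ≤ c * φ k := fun k =>
    mul_le_mul_of_nonneg_left (factorial_rpow_le_gevreyMajorant hρ k) hc
  replace hL : ∀ n, DerivBound R U 0 n (fun k => c * φ k) L := fun n =>
    (hL n).mono_fun fun k _ _ => hcφ k
  replace hQ : ∀ n, DerivBound R U 0 n (fun k => c * φ k) Q := fun n =>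
    (hQ n).mono_fun fun k _ _ => hcφ k
  replace hF : ∀ n, DerivBound R U 0 n (fun k => c * φ k) F := fun n =>
    (hF n).mono_fun fun k _ _ => hcφ k
  set b : ℕ → ℝ := fun k => if k = 0 then K₀ else K * φ k with hb
  have hb0 : ∀ k, 0 ≤ b k := fun k => by
    simp only [hb]; split_ifs; exacts [hK₀, mul_nonneg hK0 (hφ0 k)]
  have hbK : ∀ k, b k ≤ K * φ k := fun k => by
    simp only [hb]; split_ifs with hk
    · rw [hk, hφ, gevreyMajorant_zero, mul_one]; exact hK
    · exact le_rfl
  have hbs : ∀ k, 1 ≤ k → b k = K * φ k := fun k hk => if_neg (by omega)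
  have hxs := h.partialSmoothOn hU
  have hD : 0 ≤ K / ρ := div_nonneg hK0 hρ0.le
  -- convolution of the shifted data with the bound of the solution
  have hshift : ∀ m, leibnizSum (fun k => φ (k + 1)) b m ≤ (K₀ + K / ρ) * φ (m + 1) := fun m =>
    leibnizSum_shift_left hδ hρ0 hK0 (by simp [hb]) m fun k _ _ => hbK k
  induction n with
  | zero =>
    intro l _ hl y hy
    rw [List.length_eq_zero_iff.1 (Nat.le_zero.1 hl)]
    simpa [iterPartialOn, hb] using hx y hy
  | succ n ih =>
    intro l _ hl y hy
    rcases Nat.lt_or_ge l.length (n + 1) with hl' | hl'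
    · exact ih l (Nat.zero_le _) (by omega) y hy
    obtain ⟨l, j, rfl⟩ : ∃ l' j, l = l' ++ [j] := by
      rcases List.eq_nil_or_concat l with rfl | ⟨l', j, rfl⟩
      · simp at hl'
      · exact ⟨l', j, by simp⟩
    have hln : l.length = n := by simp at hl hl'; omega
    clear hl hl'
    have hRj := hR j
    rw [iterPartialOn_concat]
    set S : (ι → ℝ) → X →L[ℝ] Y := fun y => secantOp L Q x y y with hSdef
    -- bound for the linearised operator, where only derivatives of order at most `n` enter
    have hQxs : PartialSmoothOn U fun y => Q y (x y) :=
      h.smooth_quad.clm_apply hU hxs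
    have hfls : PartialSmoothOn U fun y => (Q y).flip :=
      h.smooth_quad.flip hU
    have hflxs : PartialSmoothOn U fun y => (Q y).flip (x y) :=
      hfls.clm_apply hU hxs
    have hSs : PartialSmoothOn U S := (h.smooth_lin.add hU hflxs).add hU hQxs
    have hfl : DerivBound R U 0 n (fun k => c * φ k) fun y => (Q y).flip :=
      (hQ n).flip hU h.smooth_quad
    have hprod : ∀ {G : (ι → ℝ) → X →L[ℝ] X →L[ℝ] Y}, PartialSmoothOn U G →
        DerivBound R U 0 n (fun k => c * φ k) G →
        DerivBound R U 0 n (fun k => 3 * c * K * φ k) fun y => G y (x y) := by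
      intro G hGs hG
      refine (DerivBound.clm_apply hU hR hGs hxs hG ih).mono_fun
        fun k _ hk => ?_
      rw [leibnizSum_const_mul_left]
      calc c * leibnizSum φ b k ≤ c * (3 * K * φ k) := by
            gcongr
            exact leibnizSum_gevreyMajorant_le hδ hρ hK0 k fun i _ => hbK i
        _ = _ := by ring
    have hS : DerivBound R U 1 n
        (fun k => c * (1 + 6 * K) * if k = 0 then 0 else φ k) S := by
      refine ((((hL n).add hU hR h.smooth_lin hflxs (hprod hfls hfl)).add hU hR
        (h.smooth_lin.add hU hflxs) hQxs (hprod h.smooth_quad (hQ n))).mono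
        (Nat.zero_le 1) le_rfl).mono_fun fun k hk _ => ?_
      rw [if_neg (by omega)]
      exact le_of_eq (by ring)
    have hcomm := DerivBound.bilin_sub hU hR (ContinuousLinearMap.id ℝ (X →L[ℝ] Y))
      (fun T v => T.le_opNorm v) hSs
      (hxs.partialOn j) (b := fun k => (R j)⁻¹ * (K * φ (k + 1))) (by simp) l (hln ▸ hS)
      (fun m hm => ((ih.mono le_rfl (by omega : m + 1 ≤ n)).partialOn hR j (n' := m) (m' := 0)
        (Nat.zero_le _) le_rfl).mono_fun fun k _ _ => le_of_eq (by rw [hbs _ (by omega)])) hy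
    rw [leibnizSum_const_mul_left, leibnizSum_const_mul_right, leibnizSum_const_mul_right,
      hln] at hcomm
    have hcomm' : (l.map R).prod * R j * ‖iterPartialOn U (fun y => S y (partialOn U j x y)) l y -
        S y (iterPartialOn U (partialOn U j x) l y)‖ ≤
        c * (1 + 6 * K) * (K / ρ) * φ (n + 1) := by
      have h1 := leibnizSum_interior hδ hρ0 n
      have h2 : 0 ≤ c * (1 + 6 * K) * K := by positivity
      have h3 := mul_le_mul_of_nonneg_left hcomm hRj.le
      calc _ = R j * ((l.map R).prod * ‖iterPartialOn U (fun y => S y (partialOn U j x y)) l y -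
            S y (iterPartialOn U (partialOn U j x) l y)‖) := by ring
        _ ≤ _ := h3
        _ = c * (1 + 6 * K) * K * leibnizSum (fun k => if k = 0 then 0 else φ k)
            (fun k => φ (k + 1)) n := by field_simp
        _ ≤ c * (1 + 6 * K) * K * (φ (n + 1) / ρ) := by gcongr
        _ = _ := by ring
    -- bound for the right hand side
    have hF' := (hF (n + 1)).partialOn hR j (m' := 0) (Nat.zero_le _) le_rfl
    have hLx : DerivBound R U 0 n (fun k => (R j)⁻¹ * (c * (K₀ + K / ρ) * φ (k + 1)))
        fun y => partialOn U j L y (x y) := by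
      refine (DerivBound.clm_apply hU hR (h.smooth_lin.partialOn j)
        hxs ((hL (n + 1)).partialOn hR j (m' := 0) (Nat.zero_le _) le_rfl) ih).mono_fun
        fun k _ hk => ?_
      rw [leibnizSum_const_mul_left, leibnizSum_const_mul_left, mul_assoc c]
      have := hshift k
      gcongr
    have hQx : DerivBound R U 0 n (fun k => (R j)⁻¹ * (c * (K₀ + K / ρ) * φ (k + 1)))
        fun y => partialOn U j Q y (x y) := by
      refine (DerivBound.clm_apply hU hR (h.smooth_quad.partialOn j)
        hxs ((hQ (n + 1)).partialOn hR j (m' := 0) (Nat.zero_le _) le_rfl) ih).mono_fun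
        fun k _ hk => ?_
      rw [leibnizSum_const_mul_left, leibnizSum_const_mul_left, mul_assoc c]
      have := hshift k
      gcongr
    have hQxs' : PartialSmoothOn U fun y => partialOn U j Q y (x y) :=
      (h.smooth_quad.partialOn j).clm_apply hU hxs
    have hQxxs' : PartialSmoothOn U fun y => partialOn U j Q y (x y) (x y) :=
      hQxs'.clm_apply hU hxs
    have hLxs' : PartialSmoothOn U fun y => partialOn U j L y (x y) :=
      (h.smooth_lin.partialOn j).clm_apply hU hxs
    have hQxx : DerivBound R U 0 n (fun k => (R j)⁻¹ * (c * (K₀ + K / ρ) ^ 2 * φ (k + 1)))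
        fun y => partialOn U j Q y (x y) (x y) := by
      refine (DerivBound.clm_apply hU hR hQxs' hxs hQx ih).mono_fun
        fun k _ hk => ?_
      rw [leibnizSum_const_mul_left, leibnizSum_const_mul_left, sq, ← mul_assoc c,
        mul_assoc (c * (K₀ + K / ρ))]
      have := hshift k
      gcongr
    have hG := ((hF'.add hU hR (h.smooth_rhs.partialOn j) (hLxs'.neg hU)
      (hLx.neg hU hLxs')).add hU hR ((h.smooth_rhs.partialOn j).add hU (hLxs'.neg hU))
      (hQxxs'.neg hU) (hQxx.neg hU hQxxs')) l (Nat.zero_le _) hln.le y hy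
    have hEq : EqOn (fun y => partialOn U j F y + -partialOn U j L y (x y) +
        -partialOn U j Q y (x y) (x y)) (fun y => S y (partialOn U j x y)) U := fun y hy => by
      simp only [hSdef]
      rw [h.secantOp_partialOn hU hy j, sub_eq_add_neg, sub_eq_add_neg]
    rw [iterPartialOn_congr hEq l hy, hln] at hG
    have hG' : (l.map R).prod * R j * ‖iterPartialOn U (fun y => S y (partialOn U j x y)) l y‖ ≤
        (c + c * (K₀ + K / ρ) + c * (K₀ + K / ρ) ^ 2) * φ (n + 1) := by
      have h3 := mul_le_mul_of_nonneg_left hG hRj.le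
      calc _ = R j * ((l.map R).prod *
            ‖iterPartialOn U (fun y => S y (partialOn U j x y)) l y‖) := by ring
        _ ≤ _ := h3
        _ = _ := by field_simp
    -- conclusion from the stability of the linearised operator
    set z := iterPartialOn U (partialOn U j x) l y
    set Sx := iterPartialOn U (fun y => S y (partialOn U j x y)) l y
    have hz : ‖z‖ ≤ C * ‖S y z‖ := h.norm_le y hy y hy z
    have hSz : ‖S y z‖ ≤ ‖Sx‖ + ‖Sx - S y z‖ := by
      calc ‖S y z‖ = ‖Sx - (Sx - S y z)‖ := by rw [sub_sub_cancel]
        _ ≤ _ := norm_sub_le _ _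
    simp only [List.map_append, List.prod_append, List.map_cons, List.map_nil, List.prod_cons,
      List.prod_nil, mul_one, List.length_append, List.length_cons, List.length_nil, hln]
    rw [hbs _ (by omega)]
    have hw : 0 ≤ (l.map R).prod * R j := mul_nonneg (weight_nonneg hR l) hRj.le
    calc (l.map R).prod * R j * ‖z‖ ≤ (l.map R).prod * R j * (C * (‖Sx‖ + ‖Sx - S y z‖)) := by
          gcongr
          exact hz.trans (by gcongr)
      _ = C * ((l.map R).prod * R j * ‖Sx‖ + (l.map R).prod * R j * ‖Sx - S y z‖) := by ring
      _ ≤ C * ((c + c * (K₀ + K / ρ) + c * (K₀ + K / ρ) ^ 2) * φ (n + 1) +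
          c * (1 + 6 * K) * (K / ρ) * φ (n + 1)) := by
          gcongr
      _ = C * (c + c * (K₀ + K / ρ) + c * (K₀ + K / ρ) ^ 2 + c * (1 + 6 * K) * (K / ρ)) *
          φ (n + 1) := by ring
      _ ≤ K * φ (n + 1) := by
          gcongr
          exact hφ0 _

end StableQuadraticFamily

/-- Constants for which the majorant argument closes: `K` is chosen as if `K / ρ` and
`(1 + 6K)K / ρ` were `1`, and `ρ` afterwards so that they are at most `1`. -/
theorem exists_majorant_constants {C c K₀ : ℝ} (hC : 0 ≤ C) (hc : 0 ≤ c) (hK₀ : 0 ≤ K₀) :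
    ∃ K ρ : ℝ, K₀ ≤ K ∧ 1 ≤ K ∧ 1 ≤ ρ ∧
      C * (c + c * (K₀ + K / ρ) + c * (K₀ + K / ρ) ^ 2 + c * (1 + 6 * K) * (K / ρ)) ≤ K := by
  have hCc : 0 ≤ C * c := mul_nonneg hC hc
  set K := C * c * (1 + (K₀ + 1) + (K₀ + 1) ^ 2 + 1) + K₀ + 1 with hKdef
  have h0 : 0 ≤ C * c * (1 + (K₀ + 1) + (K₀ + 1) ^ 2 + 1) := by positivity
  have hK1 : 1 ≤ K := by linarith
  set ρ := (1 + 6 * K) * K with hρ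
  have hρ1 : 1 ≤ ρ := by nlinarith
  have h1 : (1 + 6 * K) * (K / ρ) = 1 := by
    rw [hρ]; field_simp
  have h2 : K / ρ ≤ 1 := by
    rw [div_le_one (by linarith)]; nlinarith
  have h3 : 0 ≤ K / ρ := by positivity
  refine ⟨K, ρ, by linarith, hK1, hρ1, ?_⟩
  calc _ = C * c * (1 + (K₀ + K / ρ) + (K₀ + K / ρ) ^ 2 + (1 + 6 * K) * (K / ρ)) := by ring
    _ ≤ C * c * (1 + (K₀ + 1) + (K₀ + 1) ^ 2 + 1) := by
        rw [h1]; gcongr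
    _ ≤ K := by linarith

end QuadraticEquation

/-! ### Saddle point problems -/

section SaddlePoint

variable {V P : Type*} [NormedAddCommGroup V] [InnerProductSpace ℝ V] [NormedAddCommGroup P]
  [InnerProductSpace ℝ P]

/-- The Lax–Milgram theorem, as bijectivity of `u ↦ a(u, ·)` onto the dual. -/
theorem IsCoercive.bijective [CompleteSpace V] {a : V →L[ℝ] V →L[ℝ] ℝ} (h : IsCoercive a) :
    Function.Bijective a := by
  constructor
  · rw [injective_iff_map_eq_zero]
    intro u hu
    obtain ⟨C, hC, hc⟩ := h
    have h1 := hc u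
    rw [hu, zero_apply] at h1
    by_contra hne
    have := norm_pos_iff.2 hne
    have : 0 < C * ‖u‖ * ‖u‖ := by positivity
    linarith
  · intro φ
    refine ⟨h.continuousLinearEquivOfBilin.symm ((InnerProductSpace.toDual ℝ V).symm φ), ?_⟩
    ext v
    rw [← h.continuousLinearEquivOfBilin_apply, ContinuousLinearEquiv.apply_symm_apply,
      InnerProductSpace.toDual_symm_apply]

/-- Solvability of the saddle point problem: the velocity is eliminated by Lax–Milgram, and the
resulting Schur complement on `P` is coercive. -/
theorem exists_saddlePoint_solution [CompleteSpace V] [CompleteSpace P]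
    {a : V →L[ℝ] V →L[ℝ] ℝ} {b : V →L[ℝ] P →L[ℝ] ℝ}
    {α β : ℝ} (hα : 0 < α) (hβ : 0 < β) (ha : ∀ u, α * ‖u‖ ^ 2 ≤ a u u)
    (hb : ∀ p, β * ‖p‖ ≤ ‖b.flip p‖) (φ : StrongDual ℝ V) (ψ : StrongDual ℝ P) :
    ∃ u p, a u - b.flip p = φ ∧ b u = ψ := by
  have hca : IsCoercive a := ⟨α, hα, fun u => by linarith [ha u, sq ‖u‖]⟩
  set e : V ≃L[ℝ] StrongDual ℝ V := ContinuousLinearEquiv.ofBijective a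
    (LinearMap.ker_eq_bot.2 hca.bijective.1) (LinearMap.range_eq_top.2 hca.bijective.2)
  have he : ∀ ℓ, a (e.symm ℓ) = ℓ := fun ℓ => e.apply_symm_apply ℓ
  set s : P →L[ℝ] P →L[ℝ] ℝ := b ∘L (e.symm : StrongDual ℝ V →L[ℝ] V) ∘L b.flip
  have hs : ∀ p q, s p q = b (e.symm (b.flip p)) q := fun p q => rfl
  have hcs : IsCoercive s := by
    have ha1 : 0 < ‖a‖ + 1 := by positivity
    refine ⟨α * (β / (‖a‖ + 1)) ^ 2, by positivity, fun p => ?_⟩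
    set v := e.symm (b.flip p)
    have h1 : s p p = a v v := by
      rw [he (b.flip p)]
      rfl
    have h2 : β / (‖a‖ + 1) * ‖p‖ ≤ ‖v‖ := by
      have h3 := (hb p).trans_eq (congrArg norm (he (b.flip p)).symm)
      have h4 : β * ‖p‖ ≤ (‖a‖ + 1) * ‖v‖ :=
        h3.trans ((a.le_opNorm v).trans (by nlinarith [norm_nonneg v]))
      rw [div_mul_eq_mul_div, div_le_iff₀ ha1]
      linarith
    calc α * (β / (‖a‖ + 1)) ^ 2 * ‖p‖ * ‖p‖ = α * (β / (‖a‖ + 1) * ‖p‖) ^ 2 := by ring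
      _ ≤ α * ‖v‖ ^ 2 := by gcongr
      _ ≤ _ := by rw [h1]; exact ha v
  obtain ⟨p, hp⟩ := hcs.bijective.2 (ψ - b (e.symm φ))
  refine ⟨e.symm (φ + b.flip p), p, ?_, ?_⟩
  · rw [he, add_sub_cancel_right]
  · rw [map_add, map_add]
    have : b (e.symm (b.flip p)) = s p := rfl
    rw [this, hp, add_sub_cancel]

/-- The constant in the velocity bound of the saddle point problem. -/
noncomputable def saddleConst (α β N : ℝ) : ℝ := 1 + (1 + N / β + 1 / β) / α

/-- A priori bound for the saddle point problem. The pressure is bounded in terms of the velocity by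
the inf-sup condition, the velocity by testing with `(u, p)`. -/
theorem saddlePoint_norm_le {a : V →L[ℝ] V →L[ℝ] ℝ} {b : V →L[ℝ] P →L[ℝ] ℝ}
    {α β N : ℝ} (hα : 0 < α) (hβ : 0 < β) (haN : ‖a‖ ≤ N) (ha : ∀ u, α * ‖u‖ ^ 2 ≤ a u u)
    (hb : ∀ p, β * ‖p‖ ≤ ‖b.flip p‖) (u : V) (p : P) {r : ℝ}
    (h1 : ‖a u - b.flip p‖ ≤ r) (h2 : ‖b u‖ ≤ r) :
    ‖u‖ ≤ saddleConst α β N * r ∧ ‖p‖ ≤ (N * saddleConst α β N + 1) / β * r := by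
  have hr : 0 ≤ r := (norm_nonneg _).trans h1
  have hN : 0 ≤ N := (norm_nonneg a).trans haN
  have hu := norm_nonneg u
  have hau : ‖a u‖ ≤ N * ‖u‖ := (a.le_opNorm u).trans (by gcongr)
  have hp : β * ‖p‖ ≤ N * ‖u‖ + r := by
    refine (hb p).trans ?_
    calc ‖b.flip p‖ = ‖a u - (a u - b.flip p)‖ := by rw [sub_sub_cancel]
      _ ≤ _ := (norm_sub_le _ _).trans (add_le_add hau h1)
  have hp' : ‖p‖ ≤ (N * ‖u‖ + r) / β := by rw [le_div_iff₀ hβ]; linarith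
  have hen : α * ‖u‖ ^ 2 ≤ r * ‖u‖ + r * ‖p‖ := by
    refine (ha u).trans ?_
    have h3 : a u u = (a u - b.flip p) u + b u p := by simp
    rw [h3]
    refine add_le_add ((le_abs_self _).trans (((a u - b.flip p).le_opNorm u).trans ?_))
      ((le_abs_self _).trans (((b u).le_opNorm p).trans ?_)) <;> gcongr
  have hmain : ‖u‖ ≤ saddleConst α β N * r := by
    have hk : 0 ≤ (1 + N / β + 1 / β) / α := by positivity
    rcases le_or_gt ‖u‖ r with h | h
    · unfold saddleConst
      nlinarith
    · -- here `r² ≤ r ‖u‖`, so that a factor `‖u‖` can be cancelled in the energy estimate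
      have hu0 : 0 < ‖u‖ := hr.trans_lt h
      have h4 : α * ‖u‖ * ‖u‖ ≤ (1 + N / β + 1 / β) * r * ‖u‖ := by
        calc α * ‖u‖ * ‖u‖ = α * ‖u‖ ^ 2 := by ring
          _ ≤ r * ‖u‖ + r * ‖p‖ := hen
          _ ≤ r * ‖u‖ + r * ((N * ‖u‖ + ‖u‖) / β) := by
              gcongr
              exact hp'.trans (by gcongr)
          _ = _ := by ring
      have h5 := le_of_mul_le_mul_right h4 hu0
      have h6 : ‖u‖ ≤ (1 + N / β + 1 / β) / α * r := by
        rw [div_mul_eq_mul_div, le_div_iff₀ hα]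
        linarith
      unfold saddleConst
      nlinarith
  refine ⟨hmain, hp'.trans ?_⟩
  rw [div_mul_eq_mul_div]
  gcongr
  calc N * ‖u‖ + r ≤ N * (saddleConst α β N * r) + r := by gcongr
    _ = _ := by ring

end SaddlePoint

/-! ### The spaces `H¹₀(D)` and `L²₀(D)` -/

section FunctionSpaces

variable {d : ℕ} {D : PhysDomain d} {k : ℕ}

theorem H10.norm_grad (u : H10 D k) : ‖u.grad‖ = ‖u‖ := rfl

/-- The gradient as a continuous linear map. -/
noncomputable def H10.gradL (D : PhysDomain d) (k : ℕ) : H10 D k →L[ℝ] Lp (Mat k d) 2 D.vol :=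
  H10.grad.mkContinuous 1 fun u => by rw [one_mul, H10.norm_grad]

/-- The norm is that of the gradient only; by Poincaré's inequality it controls the graph norm. -/
instance : CompleteSpace (H10 D k) := by
  obtain ⟨C, hC⟩ := H10.exists_norm_val_le D k
  refine Metric.complete_of_cauchySeq_tendsto fun s hs => ?_
  have hg : CauchySeq fun n => (s n).grad := (H10.gradL D k).uniformContinuous.comp_cauchySeq hs
  have hv : CauchySeq fun n => (s n).val :=
    ((H10.val (D := D) (k := k)).mkContinuous C hC).uniformContinuous.comp_cauchySeq hs
  obtain ⟨g, hg⟩ := cauchySeq_tendsto_of_complete hg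
  obtain ⟨v, hv⟩ := cauchySeq_tendsto_of_complete hv
  have hmem : (v, g) ∈ (testPairs D k).topologicalClosure :=
    (testPairs D k).isClosed_topologicalClosure.mem_of_tendsto (hv.prodMk_nhds hg)
      (Eventually.of_forall fun n => (s n).2)
  obtain ⟨u, hu⟩ : ∃ u : H10 D k, u.grad = g :=
    ⟨(⟨(v, g), hmem⟩ : (testPairs D k).topologicalClosure), rfl⟩
  refine ⟨u, ?_⟩
  rw [tendsto_iff_norm_sub_tendsto_zero] at hg ⊢
  refine hg.congr fun n => ?_
  rw [← hu, ← map_sub, H10.norm_grad]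

/-- Functions of mean zero form the orthogonal complement of the constants. -/
instance : CompleteSpace (L20 D) := by
  have hc : IsClosed ((L20 D : Submodule ℝ (Lp ℝ 2 D.vol)) : Set (Lp ℝ 2 D.vol)) := by
    have h : ((L20 D : Submodule ℝ (Lp ℝ 2 D.vol)) : Set (Lp ℝ 2 D.vol)) =
        {q | inner ℝ (indicatorConstLp 2 MeasurableSet.univ (measure_ne_top D.vol univ) (1 : ℝ)) q
          = 0} := by
      ext q
      rw [mem_ofPred_eq, L2.inner_indicatorConstLp_one, Measure.restrict_univ]
      rfl
    rw [h]
    exact isClosed_eq (by fun_prop) continuous_const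
  exact hc.completeSpace_coe

/-- The `i`-th component of a vector. -/
noncomputable def vecComp (k : ℕ) (i : Fin k) : Vec k →L[ℝ] Vec 1 :=
  LinearMap.toContinuousLinearMap
    { toFun := fun v => WithLp.toLp 2 fun _ => v i
      map_add' := fun v w => by ext; simp
      map_smul' := fun c v => by ext; simp }

/-- The `i`-th row of a matrix. -/
noncomputable def matRow (k d : ℕ) (i : Fin k) : Mat k d →L[ℝ] Mat 1 d :=
  LinearMap.toContinuousLinearMap
    { toFun := fun G => WithLp.toLp 2 fun j => G (i, j.2)
      map_add' := fun v w => by ext; simp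
      map_smul' := fun c v => by ext; simp }

theorem vecComp_apply (i : Fin k) (v : Vec k) (j : Fin 1) : vecComp k i v j = v i := rfl

theorem matRow_apply (i : Fin k) (G : Mat k d) (j : Fin 1 × Fin d) :
    matRow k d i G j = G (i, j.2) := rfl

theorem sum_norm_vecComp_sq (v : Vec k) : ∑ i, ‖vecComp k i v‖ ^ 2 = ‖v‖ ^ 2 := by
  simp [EuclideanSpace.norm_sq_eq, vecComp_apply]

theorem sum_norm_matRow_sq (G : Mat k d) : ∑ i, ‖matRow k d i G‖ ^ 2 = ‖G‖ ^ 2 := by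
  simp [EuclideanSpace.norm_sq_eq, matRow_apply, Fintype.sum_prod_type]

theorem IsTestField.vecComp {φ : Vec d → Vec k} (h : IsTestField D φ) (i : Fin k) :
    IsTestField D (fun x => _root_.vecComp k i (φ x)) := by
  obtain ⟨h1, h2, h3⟩ := h
  have hsub : Function.support (fun x => _root_.vecComp k i (φ x)) ⊆ Function.support φ := by
    intro x hx
    contrapose! hx
    simp only [Function.mem_support, not_not] at hx ⊢
    rw [hx, map_zero]
  exact ⟨(_root_.vecComp k i).contDiff.comp h1, h2.mono hsub, (closure_mono hsub).trans h3⟩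

theorem jacobian_vecComp {φ : Vec d → Vec k} (h : Differentiable ℝ φ) (i : Fin k) (x : Vec d) :
    jacobian (fun x => vecComp k i (φ x)) x = matRow k d i (jacobian φ x) := by
  have h1 : fderiv ℝ (fun x => vecComp k i (φ x)) x = (vecComp k i) ∘L fderiv ℝ φ x :=
    ((vecComp k i).hasFDerivAt.comp x (h x).hasFDerivAt).fderiv
  ext j
  rw [matRow_apply]
  simp only [jacobian, h1, ContinuousLinearMap.comp_apply]
  rfl

/-- The components of an `H¹₀` field belong to `H¹₀`. -/
theorem H10.exists_component (u : H10 D k) (i : Fin k) :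
    ∃ w : H10 D 1, w.val = (vecComp k i).compLpL 2 D.vol u.val ∧
      w.grad = (matRow k d i).compLpL 2 D.vol u.grad := by
  let T : Lp (Vec k) 2 D.vol × Lp (Mat k d) 2 D.vol →L[ℝ]
      Lp (Vec 1) 2 D.vol × Lp (Mat 1 d) 2 D.vol :=
    ((vecComp k i).compLpL 2 D.vol).prodMap ((matRow k d i).compLpL 2 D.vol)
  have hmaps : MapsTo T (testPairs D k) (testPairs D 1) := by
    rintro w ⟨φ, hφ, h1, h2⟩
    refine ⟨fun x => vecComp k i (φ x), hφ.vecComp i, ?_, ?_⟩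
    · filter_upwards [(vecComp k i).coeFn_compLpL (p := 2) w.1, h1] with x hx hx1
      rw [← hx1, ← hx]
      rfl
    · filter_upwards [(matRow k d i).coeFn_compLpL (p := 2) w.2, h2] with x hx hx2
      rw [jacobian_vecComp (hφ.1.differentiable (by simp)), ← hx2, ← hx]
      rfl
  have hu : T u.1 ∈ (testPairs D 1).topologicalClosure :=
    map_mem_closure T.continuous u.2 hmaps
  exact ⟨(⟨T u.1, hu⟩ : (testPairs D 1).topologicalClosure), rfl, rfl⟩

theorem norm_sq_eq_integral {E : Type*} [NormedAddCommGroup E] [InnerProductSpace ℝ E]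
    (w : Lp E 2 D.vol) : ‖w‖ ^ 2 = ∫ x, ‖w x‖ ^ 2 ∂D.vol := by
  rw [← real_inner_self_eq_norm_sq, L2.inner_def]
  exact integral_congr_ae (Eventually.of_forall fun x => real_inner_self_eq_norm_sq _)

theorem integrable_norm_sq {E : Type*} [NormedAddCommGroup E] [InnerProductSpace ℝ E]
    (w : Lp E 2 D.vol) : Integrable (fun x => ‖w x‖ ^ 2) D.vol := by
  simpa using (Lp.memLp w).integrable_norm_rpow (by norm_num) (by norm_num)

theorem sum_norm_sq_matRow (G : Lp (Mat k d) 2 D.vol) :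
    ∑ i, ‖(matRow k d i).compLpL 2 D.vol G‖ ^ 2 = ‖G‖ ^ 2 := by
  simp_rw [norm_sq_eq_integral]
  rw [← integral_finsetSum _ fun i _ => integrable_norm_sq _]
  refine integral_congr_ae ?_
  have h : ∀ᵐ x ∂D.vol, ∀ i, (matRow k d i).compLpL 2 D.vol G x = matRow k d i (G x) :=
    ae_all_iff.2 fun i => (matRow k d i).coeFn_compLpL (p := 2) G
  filter_upwards [h] with x hx
  simp only [hx]
  exact sum_norm_matRow_sq _

/-- The scalar embedding `H¹₀ ↪ L⁴` gives the embedding of vector fields with the same constant,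
since `‖|u|²‖_{L²} ≤ ∑ᵢ ‖uᵢ‖²_{L⁴}`. -/
theorem IsL4EmbeddingConst.eLpNorm_le {C₄ : ℝ} (hC : IsL4EmbeddingConst D C₄) (u : H10 D k) :
    eLpNorm u.val 4 D.vol ≤ ENNReal.ofReal (C₄ * ‖u‖) := by
  choose w hwv hwg using u.exists_component
  have hsq : ∀ {E : Type} [NormedAddCommGroup E] (f : Vec d → E),
      eLpNorm (fun x => ‖f x‖ ^ 2) 2 D.vol = eLpNorm f 4 D.vol ^ 2 := by
    intro E _ f
    have h1 := eLpNorm_norm_rpow (p := 2) (μ := D.vol) f (q := 2) (by norm_num)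
    simp only [Real.rpow_two, ENNReal.rpow_two] at h1
    rw [h1]
    congr 2
    norm_num
  have h1 : eLpNorm u.val 4 D.vol ^ 2 ≤ ENNReal.ofReal (C₄ * ‖u‖) ^ 2 := by
    calc eLpNorm u.val 4 D.vol ^ 2
        = eLpNorm (fun x => ‖u.val x‖ ^ 2) 2 D.vol := (hsq _).symm
      _ = eLpNorm (∑ i, fun x => ‖(w i).val x‖ ^ 2) 2 D.vol := by
          refine eLpNorm_congr_ae ?_
          have h : ∀ᵐ x ∂D.vol, ∀ i, (w i).val x = vecComp k i (u.val x) :=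
            ae_all_iff.2 fun i => by
              rw [hwv]; exact (vecComp k i).coeFn_compLpL (p := 2) u.val
          filter_upwards [h] with x hx
          simp only [Finset.sum_apply, hx]
          exact (sum_norm_vecComp_sq _).symm
      _ ≤ ∑ i, eLpNorm (fun x => ‖(w i).val x‖ ^ 2) 2 D.vol :=
          eLpNorm_sum_le (fun i _ => (Lp.aestronglyMeasurable _).norm.pow 2) (by norm_num)
      _ = ∑ i, eLpNorm (w i).val 4 D.vol ^ 2 := by simp only [hsq]
      _ ≤ ∑ i, ENNReal.ofReal (C₄ * ‖w i‖) ^ 2 := by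
          gcongr with i
          exact hC.2 (w i)
      _ = ENNReal.ofReal (∑ i, (C₄ * ‖w i‖) ^ 2) := by
          rw [ENNReal.ofReal_sum_of_nonneg fun i _ => sq_nonneg _]
          refine Finset.sum_congr rfl fun i _ => ?_
          rw [ENNReal.ofReal_pow (mul_nonneg hC.1.le (norm_nonneg _))]
      _ = ENNReal.ofReal (C₄ * ‖u‖) ^ 2 := by
          rw [← ENNReal.ofReal_pow (mul_nonneg hC.1.le (norm_nonneg _))]
          congr 1
          simp only [mul_pow, ← Finset.mul_sum]
          congr 1
          rw [← H10.norm_grad u, ← sum_norm_sq_matRow]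
          refine Finset.sum_congr rfl fun i _ => ?_
          rw [← hwg, H10.norm_grad]
  exact (ENNReal.pow_le_pow_left_iff two_ne_zero).1 h1

theorem IsL4EmbeddingConst.memLp {C₄ : ℝ} (hC : IsL4EmbeddingConst D C₄) (u : H10 D k) :
    MemLp u.val 4 D.vol :=
  ⟨Lp.aestronglyMeasurable _, (hC.eLpNorm_le u).trans_lt ENNReal.ofReal_lt_top⟩

instance : Fact ((1 : ℝ≥0∞) ≤ 4) := ⟨by norm_num⟩

/-- The embedding `H¹₀(D)ᵏ → L⁴(D)ᵏ`. -/
noncomputable def H10.toL4 {C₄ : ℝ} (hC : IsL4EmbeddingConst D C₄) (k : ℕ) :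
    H10 D k →L[ℝ] Lp (Vec k) 4 D.vol :=
  LinearMap.mkContinuous
    { toFun := fun u => (hC.memLp u).toLp
      map_add' := fun u v => by
        rw [← MemLp.toLp_add]
        refine MemLp.toLp_congr _ _ ?_
        rw [map_add]
        exact Lp.coeFn_add _ _
      map_smul' := fun c u => by
        rw [RingHom.id_apply, ← MemLp.toLp_const_smul]
        refine MemLp.toLp_congr _ _ ?_
        rw [map_smul]
        exact Lp.coeFn_smul _ _ }
    C₄ fun u => by
      change ‖(hC.memLp u).toLp‖ ≤ _
      rw [Lp.norm_toLp]
      exact ENNReal.toReal_le_of_le_ofReal (mul_nonneg hC.1.le (norm_nonneg _)) (hC.eLpNorm_le u)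

theorem H10.coeFn_toL4 {C₄ : ℝ} (hC : IsL4EmbeddingConst D C₄) (u : H10 D k) :
    H10.toL4 hC k u =ᵐ[D.vol] u.val :=
  (hC.memLp u).coeFn_toLp

theorem H10.norm_toL4_le {C₄ : ℝ} (hC : IsL4EmbeddingConst D C₄) (u : H10 D k) :
    ‖H10.toL4 hC k u‖ ≤ C₄ * ‖u‖ := by
  change ‖(hC.memLp u).toLp‖ ≤ _
  rw [Lp.norm_toLp]
  exact ENNReal.toReal_le_of_le_ofReal (mul_nonneg hC.1.le (norm_nonneg _)) (hC.eLpNorm_le u)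

end FunctionSpaces

/-! ### The forms as continuous multilinear maps -/

section Forms

set_option maxSynthPendingDepth 6

variable {d : ℕ} {D : PhysDomain d}

/-- The inner product of a real inner product space as a continuous bilinear map. -/
noncomputable def innerCLM (E : Type*) [NormedAddCommGroup E] [InnerProductSpace ℝ E] :
    E →L[ℝ] E →L[ℝ] ℝ :=
  (innerₗ E).mkContinuous₂ 1 fun u v => by
    rw [one_mul]
    exact norm_inner_le_norm u v

/-- `(A, G) ↦ A ∇u` for `∇u` read from the Jacobian `G` by the convention `c`, the result written
as a Jacobian again. -/
noncomputable def matMulCLM (c : GradConvention) (d : ℕ) : Mat d d →L[ℝ] Mat d d →L[ℝ] Mat d d :=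
  LinearMap.toContinuousBilinearMap <| LinearMap.mk₂ ℝ
    (fun A G => WithLp.toLp 2 fun ij => c.apply (A.toMatrix * c.apply G.toMatrix) ij.1 ij.2)
    (fun A A' G => by
      ext ij
      cases c <;> simp [GradConvention.apply, Mat.toMatrix, Matrix.mul_apply, add_mul,
        Finset.sum_add_distrib])
    (fun r A G => by
      ext ij
      cases c <;> simp [GradConvention.apply, Mat.toMatrix, Matrix.mul_apply, mul_assoc,
        Finset.mul_sum])
    (fun A G G' => by
      ext ij
      cases c <;> simp [GradConvention.apply, Mat.toMatrix, Matrix.mul_apply, mul_add,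
        Finset.sum_add_distrib])
    (fun r A G => by
      ext ij
      cases c <;> simp [GradConvention.apply, Mat.toMatrix, Matrix.mul_apply, mul_left_comm,
        Finset.mul_sum])

theorem matMulCLM_apply (c : GradConvention) (A G : Mat d d) (ij : Fin d × Fin d) :
    matMulCLM c d A G ij = c.apply (A.toMatrix * c.apply G.toMatrix) ij.1 ij.2 := rfl

theorem inner_matMulCLM (c : GradConvention) (A G G' : Mat d d) :
    inner ℝ (matMulCLM c d A G) G' =
      ((c.apply G.toMatrix).transpose * A.toMatrix.transpose * c.apply G'.toMatrix).trace := by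
  rw [← Matrix.transpose_mul, PiLp.inner_apply]
  simp only [matMulCLM_apply, RCLike.inner_apply, conj_trivial]
  cases c
  · simp only [GradConvention.apply, Matrix.trace, Matrix.diag, Matrix.mul_apply,
      Matrix.transpose_apply]
    rw [Fintype.sum_prod_type, Finset.sum_comm]
    refine Finset.sum_congr rfl fun i _ => Finset.sum_congr rfl fun j _ => mul_comm _ _
  · simp only [GradConvention.apply, Matrix.trace, Matrix.diag, Matrix.mul_apply,
      Matrix.transpose_apply]
    rw [Fintype.sum_prod_type]
    refine Finset.sum_congr rfl fun i _ => Finset.sum_congr rfl fun j _ => mul_comm _ _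

/-- `(B, G) ↦ tr(G B)`. -/
noncomputable def traceMulCLM (d : ℕ) : Mat d d →L[ℝ] Mat d d →L[ℝ] ℝ :=
  LinearMap.toContinuousBilinearMap <| LinearMap.mk₂ ℝ
    (fun B G => (G.toMatrix * B.toMatrix).trace)
    (fun B B' G => by
      simp [Mat.toMatrix, Matrix.trace, Matrix.mul_apply, mul_add, Finset.sum_add_distrib])
    (fun r B G => by
      simp [Mat.toMatrix, Matrix.trace, Matrix.mul_apply, mul_left_comm, Finset.mul_sum])
    (fun B G G' => by
      simp [Mat.toMatrix, Matrix.trace, Matrix.mul_apply, add_mul, Finset.sum_add_distrib])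
    (fun r B G => by
      simp [Mat.toMatrix, Matrix.trace, Matrix.mul_apply, mul_assoc, Finset.mul_sum])

theorem traceMulCLM_apply (B G : Mat d d) :
    traceMulCLM d B G = (G.toMatrix * B.toMatrix).trace := rfl

/-- The product of a matrix with a vector. -/
noncomputable def mulVecCLM (d : ℕ) : Mat d d →L[ℝ] Vec d →L[ℝ] Vec d :=
  LinearMap.mkContinuous₂ (LinearMap.mk₂ ℝ
    (fun M v => WithLp.toLp 2 (M.toMatrix.mulVec v.ofLp))
    (fun M M' v => by
      ext i
      simp [Mat.toMatrix, Matrix.mulVec, dotProduct, add_mul, Finset.sum_add_distrib])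
    (fun r M v => by
      ext i
      simp [Mat.toMatrix, Matrix.mulVec, dotProduct, mul_assoc, Finset.mul_sum])
    (fun M v v' => by
      ext i
      simp [Mat.toMatrix, Matrix.mulVec, dotProduct, mul_add, Finset.sum_add_distrib])
    (fun r M v => by
      ext i
      simp [Mat.toMatrix, Matrix.mulVec, dotProduct, mul_left_comm, Finset.mul_sum])) 1
    fun M v => by
      -- Cauchy–Schwarz in each row
      rw [one_mul]
      refine (pow_le_pow_iff_left₀ (norm_nonneg _) (by positivity) two_ne_zero).1 ?_
      rw [mul_pow, EuclideanSpace.norm_sq_eq, EuclideanSpace.norm_sq_eq M,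
        EuclideanSpace.norm_sq_eq v, Fintype.sum_prod_type, Finset.sum_mul]
      refine Finset.sum_le_sum fun i _ => ?_
      simp only [Real.norm_eq_abs, sq_abs]
      exact Finset.sum_mul_sq_le_sq_mul_sq Finset.univ (fun j => M (i, j)) fun j => v j

theorem mulVecCLM_apply (M : Mat d d) (v : Vec d) :
    mulVecCLM d M v = WithLp.toLp 2 (M.toMatrix.mulVec v.ofLp) := rfl

theorem norm_mulVecCLM_le : ‖mulVecCLM d‖ ≤ 1 :=
  LinearMap.mkContinuous₂_norm_le _ zero_le_one _

/-- The matrix `w zᵀ`. -/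
noncomputable def outerCLM (d : ℕ) : Vec d →L[ℝ] Vec d →L[ℝ] Mat d d :=
  LinearMap.mkContinuous₂ (LinearMap.mk₂ ℝ
    (fun w z => WithLp.toLp 2 fun ij => w ij.1 * z ij.2)
    (fun w w' z => by ext; simp [add_mul])
    (fun r w z => by ext; simp [mul_assoc])
    (fun w z z' => by ext; simp [mul_add])
    (fun r w z => by ext; simp [mul_left_comm])) 1
    fun w z => by
      rw [one_mul]
      refine (pow_le_pow_iff_left₀ (norm_nonneg _) (by positivity) two_ne_zero).1 (le_of_eq ?_)
      rw [mul_pow, EuclideanSpace.norm_sq_eq, EuclideanSpace.norm_sq_eq w,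
        EuclideanSpace.norm_sq_eq z, Fintype.sum_prod_type, Finset.sum_mul_sum]
      simp [mul_pow]

theorem outerCLM_apply (w z : Vec d) (ij : Fin d × Fin d) :
    outerCLM d w z ij = w ij.1 * z ij.2 := rfl

theorem norm_outerCLM_le : ‖outerCLM d‖ ≤ 1 :=
  LinearMap.mkContinuous₂_norm_le _ zero_le_one _

theorem inner_outerCLM (G M : Mat d d) (u w : Vec d) :
    inner ℝ G (outerCLM d w (mulVecCLM d M u)) =
      dotProduct (G.toMatrix.mulVec (M.toMatrix.mulVec u.ofLp)) w.ofLp := by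
  rw [PiLp.inner_apply, Fintype.sum_prod_type]
  simp only [outerCLM_apply, mulVecCLM_apply, RCLike.inner_apply, conj_trivial, dotProduct]
  refine Finset.sum_congr rfl fun i _ => ?_
  rw [Matrix.mulVec, dotProduct, Finset.sum_mul]
  refine Finset.sum_congr rfl fun j _ => ?_
  simp only [Mat.toMatrix, Matrix.of_apply]
  ring

instance : ENNReal.HolderTriple ∞ 2 2 := ⟨by simp⟩

instance : ENNReal.HolderTriple ∞ 4 4 := ⟨by simp⟩

instance : ENNReal.HolderTriple 4 4 2 := ⟨by
  rw [← two_mul, show (4 : ℝ≥0∞) = 2 * 2 by norm_num,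
    ENNReal.mul_inv (by simp) (by simp), ← mul_assoc, ENNReal.mul_inv_cancel (by simp) (by simp),
    one_mul]⟩

section Builders

variable {E V W Z P : Type*} [NormedAddCommGroup E] [NormedSpace ℝ E] [NormedAddCommGroup V]
  [NormedSpace ℝ V] [NormedAddCommGroup W] [NormedSpace ℝ W] [NormedAddCommGroup Z]
  [NormedSpace ℝ Z] [NormedAddCommGroup P] [NormedSpace ℝ P]

/-- The trilinear form `(e, v, p) ↦ ψ(T(e, g(v)), p)`. -/
noncomputable def trilinCLM (T : E →L[ℝ] W →L[ℝ] Z) (g : V →L[ℝ] W) (ψ : Z →L[ℝ] P →L[ℝ] ℝ) :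
    E →L[ℝ] V →L[ℝ] P →L[ℝ] ℝ :=
  (ContinuousLinearMap.compL ℝ V Z (P →L[ℝ] ℝ) ψ) ∘L
    ((ContinuousLinearMap.compL ℝ V W Z).flip g) ∘L T

/-- The form `(e, u, v, w) ↦ ψ(g(v), O(j(w), T(e, j(u))))`. -/
noncomputable def quadrilinCLM (T : E →L[ℝ] W →L[ℝ] W) (j : V →L[ℝ] W) (g : V →L[ℝ] Z)
    (O : W →L[ℝ] W →L[ℝ] Z) (ψ : Z →L[ℝ] Z →L[ℝ] ℝ) :
    E →L[ℝ] V →L[ℝ] V →L[ℝ] V →L[ℝ] ℝ :=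
  (ContinuousLinearMap.compL ℝ V W (V →L[ℝ] V →L[ℝ] ℝ)
    ((ContinuousLinearMap.compL ℝ V Z ℝ).bilinearComp (ψ ∘L g)
      (O.bilinearComp j (ContinuousLinearMap.id ℝ W)).flip).flip) ∘L
    ((ContinuousLinearMap.compL ℝ V W W).flip j) ∘L T

end Builders

/-- `a(u, v; A)` as a continuous trilinear form in `(A, u, v)`. -/
noncomputable def formACLM (c : GradConvention) (D : PhysDomain d) :
    MatField D →L[ℝ] H10 D d →L[ℝ] H10 D d →L[ℝ] ℝ :=
  trilinCLM ((matMulCLM c d).holderL D.vol ∞ 2 2) (H10.gradL D d)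
    ((innerCLM (Lp (Mat d d) 2 D.vol)).bilinearComp (ContinuousLinearMap.id ℝ _) (H10.gradL D d))

theorem formACLM_apply (c : GradConvention) (A : MatField D) (u v : H10 D d) :
    formACLM c D A u v = formA c A u v := by
  change inner ℝ ((matMulCLM c d).holder 2 A u.grad) v.grad = _
  rw [L2.inner_def, formA]
  refine integral_congr_ae ?_
  filter_upwards [(matMulCLM c d).coeFn_holder (r := 2) A u.grad] with x hx
  rw [hx, inner_matMulCLM]

/-- `b(v, p; B)` as a continuous trilinear form in `(B, v, p)`. -/
noncomputable def formBCLM (D : PhysDomain d) :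
    MatField D →L[ℝ] H10 D d →L[ℝ] L20 D →L[ℝ] ℝ :=
  trilinCLM ((traceMulCLM d).holderL D.vol ∞ 2 2) (H10.gradL D d)
    (-(innerCLM (Lp ℝ 2 D.vol)).bilinearComp (ContinuousLinearMap.id ℝ _) (L20 D).subtypeL)

theorem formBCLM_apply (B : MatField D) (v : H10 D d) (p : L20 D) :
    formBCLM D B v p = formB B v p := by
  change -inner ℝ ((traceMulCLM d).holder 2 B v.grad) (p : Lp ℝ 2 D.vol) = _
  rw [L2.inner_def, formB]
  congr 1
  refine integral_congr_ae ?_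
  filter_upwards [(traceMulCLM d).coeFn_holder (r := 2) B v.grad] with x hx
  rw [hx, traceMulCLM_apply, Matrix.mul_smul, Matrix.trace_smul, RCLike.inner_apply, conj_trivial,
    smul_eq_mul]

/-- `m(u, v, w; M)` as a continuous multilinear form in `(M, u, v, w)`. -/
noncomputable def formMCLM {C₄ : ℝ} (hC : IsL4EmbeddingConst D C₄) :
    MatField D →L[ℝ] H10 D d →L[ℝ] H10 D d →L[ℝ] H10 D d →L[ℝ] ℝ :=
  quadrilinCLM ((mulVecCLM d).holderL D.vol ∞ 4 4) (H10.toL4 hC d) (H10.gradL D d)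
    ((outerCLM d).holderL D.vol 4 4 2) (innerCLM (Lp (Mat d d) 2 D.vol))

theorem formMCLM_eq_inner {C₄ : ℝ} (hC : IsL4EmbeddingConst D C₄) (M : MatField D)
    (u v w : H10 D d) :
    formMCLM hC M u v w = inner ℝ v.grad ((outerCLM d).holder 2 (H10.toL4 hC d w)
      ((mulVecCLM d).holder 4 M (H10.toL4 hC d u))) := rfl

theorem formMCLM_apply {C₄ : ℝ} (hC : IsL4EmbeddingConst D C₄) (M : MatField D)
    (u v w : H10 D d) : formMCLM hC M u v w = formM M u v w := by
  rw [formMCLM_eq_inner, L2.inner_def, formM]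
  refine integral_congr_ae ?_
  filter_upwards [(outerCLM d).coeFn_holder (r := 2) (H10.toL4 hC d w)
      ((mulVecCLM d).holder 4 M (H10.toL4 hC d u)),
    (mulVecCLM d).coeFn_holder (r := 4) M (H10.toL4 hC d u), H10.coeFn_toL4 hC u,
    H10.coeFn_toL4 hC w] with x h1 h2 h3 h4
  rw [h1, h2, h3, h4, inner_outerCLM]

/-- `|m(u, v, w; M)| ≤ C₄² ‖M‖ ‖u‖ ‖v‖ ‖w‖`. -/
theorem abs_formMCLM_le {C₄ : ℝ} (hC : IsL4EmbeddingConst D C₄) (M : MatField D)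
    (u v w : H10 D d) :
    |formMCLM hC M u v w| ≤ C₄ ^ 2 * ‖M‖ * ‖u‖ * ‖v‖ * ‖w‖ := by
  rw [formMCLM_eq_inner]
  have h0 := hC.1.le
  have h1 := H10.norm_toL4_le hC u
  have h2 := H10.norm_toL4_le hC w
  set u4 := H10.toL4 hC d u
  set w4 := H10.toL4 hC d w
  have h3 : ‖(mulVecCLM d).holder 4 M u4‖ ≤ ‖M‖ * ‖u4‖ := by
    refine ((mulVecCLM d).norm_holder_apply_apply_le (r := 4) M u4).trans ?_
    rw [mul_assoc]
    exact mul_le_of_le_one_left (by positivity) norm_mulVecCLM_le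
  have h4 : ‖(outerCLM d).holder 2 w4 ((mulVecCLM d).holder 4 M u4)‖ ≤
      ‖w4‖ * ‖(mulVecCLM d).holder 4 M u4‖ := by
    refine ((outerCLM d).norm_holder_apply_apply_le (r := 2) w4 _).trans ?_
    rw [mul_assoc]
    exact mul_le_of_le_one_left (by positivity) norm_outerCLM_le
  calc _ ≤ ‖v.grad‖ * ‖(outerCLM d).holder 2 w4 ((mulVecCLM d).holder 4 M u4)‖ :=
        abs_real_inner_le_norm _ _
    _ ≤ ‖v‖ * ((C₄ * ‖w‖) * (‖M‖ * (C₄ * ‖u‖))) := by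
        rw [H10.norm_grad]
        gcongr
        refine h4.trans ?_
        gcongr
        refine h3.trans ?_
        gcongr
    _ = _ := by ring

end Forms

/-! ### Mixed problems with a quadratic term -/

section MixedProblem

set_option maxSynthPendingDepth 6

variable {V P : Type*} [NormedAddCommGroup V] [InnerProductSpace ℝ V] [NormedAddCommGroup P]
  [InnerProductSpace ℝ P]

/-- `a ↦ ((u, p) ↦ (a(u, ·), 0))`. -/
noncomputable def mixedLinA (V P : Type*) [NormedAddCommGroup V] [InnerProductSpace ℝ V]
    [NormedAddCommGroup P] [InnerProductSpace ℝ P] :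
    (V →L[ℝ] V →L[ℝ] ℝ) →L[ℝ] (V × P →L[ℝ] (V →L[ℝ] ℝ) × (P →L[ℝ] ℝ)) :=
  (ContinuousLinearMap.compL ℝ (V × P) (V →L[ℝ] ℝ) ((V →L[ℝ] ℝ) × (P →L[ℝ] ℝ))
    (ContinuousLinearMap.inl ℝ _ _)) ∘L
    ((ContinuousLinearMap.compL ℝ (V × P) V (V →L[ℝ] ℝ)).flip (ContinuousLinearMap.fst ℝ V P))

theorem mixedLinA_apply (a : V →L[ℝ] V →L[ℝ] ℝ) (x : V × P) :
    mixedLinA V P a x = (a x.1, 0) := rfl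

/-- `b ↦ ((u, p) ↦ (-b(·, p), b(u, ·)))`. -/
noncomputable def mixedLinB (V P : Type*) [NormedAddCommGroup V] [InnerProductSpace ℝ V]
    [NormedAddCommGroup P] [InnerProductSpace ℝ P] :
    (V →L[ℝ] P →L[ℝ] ℝ) →L[ℝ] (V × P →L[ℝ] (V →L[ℝ] ℝ) × (P →L[ℝ] ℝ)) :=
  (ContinuousLinearMap.compL ℝ (V × P) (P →L[ℝ] ℝ) ((V →L[ℝ] ℝ) × (P →L[ℝ] ℝ))
      (ContinuousLinearMap.inr ℝ _ _)) ∘L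
    ((ContinuousLinearMap.compL ℝ (V × P) V (P →L[ℝ] ℝ)).flip (ContinuousLinearMap.fst ℝ V P)) -
  (ContinuousLinearMap.compL ℝ (V × P) (V →L[ℝ] ℝ) ((V →L[ℝ] ℝ) × (P →L[ℝ] ℝ))
      (ContinuousLinearMap.inl ℝ _ _)) ∘L
    ((ContinuousLinearMap.compL ℝ (V × P) P (V →L[ℝ] ℝ)).flip (ContinuousLinearMap.snd ℝ V P)) ∘L
    flipCLM V P ℝ

theorem mixedLinB_apply (b : V →L[ℝ] P →L[ℝ] ℝ) (x : V × P) :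
    mixedLinB V P b x = (-b.flip x.2, b x.1) := by
  change ((0 : V →L[ℝ] ℝ), b x.1) - (b.flip x.2, (0 : P →L[ℝ] ℝ)) = _
  ext1 <;> simp

/-- `m ↦ ((u, p), (v, q) ↦ (m(u, v, ·), 0))`. -/
noncomputable def mixedQuad (V P : Type*) [NormedAddCommGroup V] [InnerProductSpace ℝ V]
    [NormedAddCommGroup P] [InnerProductSpace ℝ P] :
    (V →L[ℝ] V →L[ℝ] V →L[ℝ] ℝ) →L[ℝ]
      (V × P →L[ℝ] V × P →L[ℝ] (V →L[ℝ] ℝ) × (P →L[ℝ] ℝ)) :=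
  (ContinuousLinearMap.compL ℝ (V × P) (V →L[ℝ] V →L[ℝ] ℝ)
      (V × P →L[ℝ] (V →L[ℝ] ℝ) × (P →L[ℝ] ℝ)) (mixedLinA V P)) ∘L
    ((ContinuousLinearMap.compL ℝ (V × P) V (V →L[ℝ] V →L[ℝ] ℝ)).flip
      (ContinuousLinearMap.fst ℝ V P))

theorem mixedQuad_apply (m : V →L[ℝ] V →L[ℝ] V →L[ℝ] ℝ) (x x' : V × P) :
    mixedQuad V P m x x' = (m x.1 x'.1, 0) := rfl

/-- The stability constant of the linearised mixed problem. -/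
noncomputable def mixedConst (α β N : ℝ) : ℝ :=
  max (saddleConst α β N) ((N * saddleConst α β N + 1) / β)

/-- The Oseen form `a(u, v) + m(u, z, v) + m(z', u, v)`: the problem linearised between the
velocities `z` and `z'`. -/
noncomputable def oseenForm (a : V →L[ℝ] V →L[ℝ] ℝ) (m : V →L[ℝ] V →L[ℝ] V →L[ℝ] ℝ) (z z' : V) :
    V →L[ℝ] V →L[ℝ] ℝ :=
  a + m.flip z + m z'

theorem oseenForm_apply (a : V →L[ℝ] V →L[ℝ] ℝ) (m : V →L[ℝ] V →L[ℝ] V →L[ℝ] ℝ) (z z' u : V) :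
    oseenForm a m z z' u = a u + m u z + m z' u := rfl

section

variable {a : V →L[ℝ] V →L[ℝ] ℝ} {b : V →L[ℝ] P →L[ℝ] ℝ} {m : V →L[ℝ] V →L[ℝ] V →L[ℝ] ℝ}
  {α β γ μ N : ℝ} {z z' : V}

theorem oseenForm_coercive (ha : ∀ u, α * ‖u‖ ^ 2 ≤ a u u)
    (hm : ∀ u v w, |m u v w| ≤ μ * ‖u‖ * ‖v‖ * ‖w‖) (hμ : 0 ≤ μ)
    (hz : ‖z‖ ≤ γ) (hz' : ‖z'‖ ≤ γ) (u : V) :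
    (α - 2 * μ * γ) * ‖u‖ ^ 2 ≤ oseenForm a m z z' u u := by
  have h1 := ha u
  have h2 : -(m u z u) ≤ μ * γ * ‖u‖ ^ 2 := by
    refine (neg_le_abs _).trans ((hm u z u).trans ?_)
    calc μ * ‖u‖ * ‖z‖ * ‖u‖ ≤ μ * ‖u‖ * γ * ‖u‖ := by gcongr
      _ = _ := by ring
  have h3 : -(m z' u u) ≤ μ * γ * ‖u‖ ^ 2 := by
    refine (neg_le_abs _).trans ((hm z' u u).trans ?_)
    calc μ * ‖z'‖ * ‖u‖ * ‖u‖ ≤ μ * γ * ‖u‖ * ‖u‖ := by gcongr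
      _ = _ := by ring
  rw [oseenForm_apply, add_apply, add_apply]
  linarith

theorem norm_oseenForm_le (haN : ‖a‖ ≤ N) (hm : ∀ u v w, |m u v w| ≤ μ * ‖u‖ * ‖v‖ * ‖w‖)
    (hμ : 0 ≤ μ) (hz : ‖z‖ ≤ γ) (hz' : ‖z'‖ ≤ γ) :
    ‖oseenForm a m z z'‖ ≤ N + 2 * μ * γ := by
  have hγ : 0 ≤ γ := (norm_nonneg z).trans hz
  have h1 : ‖m.flip z‖ ≤ μ * γ := by
    refine ContinuousLinearMap.opNorm_le_bound₂ _ (by positivity) fun u w => ?_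
    refine (hm u z w).trans ?_
    calc μ * ‖u‖ * ‖z‖ * ‖w‖ ≤ μ * ‖u‖ * γ * ‖w‖ := by gcongr
      _ = _ := by ring
  have h2 : ‖m z'‖ ≤ μ * γ := by
    refine ContinuousLinearMap.opNorm_le_bound₂ _ (by positivity) fun u w => ?_
    refine (hm z' u w).trans ?_
    gcongr
  calc ‖oseenForm a m z z'‖ ≤ ‖a‖ + ‖m.flip z‖ + ‖m z'‖ := norm_add₃_le
    _ ≤ _ := by linarith

end

/-- A solution of the mixed problem with `‖u‖ ≤ γ < α / (2μ)` is a stable quadratic family: the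
linearised operators are saddle point problems with the Oseen forms, which are coercive with
constant `α - 2μγ`. -/
theorem stableQuadraticFamily_mixed [CompleteSpace V] [CompleteSpace P] {ι : Type*}
    [DecidableEq ι] {U : Set (ι → ℝ)}
    {L : (ι → ℝ) → V × P →L[ℝ] (V →L[ℝ] ℝ) × (P →L[ℝ] ℝ)}
    {Q : (ι → ℝ) → V × P →L[ℝ] V × P →L[ℝ] (V →L[ℝ] ℝ) × (P →L[ℝ] ℝ)}
    {F : (ι → ℝ) → (V →L[ℝ] ℝ) × (P →L[ℝ] ℝ)}
    {a : (ι → ℝ) → V →L[ℝ] V →L[ℝ] ℝ} {b : (ι → ℝ) → V →L[ℝ] P →L[ℝ] ℝ}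
    {m : (ι → ℝ) → V →L[ℝ] V →L[ℝ] V →L[ℝ] ℝ} {α β γ μ N : ℝ} (hμ : 0 ≤ μ)
    (hα : 2 * μ * γ < α) (hβ : 0 < β)
    (hL : ∀ y, L y = mixedLinA V P (a y) + mixedLinB V P (b y))
    (hQ : ∀ y, Q y = mixedQuad V P (m y))
    (hLs : PartialSmoothOn U L) (hQs : PartialSmoothOn U Q) (hFs : PartialSmoothOn U F)
    (ha : ∀ y ∈ U, ∀ u, α * ‖u‖ ^ 2 ≤ a y u u) (haN : ∀ y ∈ U, ‖a y‖ ≤ N)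
    (hb : ∀ y ∈ U, ∀ p, β * ‖p‖ ≤ ‖(b y).flip p‖)
    (hm : ∀ y ∈ U, ∀ u v w, |m y u v w| ≤ μ * ‖u‖ * ‖v‖ * ‖w‖)
    {u : (ι → ℝ) → V} {p : (ι → ℝ) → P} (hu : ∀ y ∈ U, ‖u y‖ ≤ γ)
    (h1 : ∀ y ∈ U, a y (u y) + m y (u y) (u y) - (b y).flip (p y) = (F y).1)
    (h2 : ∀ y ∈ U, b y (u y) = (F y).2) :
    StableQuadraticFamily U L Q F (mixedConst (α - 2 * μ * γ) β (N + 2 * μ * γ))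
      (fun y => (u y, p y)) := by
  have hS : ∀ y y' (x : V × P), L y' x + Q y' x (u y, p y) + Q y' (u y', p y') x =
      (oseenForm (a y') (m y') (u y) (u y') x.1 - (b y').flip x.2, b y' x.1) := by
    intro y y' x
    rw [hL, hQ, add_apply, mixedLinA_apply, mixedLinB_apply, mixedQuad_apply, mixedQuad_apply,
      oseenForm_apply]
    ext1
    · simp only [Prod.fst_add]
      abel
    · simp
  have hα' : 0 < α - 2 * μ * γ := by linarith
  refine ⟨hLs, hQs, hFs, fun y hy => ?_, fun y hy y' hy' x => ?_, fun y hy y' hy' => ?_⟩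
  · rw [hL, hQ, add_apply, mixedLinA_apply, mixedLinB_apply, mixedQuad_apply]
    ext1
    · rw [← h1 y hy]
      simp only [Prod.fst_add]
      abel
    · rw [← h2 y hy]
      simp
  · rw [hS]
    set r := ‖(oseenForm (a y') (m y') (u y) (u y') x.1 - (b y').flip x.2, b y' x.1)‖
    have hr : 0 ≤ r := norm_nonneg _
    have h3 := saddlePoint_norm_le hα' hβ (norm_oseenForm_le (haN y' hy') (hm y' hy') hμ (hu y hy)
      (hu y' hy')) (oseenForm_coercive (ha y' hy') (hm y' hy') hμ (hu y hy) (hu y' hy'))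
      (hb y' hy') x.1 x.2 (norm_fst_le _ : _ ≤ r) (norm_snd_le _ : _ ≤ r)
    refine norm_prod_le_iff.2 ⟨h3.1.trans ?_, h3.2.trans ?_⟩
    · exact mul_le_mul_of_nonneg_right (le_max_left _ _) hr
    · exact mul_le_mul_of_nonneg_right (le_max_right _ _) hr
  · intro φ
    obtain ⟨v, q, h3, h4⟩ := exists_saddlePoint_solution hα' hβ
      (oseenForm_coercive (ha y' hy') (hm y' hy') hμ (hu y hy) (hu y' hy')) (hb y' hy') φ.1 φ.2
    refine ⟨(v, q), ?_⟩
    dsimp only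
    rw [hS]
    exact Prod.ext h3 h4

section Stationary

variable {a : V →L[ℝ] V →L[ℝ] ℝ} {b : V →L[ℝ] P →L[ℝ] ℝ} {m : V →L[ℝ] V →L[ℝ] V →L[ℝ] ℝ}
  {α β γ μ : ℝ}

/-- Uniqueness in the ball of radius `γ < α / (2μ)`: the difference of two solutions is in the
kernel of `b`, and the Oseen form is coercive. -/
theorem mixedProblem_unique (hμ : 0 ≤ μ) (hα : 2 * μ * γ < α) (hβ : 0 < β)
    (ha : ∀ u, α * ‖u‖ ^ 2 ≤ a u u) (hb : ∀ p, β * ‖p‖ ≤ ‖b.flip p‖)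
    (hm : ∀ u v w, |m u v w| ≤ μ * ‖u‖ * ‖v‖ * ‖w‖) {φ : V →L[ℝ] ℝ} {ψ : P →L[ℝ] ℝ}
    {u u' : V} {p p' : P} (hu : ‖u‖ ≤ γ) (hu' : ‖u'‖ ≤ γ)
    (h1 : a u + m u u - b.flip p = φ) (h2 : b u = ψ)
    (h1' : a u' + m u' u' - b.flip p' = φ) (h2' : b u' = ψ) : u = u' ∧ p = p' := by
  have hdiff : oseenForm a m u u' (u - u') = b.flip (p - p') := by
    have h3 := h1.trans h1'.symm
    rw [oseenForm_apply]
    simp only [map_sub, sub_apply]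
    rw [sub_eq_sub_iff_add_eq_add] at h3
    have h4 : a u - a u' + (m u u - m u' u') = b.flip p - b.flip p' := by
      rw [sub_add_sub_comm, sub_eq_sub_iff_add_eq_add, h3]
      abel
    rw [← h4]
    abel
  have hbu : b (u - u') = 0 := by rw [map_sub, h2, h2', sub_self]
  have hw : u - u' = 0 := by
    have h3 := oseenForm_coercive ha hm hμ hu hu' (u - u')
    rw [hdiff, ContinuousLinearMap.flip_apply, hbu, zero_apply] at h3
    by_contra hne
    have : 0 < (α - 2 * μ * γ) * ‖u - u'‖ ^ 2 := by
      have := norm_pos_iff.2 hne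
      have : 0 < α - 2 * μ * γ := by linarith
      positivity
    linarith
  refine ⟨sub_eq_zero.1 hw, sub_eq_zero.1 ?_⟩
  have h3 := hb (p - p')
  rw [← hdiff, hw, map_zero, norm_zero] at h3
  exact norm_le_zero_iff.1 (nonpos_of_mul_nonpos_right h3 hβ)

/-- Existence by the contraction principle. The iteration `û ↦ u` solves the linear saddle point
problem with `m(û, û, ·)` on the right. It maps the ball of radius `γ` to itself, since
`u - w` lies in the kernel of `b` and is there controlled by `a`, the lifting `w` being
`a`-orthogonal to the kernel; the difference of two iterates lies in the kernel as well, which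
gives the contraction constant `2μγ/α`. -/
theorem exists_mixedProblem_solution [CompleteSpace V] [CompleteSpace P] (hμ : 0 ≤ μ)
    (hγ : 0 ≤ γ) (hα0 : 0 < α) (hα : 2 * μ * γ < α) (hβ : 0 < β)
    (ha : ∀ u, α * ‖u‖ ^ 2 ≤ a u u) (hb : ∀ p, β * ‖p‖ ≤ ‖b.flip p‖)
    (hm : ∀ u v w, |m u v w| ≤ μ * ‖u‖ * ‖v‖ * ‖w‖) {φ : V →L[ℝ] ℝ} {ψ : P →L[ℝ] ℝ}
    {w : V} (hw : b w = ψ) (horth : ∀ v, b v = 0 → a w v = 0)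
    (hsize : ‖w‖ + (‖φ‖ + μ * γ ^ 2) / α ≤ γ) :
    ∃ u p, a u + m u u - b.flip p = φ ∧ b u = ψ ∧ ‖u‖ ≤ γ := by
  choose T π hT1 hT2 using fun z : V => exists_saddlePoint_solution hα0 hβ ha hb (φ - m z z) ψ
  have hker : ∀ z, b (T z - w) = 0 := fun z => by rw [map_sub, hT2, hw, sub_self]
  have hball : ∀ z, ‖z‖ ≤ γ → ‖T z‖ ≤ γ := by
    intro z hz
    set v := T z - w
    have h1 : a v v = φ v - m z z v := by
      have h2 := DFunLike.congr_fun (hT1 z) v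
      rw [sub_apply, sub_apply, ContinuousLinearMap.flip_apply, hker, zero_apply, sub_zero] at h2
      have h3 : a v v = a (T z) v - a w v := by rw [← sub_apply, ← map_sub]
      rw [h3, horth v (hker z), sub_zero, h2]
    have h2 : α * ‖v‖ ^ 2 ≤ (‖φ‖ + μ * γ ^ 2) * ‖v‖ := by
      refine (ha v).trans ?_
      rw [h1]
      have h3 : φ v ≤ ‖φ‖ * ‖v‖ := (le_abs_self _).trans (φ.le_opNorm v)
      have h4 : -(m z z v) ≤ μ * γ ^ 2 * ‖v‖ := by
        refine (neg_le_abs _).trans ((hm z z v).trans ?_)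
        calc μ * ‖z‖ * ‖z‖ * ‖v‖ ≤ μ * γ * γ * ‖v‖ := by gcongr
          _ = _ := by ring
      linarith
    have h3 : ‖v‖ ≤ (‖φ‖ + μ * γ ^ 2) / α := by
      rw [le_div_iff₀ hα0]
      rcases (norm_nonneg v).eq_or_lt with h0 | h0
      · rw [← h0, zero_mul]
        positivity
      · exact le_of_mul_le_mul_right (by linarith [sq ‖v‖] : ‖v‖ * α * ‖v‖ ≤ _) h0
    calc ‖T z‖ = ‖w + v‖ := by rw [add_sub_cancel]
      _ ≤ ‖w‖ + ‖v‖ := norm_add_le _ _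
      _ ≤ γ := by linarith
  have hcontr : ∀ z z', ‖z‖ ≤ γ → ‖z'‖ ≤ γ → ‖T z - T z'‖ ≤ 2 * μ * γ / α * ‖z - z'‖ := by
    intro z z' hz hz'
    set v := T z - T z'
    have hv : b v = 0 := by rw [map_sub, hT2, hT2, sub_self]
    have h1 : a v v = -(m (z - z') z v + m z' (z - z') v) := by
      have h2 := DFunLike.congr_fun (hT1 z) v
      have h3 := DFunLike.congr_fun (hT1 z') v
      simp only [sub_apply, ContinuousLinearMap.flip_apply, hv, zero_apply, sub_zero] at h2 h3
      have h4 : a v v = a (T z) v - a (T z') v := by rw [← sub_apply, ← map_sub]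
      rw [h4, h2, h3]
      simp only [map_sub, sub_apply]
      ring
    have h2 : α * ‖v‖ ^ 2 ≤ 2 * μ * γ * ‖z - z'‖ * ‖v‖ := by
      refine (ha v).trans ?_
      rw [h1]
      have h3 : -(m (z - z') z v) ≤ μ * γ * ‖z - z'‖ * ‖v‖ := by
        refine (neg_le_abs _).trans ((hm _ _ _).trans ?_)
        calc μ * ‖z - z'‖ * ‖z‖ * ‖v‖ ≤ μ * ‖z - z'‖ * γ * ‖v‖ := by gcongr
          _ = _ := by ring
      have h4 : -(m z' (z - z') v) ≤ μ * γ * ‖z - z'‖ * ‖v‖ := by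
        refine (neg_le_abs _).trans ((hm _ _ _).trans ?_)
        gcongr
      linarith
    rw [div_mul_eq_mul_div, le_div_iff₀ hα0]
    rcases (norm_nonneg v).eq_or_lt with h0 | h0
    · rw [← h0, zero_mul]
      positivity
    · exact le_of_mul_le_mul_right (by linarith [sq ‖v‖] : ‖v‖ * α * ‖v‖ ≤ _) h0
  have hmaps : MapsTo T (Metric.closedBall 0 γ) (Metric.closedBall 0 γ) := fun z hz => by
    rw [mem_closedBall_zero_iff] at hz ⊢
    exact hball z hz
  have hq : 0 ≤ 2 * μ * γ / α := by positivity
  have hcw : ContractingWith (2 * μ * γ / α).toNNReal hmaps.restrict := by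
    refine ⟨?_, LipschitzWith.of_dist_le_mul fun z z' => ?_⟩
    · rw [← NNReal.coe_lt_coe, Real.coe_toNNReal _ hq, NNReal.coe_one, div_lt_one hα0]
      exact hα
    · rw [Real.coe_toNNReal _ hq, Subtype.dist_eq, Subtype.dist_eq, dist_eq_norm, dist_eq_norm]
      exact hcontr z z' (mem_closedBall_zero_iff.1 z.2) (mem_closedBall_zero_iff.1 z'.2)
  obtain ⟨u, hu, hfix, -⟩ := hcw.exists_fixedPoint' Metric.isClosed_closedBall.isComplete hmaps
    (Metric.mem_closedBall_self hγ) (edist_ne_top _ _)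
  have hTu : T u = u := hfix
  refine ⟨u, π u, ?_, ?_, mem_closedBall_zero_iff.1 hu⟩
  · have h1 := hT1 u
    rw [hTu] at h1
    rw [add_sub_right_comm, h1, sub_add_cancel]
  · rw [← hTu]
    exact hT2 u

end Stationary

end MixedProblem

/-! ### Multi-indices and lists of directions -/

section MultiIndex

variable {ι : Type*} [DecidableEq ι] {U : Set (ι → ℝ)}
  {E : Type*} [NormedAddCommGroup E] [NormedSpace ℝ E]

theorem exists_multiIndex (l : List ι) : ∃ ν : ι →₀ ℕ, ∀ j, l.count j = ν j :=
  ⟨Multiset.toFinsupp (l : Multiset ι), fun j => by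
    rw [Multiset.toFinsupp_apply, Multiset.coe_count]⟩

theorem toMultiset_eq_of_count {l : List ι} {ν : ι →₀ ℕ} (h : ∀ j, l.count j = ν j) :
    Finsupp.toMultiset ν = (l : Multiset ι) := by
  ext j
  rw [Finsupp.count_toMultiset, Multiset.coe_count, h]

theorem degree_eq_length {l : List ι} {ν : ι →₀ ℕ} (h : ∀ j, l.count j = ν j) :
    ν.degree = l.length := by
  rw [← Multiset.coe_card, ← toMultiset_eq_of_count h, Finsupp.card_toMultiset,
    Finsupp.degree_apply]
  rfl

theorem prod_pow_eq_prod_map {l : List ι} {ν : ι →₀ ℕ} (h : ∀ j, l.count j = ν j) (R : ι → ℝ) :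
    (ν.prod fun j n => R j ^ n) = (l.map R).prod := by
  rw [← Multiset.prod_coe, ← Multiset.map_coe, ← toMultiset_eq_of_count h, Finsupp.toMultiset_map,
    Finsupp.prod_toMultiset, Finsupp.prod_mapDomain_index (by simp) (fun _ _ _ => pow_add _ _ _)]

theorem weight_pos {ι : Type*} {R : ι → ℝ} (hR : ∀ j, 0 < R j) (l : List ι) :
    0 < (l.map R).prod :=
  List.prod_pos fun x hx => by
    obtain ⟨j, _, rfl⟩ := List.mem_map.1 hx
    exact hR j

/-- Bounds over multi-indices are bounds over lists of directions: every list has the multi-index of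
its multiplicities. -/
theorem gevreyBound_iff {δ C : ℝ} {R : ι → ℝ} (hR : ∀ j, 0 < R j) {f : (ι → ℝ) → E} :
    GevreyBound δ C R U U f ↔
      ∀ n, DerivBound R U 0 n (fun k => C * (k.factorial : ℝ) ^ δ) f := by
  constructor
  · intro h n l _ _ y hy
    obtain ⟨ν, hν⟩ := exists_multiIndex l
    have h1 := h y hy ν l hν
    rw [degree_eq_length hν, prod_pow_eq_prod_map hν, le_div_iff₀ (weight_pos hR l)] at h1
    rwa [mul_comm]
  · intro h y hy ν l hν
    rw [degree_eq_length hν, prod_pow_eq_prod_map hν, le_div_iff₀ (weight_pos hR l), mul_comm]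
    exact h l.length l (Nat.zero_le _) le_rfl y hy

theorem weight_div {ι : Type*} (R : ι → ℝ) (s : ℝ) (l : List ι) :
    (l.map fun j => R j / s).prod = (l.map R).prod / s ^ l.length := by
  induction l with
  | nil => simp
  | cons j l ih => simp only [List.map_cons, List.prod_cons, ih, List.length_cons, pow_succ]; ring

/-- The Catalan majorant gives a Gevrey bound for a smaller sequence of radii. -/
theorem GevreyBound.of_majorant {δ ρ K₀ K : ℝ} {R : ι → ℝ} (hR : ∀ j, 0 < R j) (hρ : 1 ≤ ρ)
    (hK₀ : 0 ≤ K₀) (hK : K₀ ≤ K) {f : (ι → ℝ) → E}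
    (h : ∀ n, DerivBound R U 0 n (fun k => if k = 0 then K₀ else K * gevreyMajorant δ ρ k) f) :
    GevreyBound δ K (fun j => R j / (4 * ρ)) U U f := by
  have hρ4 : 0 < 4 * ρ := by linarith
  rw [gevreyBound_iff fun j => div_pos (hR j) hρ4]
  intro n l h1 h2 y hy
  rw [weight_div, div_mul_eq_mul_div, div_le_iff₀ (by positivity)]
  refine (h n l h1 h2 y hy).trans ?_
  have hK' : 0 ≤ K := hK₀.trans hK
  have h3 : K * gevreyMajorant δ ρ l.length ≤
      K * ((l.length.factorial : ℝ) ^ δ * (4 * ρ) ^ l.length) := by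
    gcongr
    exact gevreyMajorant_le hρ _
  dsimp only
  split_ifs with h0
  · rw [h0]
    simpa using hK
  · linarith

theorem GevreyBound.mono_const {δ C C' : ℝ} {R : ι → ℝ} (hR : ∀ j, 0 < R j) {f : (ι → ℝ) → E}
    (h : GevreyBound δ C R U U f) (hC : C ≤ C') : GevreyBound δ C' R U U f := by
  rw [gevreyBound_iff hR] at h ⊢
  exact fun n => (h n).mono_fun fun k _ _ => by gcongr

theorem GevreyBound.clm (hU : IsParamDomain U) {δ C : ℝ} {R : ι → ℝ} (hR : ∀ j, 0 < R j)
    {F : Type*} [NormedAddCommGroup F] [NormedSpace ℝ F] {f : (ι → ℝ) → E}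
    (hf : PartialSmoothOn U f) (T : E →L[ℝ] F) (h : GevreyBound δ C R U U f) :
    GevreyBound δ (‖T‖ * C) R U U (fun y => T (f y)) := by
  rw [gevreyBound_iff hR] at h ⊢
  exact fun n => ((h n).clm hU hR hf T).mono_fun fun k _ _ => (mul_assoc _ _ _).ge

theorem GevreyBound.add (hU : IsParamDomain U) {δ C C' : ℝ} {R : ι → ℝ} (hR : ∀ j, 0 < R j)
    {f g : (ι → ℝ) → E} (hf : PartialSmoothOn U f) (hg : PartialSmoothOn U g)
    (h : GevreyBound δ C R U U f) (h' : GevreyBound δ C' R U U g) :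
    GevreyBound δ (C + C') R U U (fun y => f y + g y) := by
  rw [gevreyBound_iff hR] at h h' ⊢
  exact fun n => ((h n).add hU hR hf hg (h' n)).mono_fun fun k _ _ => (add_mul _ _ _).ge

theorem GevreyBound.norm_le {δ C : ℝ} {R : ι → ℝ} {f : (ι → ℝ) → E}
    (h : GevreyBound δ C R U U f) {y : ι → ℝ} (hy : y ∈ U) : ‖f y‖ ≤ C := by
  simpa [iterPartialOn] using h y hy 0 [] (by simp)

theorem GevreyBound.gevreyClass {δ C : ℝ} {R : ι → ℝ} {f : (ι → ℝ) → E} (hC : 0 < C)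
    (hR : ∀ j, 0 < R j) (hf : PartialSmoothOn U f) (h : GevreyBound δ C R U U f) :
    GevreyClass δ U f :=
  ⟨hf, fun _ _ => ⟨univ, isOpen_univ, mem_univ _, C, hC, R, hR, fun y hy => h y hy.2⟩⟩

end MultiIndex

/-! ### Gevrey bounds for quadratic and mixed problems -/

section StableFamily

variable {ι : Type*} [DecidableEq ι] {U : Set (ι → ℝ)} {δ : ℝ} {R : ι → ℝ}
  {X Y : Type*} [NormedAddCommGroup X] [NormedSpace ℝ X] [NormedAddCommGroup Y] [NormedSpace ℝ Y]

/-- Solutions of stable quadratic families inherit the Gevrey class of the data, with bounds that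
depend on the data only through their bounds. -/
theorem StableQuadraticFamily.exists_gevreyBound [CompleteSpace X] [CompleteSpace Y]
    (hU : IsParamDomain U) (hδ : 1 ≤ δ) (hR : ∀ j, 0 < R j) {C c K₀ : ℝ} (hC : 0 ≤ C)
    (hc : 0 ≤ c) (hK₀ : 0 ≤ K₀) :
    ∃ K > 0, ∃ R' : ι → ℝ, (∀ j, 0 < R' j) ∧
      ∀ (L : (ι → ℝ) → X →L[ℝ] Y) (Q : (ι → ℝ) → X →L[ℝ] X →L[ℝ] Y) (F : (ι → ℝ) → Y)
        (x : (ι → ℝ) → X), StableQuadraticFamily U L Q F C x →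
        GevreyBound δ c R U U L → GevreyBound δ c R U U Q → GevreyBound δ c R U U F →
        (∀ y ∈ U, ‖x y‖ ≤ K₀) → PartialSmoothOn U x ∧ GevreyBound δ K R' U U x := by
  obtain ⟨K, ρ, hK, hK1, hρ, hKρ⟩ := exists_majorant_constants hC hc hK₀
  have hρ4 : 0 < 4 * ρ := by linarith
  refine ⟨K, by linarith, fun j => R j / (4 * ρ), fun j => div_pos (hR j) hρ4, ?_⟩
  intro L Q F x hx hL hQ hF hx0
  refine ⟨hx.partialSmoothOn hU, GevreyBound.of_majorant hR hρ hK₀ hK ?_⟩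
  exact hx.derivBound hU hR hδ hρ hC hc hK₀ hK hKρ ((gevreyBound_iff hR).1 hL)
    ((gevreyBound_iff hR).1 hQ) ((gevreyBound_iff hR).1 hF) hx0

theorem PartialSmoothOn.of_prodMk (hU : IsParamDomain U) {u : (ι → ℝ) → X} {p : (ι → ℝ) → Y}
    (h : PartialSmoothOn U fun y => (u y, p y)) : PartialSmoothOn U u ∧ PartialSmoothOn U p :=
  ⟨h.clm hU (ContinuousLinearMap.fst ℝ X Y), h.clm hU (ContinuousLinearMap.snd ℝ X Y)⟩

theorem GevreyBound.of_prodMk (hU : IsParamDomain U) (hR : ∀ j, 0 < R j) {C : ℝ} (hC : 0 ≤ C)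
    {u : (ι → ℝ) → X} {p : (ι → ℝ) → Y} (hs : PartialSmoothOn U fun y => (u y, p y))
    (h : GevreyBound δ C R U U fun y => (u y, p y)) :
    GevreyBound δ C R U U u ∧ GevreyBound δ C R U U p :=
  ⟨(h.clm hU hR hs (ContinuousLinearMap.fst ℝ X Y)).mono_const hR
      (mul_le_of_le_one_left hC (ContinuousLinearMap.norm_fst_le ℝ X Y)),
    (h.clm hU hR hs (ContinuousLinearMap.snd ℝ X Y)).mono_const hR
      (mul_le_of_le_one_left hC (ContinuousLinearMap.norm_snd_le ℝ X Y))⟩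

end StableFamily

section MixedGevrey

set_option maxSynthPendingDepth 6

variable {V P : Type*} [NormedAddCommGroup V] [InnerProductSpace ℝ V] [NormedAddCommGroup P]
  [InnerProductSpace ℝ P]

/-- A priori bound of the solutions of the mixed problem. -/
theorem norm_prodMk_le_of_mixed {a : V →L[ℝ] V →L[ℝ] ℝ} {b : V →L[ℝ] P →L[ℝ] ℝ}
    {m : V →L[ℝ] V →L[ℝ] V →L[ℝ] ℝ} {φ : V →L[ℝ] ℝ} {β γ μ N N' : ℝ} (hβ : 0 < β)
    (hμ : 0 ≤ μ) (hN : 0 ≤ N)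
    (ha : ‖a‖ ≤ N) (hb : ∀ p, β * ‖p‖ ≤ ‖b.flip p‖)
    (hm : ∀ u v w, |m u v w| ≤ μ * ‖u‖ * ‖v‖ * ‖w‖) (hφ : ‖φ‖ ≤ N') {u : V} {p : P}
    (hu : ‖u‖ ≤ γ) (h : a u + m u u - b.flip p = φ) :
    ‖(u, p)‖ ≤ γ + (N * γ + μ * γ * γ + N') / β := by
  have hγ : 0 ≤ γ := (norm_nonneg _).trans hu
  have hN' : 0 ≤ N' := (norm_nonneg _).trans hφ
  have h2 : ‖a u‖ ≤ N * γ := (a.le_opNorm _).trans (mul_le_mul ha hu (norm_nonneg _) hN)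
  have h3 : ‖m u u‖ ≤ μ * γ * γ := by
    refine ContinuousLinearMap.opNorm_le_bound _ (by positivity) fun w => ?_
    refine (hm u u w).trans ?_
    gcongr
  have h5 : ‖b.flip p‖ ≤ N * γ + μ * γ * γ + N' := by
    rw [show b.flip p = a u + m u u - φ by rw [← h, sub_sub_cancel]]
    exact (norm_sub_le _ _).trans (add_le_add ((norm_add_le _ _).trans (add_le_add h2 h3)) hφ)
  have h6 : ‖p‖ ≤ (N * γ + μ * γ * γ + N') / β := by
    rw [le_div_iff₀ hβ, mul_comm]
    exact (hb p).trans h5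
  refine norm_prod_le_iff.2 ⟨?_, ?_⟩
  · exact hu.trans (le_add_of_nonneg_right (by positivity))
  · exact h6.trans (le_add_of_nonneg_left hγ)

/-- Solutions of a parametric mixed problem inherit the Gevrey class of the data. -/
theorem exists_gevreyBound_mixed [CompleteSpace V] [CompleteSpace P] {ι : Type*} [DecidableEq ι]
    {U : Set (ι → ℝ)} {a : (ι → ℝ) → V →L[ℝ] V →L[ℝ] ℝ} {b : (ι → ℝ) → V →L[ℝ] P →L[ℝ] ℝ}
    {m : (ι → ℝ) → V →L[ℝ] V →L[ℝ] V →L[ℝ] ℝ} {φ : (ι → ℝ) → V →L[ℝ] ℝ}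
    {ψ : (ι → ℝ) → P →L[ℝ] ℝ} {δ α β γ μ ca cb cm cφ cψ : ℝ} {R : ι → ℝ}
    (hU : IsParamDomain U) (hδ : 1 ≤ δ) (hR : ∀ j, 0 < R j) (hμ : 0 ≤ μ)
    (hα : 2 * μ * γ < α) (hβ : 0 < β) (hca : 0 ≤ ca)
    (has : PartialSmoothOn U a) (hbs : PartialSmoothOn U b) (hms : PartialSmoothOn U m)
    (hφs : PartialSmoothOn U φ) (hψs : PartialSmoothOn U ψ)
    (hab : GevreyBound δ ca R U U a) (hbb : GevreyBound δ cb R U U b)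
    (hmb : GevreyBound δ cm R U U m) (hφb : GevreyBound δ cφ R U U φ)
    (hψb : GevreyBound δ cψ R U U ψ)
    (ha : ∀ y ∈ U, ∀ u, α * ‖u‖ ^ 2 ≤ a y u u)
    (hb : ∀ y ∈ U, ∀ p, β * ‖p‖ ≤ ‖(b y).flip p‖)
    (hm : ∀ y ∈ U, ∀ u v w, |m y u v w| ≤ μ * ‖u‖ * ‖v‖ * ‖w‖) :
    ∃ C > 0, ∃ R' : ι → ℝ, (∀ j, 0 < R' j) ∧
      ∀ (u : (ι → ℝ) → V) (p : (ι → ℝ) → P), (∀ y ∈ U, ‖u y‖ ≤ γ) →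
        (∀ y ∈ U, a y (u y) + m y (u y) (u y) - (b y).flip (p y) = φ y) →
        (∀ y ∈ U, b y (u y) = ψ y) →
        PartialSmoothOn U u ∧ PartialSmoothOn U p ∧
        GevreyBound δ C R' U U u ∧ GevreyBound δ C R' U U p := by
  let L : (ι → ℝ) → V × P →L[ℝ] (V →L[ℝ] ℝ) × (P →L[ℝ] ℝ) :=
    fun y => mixedLinA V P (a y) + mixedLinB V P (b y)
  let Q : (ι → ℝ) → V × P →L[ℝ] V × P →L[ℝ] (V →L[ℝ] ℝ) × (P →L[ℝ] ℝ) :=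
    fun y => mixedQuad V P (m y)
  let F : (ι → ℝ) → (V →L[ℝ] ℝ) × (P →L[ℝ] ℝ) := fun y =>
    ContinuousLinearMap.inl ℝ (V →L[ℝ] ℝ) (P →L[ℝ] ℝ) (φ y) +
      ContinuousLinearMap.inr ℝ (V →L[ℝ] ℝ) (P →L[ℝ] ℝ) (ψ y)
  have hLs : PartialSmoothOn U L := (has.clm hU (mixedLinA V P)).add hU (hbs.clm hU (mixedLinB V P))
  have hQs : PartialSmoothOn U Q := hms.clm hU (mixedQuad V P)
  have hFs : PartialSmoothOn U F :=
    (hφs.clm hU (ContinuousLinearMap.inl ℝ (V →L[ℝ] ℝ) (P →L[ℝ] ℝ))).add hU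
      (hψs.clm hU (ContinuousLinearMap.inr ℝ (V →L[ℝ] ℝ) (P →L[ℝ] ℝ)))
  obtain ⟨cL, hLb⟩ : ∃ c, GevreyBound δ c R U U L :=
    ⟨_, (hab.clm hU hR has (mixedLinA V P)).add hU hR (has.clm hU (mixedLinA V P))
      (hbs.clm hU (mixedLinB V P)) (hbb.clm hU hR hbs (mixedLinB V P))⟩
  obtain ⟨cQ, hQb⟩ : ∃ c, GevreyBound δ c R U U Q := ⟨_, hmb.clm hU hR hms (mixedQuad V P)⟩
  obtain ⟨cF, hFb⟩ : ∃ c, GevreyBound δ c R U U F :=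
    ⟨_, (hφb.clm hU hR hφs (ContinuousLinearMap.inl ℝ (V →L[ℝ] ℝ) (P →L[ℝ] ℝ))).add hU hR
      (hφs.clm hU (ContinuousLinearMap.inl ℝ (V →L[ℝ] ℝ) (P →L[ℝ] ℝ)))
      (hψs.clm hU (ContinuousLinearMap.inr ℝ (V →L[ℝ] ℝ) (P →L[ℝ] ℝ)))
      (hψb.clm hU hR hψs (ContinuousLinearMap.inr ℝ (V →L[ℝ] ℝ) (P →L[ℝ] ℝ)))⟩
  obtain ⟨C, hC, R', hR', key⟩ := StableQuadraticFamily.exists_gevreyBound (X := V × P)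
    (Y := (V →L[ℝ] ℝ) × (P →L[ℝ] ℝ)) hU hδ hR
    (abs_nonneg (mixedConst (α - 2 * μ * γ) β (ca + 2 * μ * γ)))
    (c := |cL| + |cQ| + |cF|) (by positivity)
    (K₀ := |γ + (ca * γ + μ * γ * γ + cφ) / β|) (abs_nonneg _)
  refine ⟨C, hC, R', hR', fun u p hu hsol1 hsol2 => ?_⟩
  have hF : ∀ y, F y = (φ y, ψ y) := fun y => by
    change (φ y, (0 : P →L[ℝ] ℝ)) + ((0 : V →L[ℝ] ℝ), ψ y) = _
    rw [Prod.mk_add_mk, add_zero, zero_add]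
  have hstab' := stableQuadraticFamily_mixed (L := L) (Q := Q) (F := F) (a := a) (b := b) (m := m)
    (u := u) (p := p) hμ hα hβ (fun y => rfl) (fun y => rfl) hLs hQs hFs ha
    (fun y hy => hab.norm_le hy) hb hm hu
    (fun y hy => (hsol1 y hy).trans (by rw [hF])) (fun y hy => (hsol2 y hy).trans (by rw [hF]))
  have hstab : StableQuadraticFamily U L Q F |mixedConst (α - 2 * μ * γ) β (ca + 2 * μ * γ)|
      (fun y => (u y, p y)) :=
    { hstab' with
      norm_le := fun y hy y' hy' w => (hstab'.norm_le y hy y' hy' w).trans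
        (mul_le_mul_of_nonneg_right (le_abs_self _) (norm_nonneg _)) }
  obtain ⟨hs, hb⟩ := key L Q F _ hstab
    (hLb.mono_const hR (by linarith [le_abs_self cL, abs_nonneg cQ, abs_nonneg cF]))
    (hQb.mono_const hR (by linarith [le_abs_self cQ, abs_nonneg cL, abs_nonneg cF]))
    (hFb.mono_const hR (by linarith [le_abs_self cF, abs_nonneg cL, abs_nonneg cQ]))
    (fun y hy => (norm_prodMk_le_of_mixed hβ hμ hca (hab.norm_le hy) (hb y hy) (hm y hy)
      (hφb.norm_le hy) (hu y hy) (hsol1 y hy)).trans (le_abs_self _))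
  exact ⟨(hs.of_prodMk hU).1, (hs.of_prodMk hU).2, hb.of_prodMk hU hR' hC.le hs⟩

end MixedGevrey

/-! ### The parametric Navier–Stokes problem -/

section NavierStokes

set_option maxSynthPendingDepth 6

theorem NSConstants.sqrt_arg_pos {K : NSConstants} (h : K.SmallData) :
    0 < 1 - K.mbar / K.α * (K.fbar / K.α + K.gbar / K.β) := by
  have h1 := K.α_pos
  have h2 := K.mbar_pos
  have h3 : K.mbar / K.α * (K.fbar / K.α + K.gbar / K.β) < K.mbar / K.α * (K.α / K.mbar) :=
    mul_lt_mul_of_pos_left h (by positivity)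
  rw [div_mul_div_cancel₀ h1.ne', div_self h2.ne'] at h3
  linarith

theorem NSConstants.mbar_mul_γ_lt {K : NSConstants} (h : K.SmallData) : K.mbar * K.γ < K.α := by
  have h1 := K.α_pos
  have h2 := K.mbar_pos
  have h3 := Real.sqrt_pos.2 (K.sqrt_arg_pos h)
  rw [NSConstants.γ, ← mul_assoc, mul_div_cancel₀ _ h2.ne']
  nlinarith

/-- `γ` is the smaller root of the quadratic equation of the fixed-point estimate. -/
theorem NSConstants.γ_eq {K : NSConstants} (h : K.SmallData) :
    K.gbar / (2 * K.β) + (K.fbar / 2 + K.mbar / 2 * K.γ ^ 2) / K.α = K.γ := by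
  have h1 := K.α_pos
  have h2 := K.mbar_pos
  have h4 := K.β_pos
  have h3 := Real.sq_sqrt (K.sqrt_arg_pos h).le
  rw [NSConstants.γ]
  set s := Real.sqrt (1 - K.mbar / K.α * (K.fbar / K.α + K.gbar / K.β))
  have h5 : K.fbar / K.α + K.gbar / K.β = (1 - s ^ 2) * (K.α / K.mbar) := by
    rw [h3]
    field_simp
    ring
  have h6 : K.gbar / (2 * K.β) + (K.fbar / 2 + K.mbar / 2 * (K.α / K.mbar * (1 - s)) ^ 2) / K.α =
      (K.fbar / K.α + K.gbar / K.β) / 2 + K.mbar / 2 * (K.α / K.mbar * (1 - s)) ^ 2 / K.α := by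
    field_simp
    ring
  rw [h6, h5]
  field_simp
  ring

variable {d : ℕ} {D : PhysDomain d} {c : GradConvention} {C₄ : ℝ}

/-- The inf-sup condition in the form used for saddle point problems. -/
theorem UniformInfSup.le_norm_flip {ι : Type*} {β : ℝ} {U : Set (ι → ℝ)} {B : (ι → ℝ) → MatField D}
    (h : UniformInfSup β U B) {y : ι → ℝ} (hy : y ∈ U) (p : L20 D) :
    β * ‖p‖ ≤ ‖(formBCLM D (B y)).flip p‖ := by
  rcases eq_or_ne p 0 with rfl | hp
  · simp
  have hp0 : 0 < ‖p‖ := norm_pos_iff.2 hp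
  rw [← le_div_iff₀ hp0]
  refine (h y hy p hp).trans (Real.iSup_le (fun u => ?_) (by positivity))
  have hu : 0 < ‖(u : H10 D d)‖ := norm_pos_iff.2 u.2
  rw [← formBCLM_apply, div_le_div_iff₀ (by positivity) hp0]
  have h1 := (le_abs_self _).trans (((formBCLM D (B y)).flip p).le_opNorm (u : H10 D d))
  rw [ContinuousLinearMap.flip_apply] at h1
  calc formBCLM D (B y) u p * ‖p‖ ≤ (‖(formBCLM D (B y)).flip p‖ * ‖(u : H10 D d)‖) * ‖p‖ := by
        gcongr
    _ = _ := by ring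

/-- The variational problem as an equation between functionals. -/
theorem isNSSolution_iff (hC : IsL4EmbeddingConst D C₄) {A B M : MatField D}
    {f : StrongDual ℝ (H10 D d)} {g : L20 D} {u : H10 D d} {p : L20 D} :
    IsNSSolution c A B M f g u p ↔
      formACLM c D A u + formMCLM hC M u u - (formBCLM D B).flip p = f ∧
        formBCLM D B u = innerCLM (L20 D) g := by
  refine and_congr ⟨fun h => ?_, fun h v => ?_⟩ ⟨fun h => ?_, fun h q => ?_⟩
  · ext v
    rw [← h v, ← formACLM_apply, ← formMCLM_apply hC, ← formBCLM_apply]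
    rfl
  · rw [← h, ← formACLM_apply, ← formMCLM_apply hC, ← formBCLM_apply]
    rfl
  · ext q
    rw [formBCLM_apply, h q]
    rfl
  · rw [← formBCLM_apply, h]
    rfl

theorem abs_formMCLM_le_of_norm_le (hC : IsL4EmbeddingConst D C₄) {M : MatField D} {μ : ℝ}
    (hM : ‖M‖ ≤ (C₄ ^ 2)⁻¹ * μ) (u v w : H10 D d) :
    |formMCLM hC M u v w| ≤ μ * ‖u‖ * ‖v‖ * ‖w‖ := by
  have hC0 := hC.1
  refine (abs_formMCLM_le hC M u v w).trans ?_
  gcongr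
  rwa [← le_inv_mul_iff₀ (by positivity)]

variable {ι : Type*} [DecidableEq ι] {U : Set (ι → ℝ)} {K : NSConstants} {δ : ℝ} {R : ι → ℝ}
  {A B M : (ι → ℝ) → MatField D} {f : (ι → ℝ) → StrongDual ℝ (H10 D d)} {g : (ι → ℝ) → L20 D}

theorem isSmallSolution_unique (hC : IsL4EmbeddingConst D C₄)
    (hcoer : UniformlyCoercive c K.α U A) (hinfsup : UniformInfSup K.β U B)
    (hsmall : K.SmallData) (hdata : GevreyData K C₄ δ R U A B M f g) {y : ι → ℝ} (hy : y ∈ U)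
    {u u' : H10 D d} {p p' : L20 D}
    (h : IsSmallSolution K c (A y) (B y) (M y) (f y) (g y) u p)
    (h' : IsSmallSolution K c (A y) (B y) (M y) (f y) (g y) u' p') : u = u' ∧ p = p' := by
  obtain ⟨h1, h2⟩ := (isNSSolution_iff hC).1 h.1
  obtain ⟨h1', h2'⟩ := (isNSSolution_iff hC).1 h'.1
  have hmb := K.mbar_pos
  exact mixedProblem_unique (μ := K.mbar / 2) (α := K.α) (γ := K.γ) (by positivity)
    (by linarith [K.mbar_mul_γ_lt hsmall]) K.β_pos
    (fun u => by rw [formACLM_apply]; exact hcoer y hy u) (hinfsup.le_norm_flip hy)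
    (abs_formMCLM_le_of_norm_le hC (hdata.boundM.norm_le hy)) h.2 h'.2 h1 h2 h1' h2'

theorem exists_isSmallSolution (hC : IsL4EmbeddingConst D C₄)
    (hcoer : UniformlyCoercive c K.α U A) (hinfsup : UniformInfSup K.β U B)
    (hsmall : K.SmallData) (hdata : GevreyData K C₄ δ R U A B M f g) {y : ι → ℝ} (hy : y ∈ U)
    {w : H10 D d} (hw : IsOrthLift c (A y) (B y) (g y) w) (hws : ‖w‖ ≤ K.gbar / (2 * K.β)) :
    ∃ u p, IsSmallSolution K c (A y) (B y) (M y) (f y) (g y) u p := by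
  have hmb := K.mbar_pos
  have hα := K.α_pos
  have hf := hdata.boundf.norm_le hy
  have hsize : ‖w‖ + (‖f y‖ + K.mbar / 2 * K.γ ^ 2) / K.α ≤ K.γ := by
    conv_rhs => rw [← K.γ_eq hsmall]
    gcongr
  have hγ : 0 ≤ K.γ := le_trans (by positivity) hsize
  obtain ⟨u, p, h1, h2, h3⟩ := exists_mixedProblem_solution (a := formACLM c D (A y))
    (b := formBCLM D (B y)) (m := formMCLM hC (M y)) (φ := f y) (ψ := innerCLM (L20 D) (g y))
    (μ := K.mbar / 2) (by positivity) hγ hα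
    (by linarith [K.mbar_mul_γ_lt hsmall]) K.β_pos
    (fun u => by rw [formACLM_apply]; exact hcoer y hy u) (hinfsup.le_norm_flip hy)
    (abs_formMCLM_le_of_norm_le hC (hdata.boundM.norm_le hy)) (w := w)
    (by ext q; rw [formBCLM_apply, hw.1 q]; rfl)
    (fun v hv => by
      rw [formACLM_apply]
      refine hw.2 v fun q => ?_
      rw [← formBCLM_apply, hv, zero_apply])
    hsize
  exact ⟨u, p, (isNSSolution_iff hC).2 ⟨h1, h2⟩, h3⟩

theorem exists_gevreyBound_solution (hC : IsL4EmbeddingConst D C₄) (hU : IsParamDomain U)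
    (hδ : 1 ≤ δ) (hR : ∀ j, 0 < R j) (hcoer : UniformlyCoercive c K.α U A)
    (hinfsup : UniformInfSup K.β U B) (hsmall : K.SmallData)
    (hdata : GevreyData K C₄ δ R U A B M f g) :
    ∃ C > 0, ∃ R' : ι → ℝ, (∀ j, 0 < R' j) ∧
      ∀ (u : (ι → ℝ) → H10 D d) (p : (ι → ℝ) → L20 D),
        (∀ y ∈ U, IsSmallSolution K c (A y) (B y) (M y) (f y) (g y) (u y) (p y)) →
        PartialSmoothOn U u ∧ PartialSmoothOn U p ∧
        GevreyBound δ C R' U U u ∧ GevreyBound δ C R' U U p := by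
  have hmb := K.mbar_pos
  have hca := K.abar_pos
  have hR2 : ∀ j, 0 < 2 * R j := fun j => mul_pos two_pos (hR j)
  obtain ⟨C, hC0, R', hR', h⟩ := exists_gevreyBound_mixed (V := H10 D d) (P := L20 D)
    (a := fun y => formACLM c D (A y)) (b := fun y => formBCLM D (B y))
    (m := fun y => formMCLM hC (M y)) (φ := f) (ψ := fun y => innerCLM (L20 D) (g y))
    (α := K.α) (β := K.β) (μ := K.mbar / 2) (γ := K.γ) hU hδ hR2 (by positivity)
    (by linarith [K.mbar_mul_γ_lt hsmall]) K.β_pos (by positivity)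
    (hdata.smoothA.clm hU (formACLM c D)) (hdata.smoothB.clm hU (formBCLM D))
    (hdata.smoothM.clm hU (formMCLM hC)) hdata.smoothf (hdata.smoothg.clm hU (innerCLM (L20 D)))
    (hdata.boundA.clm hU hR2 hdata.smoothA (formACLM c D))
    (hdata.boundB.clm hU hR2 hdata.smoothB (formBCLM D))
    (hdata.boundM.clm hU hR2 hdata.smoothM (formMCLM hC)) hdata.boundf
    (hdata.boundg.clm hU hR2 hdata.smoothg (innerCLM (L20 D)))
    (fun y hy u => by rw [formACLM_apply]; exact hcoer y hy u)
    (fun y hy => hinfsup.le_norm_flip hy)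
    (fun y hy => abs_formMCLM_le_of_norm_le hC (hdata.boundM.norm_le hy))
  exact ⟨C, hC0, R', hR', fun u p hup => h u p (fun y hy => (hup y hy).2)
    (fun y hy => ((isNSSolution_iff hC).1 (hup y hy).1).1)
    fun y hy => ((isNSSolution_iff hC).1 (hup y hy).1).2⟩

end NavierStokes

/-! ### Analyticity in finitely many parameters -/

section Analyticity

variable {ι : Type*} [DecidableEq ι] {U : Set (ι → ℝ)}
  {E : Type*} [NormedAddCommGroup E] [NormedSpace ℝ E]

theorem PartialSmoothOn.hasDerivAt_update [Fintype ι] (hUo : IsOpen U) {f : (ι → ℝ) → E}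
    (hf : PartialSmoothOn U f) {z : ι → ℝ} {j : ι} {t : ℝ} (hz : Function.update z j t ∈ U) :
    HasDerivAt (fun s => f (Function.update z j s))
      (_root_.partialOn U j f (Function.update z j t)) t := by
  have h := (hf.partiallyDifferentiableOn j).hasPartialOn hz
  have hc : Continuous fun s : ℝ => Function.update z j s := continuous_const.update j continuous_id
  simp only [HasPartialOn, coordSection, Function.update_idem, Function.update_self] at h
  exact h.hasDerivAt ((hUo.preimage hc).mem_nhds hz)

/-- Continuity of the partial derivatives implies total differentiability. -/
theorem PartialSmoothOn.hasFDerivAt [Fintype ι] (hUo : IsOpen U) {f : (ι → ℝ) → E}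
    (hf : PartialSmoothOn U f) {y : ι → ℝ} (hy : y ∈ U) :
    HasFDerivAt f (∑ j, (ContinuousLinearMap.proj j : (ι → ℝ) →L[ℝ] ℝ).smulRight
      (_root_.partialOn U j f y)) y := by
  rw [hasFDerivAt_iff_isLittleO, Asymptotics.isLittleO_iff]
  intro ε hε
  set ε' := ε / (Fintype.card ι + 1) with hε'
  have hε'0 : 0 < ε' := by positivity
  have hnear : ∀ᶠ z in 𝓝 y, z ∈ U ∧
      ∀ j, ‖_root_.partialOn U j f z - _root_.partialOn U j f y‖ < ε' := by
    refine Filter.Eventually.and (hUo.mem_nhds hy) (eventually_all.2 fun j => ?_)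
    have h := ((hf.partialOn j).continuousOn.continuousAt (hUo.mem_nhds hy)).tendsto
    have h' := (h.sub_const (_root_.partialOn U j f y)).norm
    rw [sub_self, norm_zero] at h'
    exact h'.eventually_lt_const hε'0
  obtain ⟨r, hr, hball⟩ := Metric.eventually_nhds_iff_ball.1 hnear
  filter_upwards [Metric.ball_mem_nhds y hr] with z hz
  have hzj : ∀ j, |z j - y j| < r := fun j =>
    (norm_le_pi_norm (z - y) j).trans_lt (mem_ball_iff_norm.1 hz)
  -- change the coordinates of `y` into those of `z` one at a time
  have key : ∀ S : Finset ι,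
      ‖f (S.piecewise z y) - f y - ∑ j ∈ S, (z j - y j) • _root_.partialOn U j f y‖
      ≤ ε' * ∑ j ∈ S, |z j - y j| := by
    intro S
    induction S using Finset.induction_on with
    | empty => simp
    | insert j S hj ih =>
      set w := S.piecewise z y with hw
      have hwj : w j = y j := by simp [hw, hj]
      have hmem : ∀ t ∈ segment ℝ (y j) (z j), Function.update w j t ∈ Metric.ball y r := by
        intro t ht
        rw [mem_ball_iff_norm, pi_norm_lt_iff hr]
        intro i
        rw [Pi.sub_apply]
        by_cases hij : i = j
        · subst hij
          rw [Function.update_self]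
          refine lt_of_le_of_lt ?_ (hzj i)
          have := norm_sub_le_of_mem_segment ht
          rwa [Real.norm_eq_abs, Real.norm_eq_abs] at this
        · rw [Function.update_of_ne hij, hw]
          by_cases hiS : i ∈ S
          · rw [Finset.piecewise_eq_of_mem _ _ _ hiS]
            exact hzj i
          · rw [Finset.piecewise_eq_of_notMem _ _ _ hiS, sub_self, norm_zero]
            exact hr
      have hmv := (convex_segment (𝕜 := ℝ) (y j) (z j)).norm_image_sub_le_of_norm_hasDerivWithin_le
        (f := fun t => f (Function.update w j t) - t • _root_.partialOn U j f y)
        (f' := fun t => _root_.partialOn U j f (Function.update w j t) -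
          (1 : ℝ) • _root_.partialOn U j f y)
        (C := ε')
        (fun t ht => ((hf.hasDerivAt_update hUo (hball _ (hmem t ht)).1).sub
          ((hasDerivAt_id t).smul_const _)).hasDerivWithinAt)
        (fun t ht => by rw [one_smul]; exact ((hball _ (hmem t ht)).2 j).le)
        (left_mem_segment ℝ _ _) (right_mem_segment ℝ _ _)
      rw [Finset.sum_insert hj, Finset.sum_insert hj, Finset.piecewise_insert, ← hw, mul_add]
      have hupd : Function.update w j (y j) = w := by rw [← hwj, Function.update_eq_self]
      simp only [hupd] at hmv
      refine le_trans (le_of_eq ?_) ((norm_add_le _ _).trans (add_le_add hmv ih))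
      congr 1
      rw [sub_smul]
      abel
  have h1 := key Finset.univ
  rw [Finset.piecewise_univ] at h1
  rw [sum_apply]
  simp only [ContinuousLinearMap.smulRight_apply, ContinuousLinearMap.proj_apply, Pi.sub_apply]
  refine h1.trans ?_
  have h2 : ∑ j, |z j - y j| ≤ Fintype.card ι * ‖z - y‖ := by
    refine (Finset.sum_le_card_nsmul _ _ ‖z - y‖ fun j _ => norm_le_pi_norm (z - y) j).trans ?_
    rw [nsmul_eq_mul, Finset.card_univ]
  calc ε' * ∑ j, |z j - y j| ≤ ε' * ((Fintype.card ι + 1) * ‖z - y‖) := by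
        gcongr
        linarith [norm_nonneg (z - y)]
    _ = ε * ‖z - y‖ := by rw [hε']; field_simp

/-- The `n`-th total derivative of `f`, assembled from the iterated partial derivatives. -/
noncomputable def iterTotalDeriv [Fintype ι] (U : Set (ι → ℝ)) :
    (n : ℕ) → ((ι → ℝ) → E) → (ι → ℝ) → (ι → ℝ) [×n]→L[ℝ] E
  | 0, f, y => ContinuousMultilinearMap.uncurry0 ℝ (ι → ℝ) (f y)
  | n + 1, f, y => (∑ j, (ContinuousLinearMap.proj j : (ι → ℝ) →L[ℝ] ℝ).smulRight
      (iterTotalDeriv U n (partialOn U j f) y)).uncurryLeft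

theorem iterTotalDeriv_zero_apply [Fintype ι] (f : (ι → ℝ) → E) (y : ι → ℝ)
    (h : Fin 0 → ι → ℝ) : iterTotalDeriv U 0 f y h = f y := rfl

theorem iterTotalDeriv_succ_apply [Fintype ι] (n : ℕ) (f : (ι → ℝ) → E) (y h : ι → ℝ) :
    iterTotalDeriv U (n + 1) f y (fun _ => h) =
      ∑ j, h j • iterTotalDeriv U n (partialOn U j f) y fun _ => h := by
  rw [iterTotalDeriv, ContinuousLinearMap.uncurryLeft_apply, sum_apply, sum_apply]
  rfl

theorem norm_iterTotalDeriv_le [Fintype ι] {R : ι → ℝ} (hR : ∀ j, 0 < R j) (n : ℕ) {c : ℝ}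
    {f : (ι → ℝ) → E} {y : ι → ℝ}
    (h : ∀ l : List ι, l.length = n → (l.map R).prod * ‖iterPartialOn U f l y‖ ≤ c) :
    ‖iterTotalDeriv U n f y‖ ≤ c * (∑ j, (R j)⁻¹) ^ n := by
  induction n generalizing f c with
  | zero =>
    have h1 := h [] rfl
    rw [iterTotalDeriv, ContinuousMultilinearMap.uncurry0_norm]
    simpa [iterPartialOn] using h1
  | succ n ih =>
    rw [iterTotalDeriv, ContinuousLinearMap.uncurryLeft_norm, pow_succ', ← mul_assoc,
      Finset.mul_sum, Finset.sum_mul]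
    have key : ∀ j, ‖(ContinuousLinearMap.proj j : (ι → ℝ) →L[ℝ] ℝ).smulRight
        (iterTotalDeriv U n (partialOn U j f) y)‖ ≤ c * (R j)⁻¹ * (∑ j, (R j)⁻¹) ^ n := fun j => by
      rw [ContinuousLinearMap.norm_smulRight_apply]
      have h1 : ‖(ContinuousLinearMap.proj j : (ι → ℝ) →L[ℝ] ℝ)‖ ≤ 1 :=
        ContinuousLinearMap.opNorm_le_bound _ zero_le_one fun v => by
          rw [one_mul]
          exact norm_le_pi_norm v j
      refine (mul_le_of_le_one_left (norm_nonneg _) h1).trans (ih fun l hl => ?_)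
      have h2 := h (l ++ [j]) (by simp [hl])
      rw [iterPartialOn_concat, List.map_append, List.prod_append, List.map_singleton,
        List.prod_singleton] at h2
      rw [← div_eq_mul_inv, le_div_iff₀ (hR j)]
      linarith
    exact norm_sum_le_of_le (E := (ι → ℝ) →L[ℝ] (ι → ℝ) [×n]→L[ℝ] E)
      (f := fun j => (ContinuousLinearMap.proj j : (ι → ℝ) →L[ℝ] ℝ).smulRight
        (iterTotalDeriv U n (partialOn U j f) y)) Finset.univ fun j _ => key j

theorem PartialSmoothOn.hasDerivAt_iterTotalDeriv [Fintype ι] (hUo : IsOpen U) {f : (ι → ℝ) → E}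
    (hf : PartialSmoothOn U f) (y h : ι → ℝ) (n : ℕ) {t : ℝ} (ht : y + t • h ∈ U) :
    HasDerivAt (fun t : ℝ => iterTotalDeriv U n f (y + t • h) fun _ => h)
      (iterTotalDeriv U (n + 1) f (y + t • h) fun _ => h) t := by
  induction n generalizing f with
  | zero =>
    simp only [iterTotalDeriv_succ_apply, iterTotalDeriv_zero_apply]
    have h1 : HasDerivAt (fun t : ℝ => y + t • h) h t := by
      simpa using ((hasDerivAt_id t).smul_const h).const_add y
    have h2 := (hf.hasFDerivAt hUo ht).comp_hasDerivAt t h1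
    simpa [Function.comp_def] using h2
  | succ n ih =>
    have e : (fun t : ℝ => iterTotalDeriv U (n + 1) f (y + t • h) fun _ => h) = fun t : ℝ =>
        ∑ j, h j • iterTotalDeriv U n (_root_.partialOn U j f) (y + t • h) fun _ => h :=
      funext fun t => iterTotalDeriv_succ_apply n f _ h
    rw [iterTotalDeriv_succ_apply, e]
    exact HasDerivAt.fun_sum fun j _ => (ih (hf.partialOn j)).fun_const_smul (h j)

/-- Derivative of Taylor's polynomial for the point `1` as a function of the base point: the sum
telescopes. -/
theorem hasDerivAt_taylorSum {φ : ℕ → ℝ → E} {t : ℝ}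
    (h : ∀ n, HasDerivAt (φ n) (φ (n + 1) t) t) (n : ℕ) :
    HasDerivAt (fun s : ℝ => ∑ k ∈ Finset.range (n + 1), ((1 - s) ^ k / k.factorial) • φ k s)
      (((1 - t) ^ n / n.factorial) • φ (n + 1) t) t := by
  induction n with
  | zero => simpa using h 0
  | succ n ih =>
    simp only [Finset.sum_range_succ _ (n + 1)]
    have h1 : HasDerivAt (fun s : ℝ => (1 - s) ^ (n + 1) / ((n + 1).factorial : ℝ))
        (-((1 - t) ^ n / n.factorial)) t := by
      have h2 := (((hasDerivAt_id t).const_sub 1).pow (n + 1)).div_const ((n + 1).factorial : ℝ)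
      refine h2.congr_deriv ?_
      rw [Nat.factorial_succ]
      push_cast
      field_simp
      simp
    refine (ih.add (h1.smul (h (n + 1)))).congr_deriv ?_
    rw [neg_smul]
    abel

/-- Bounds of Gevrey order one make Taylor's series converge to the function, around each
point of `U` in the ball of radius `min r (1 / (2(S + 1)))`, where `S = ∑ⱼ Rⱼ⁻¹` and the ball of
radius `r` lies in `U`. -/
theorem GevreyBound.analyticOnNhd [CompleteSpace E] [Fintype ι] (hUo : IsOpen U)
    {f : (ι → ℝ) → E} (hf : PartialSmoothOn U f) {C : ℝ} {R : ι → ℝ} (hR : ∀ j, 0 < R j)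
    (hb : GevreyBound 1 C R U U f) : AnalyticOnNhd ℝ f U := by
  intro y hy
  set S := ∑ j, (R j)⁻¹ with hS
  have hS0 : 0 ≤ S := Finset.sum_nonneg fun j _ => (inv_pos.2 (hR j)).le
  have hC : 0 ≤ C := (norm_nonneg _).trans (hb.norm_le hy)
  have hbn : ∀ n, ∀ z ∈ U, ‖iterTotalDeriv U n f z‖ ≤ C * n.factorial * S ^ n := by
    intro n z hz
    refine norm_iterTotalDeriv_le hR n fun l hl => ?_
    have h1 := (gevreyBound_iff hR).1 hb n l (Nat.zero_le _) hl.le z hz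
    simpa only [hl, Real.rpow_one] using h1
  obtain ⟨r, hr, hball⟩ := Metric.isOpen_iff.1 hUo y hy
  -- the radius is chosen to make the ratio `S ‖h‖` of the majorising geometric series at most `1/2`
  set ρ : NNReal := ⟨min r (1 / (2 * (S + 1))), by positivity⟩ with hρ
  have hρ0 : (0 : ℝ) < ρ := lt_min hr (by positivity)
  have hρr : (ρ : ℝ) ≤ r := min_le_left _ _
  have hρS : S * ρ ≤ 1 / 2 := by
    calc S * ρ ≤ S * (1 / (2 * (S + 1))) := by
          gcongr
          exact min_le_right _ _
      _ ≤ 1 / 2 := by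
          rw [mul_one_div, div_le_div_iff₀ (by positivity) two_pos]
          linarith
  set p : FormalMultilinearSeries ℝ (ι → ℝ) E :=
    fun n => ((n.factorial : ℝ)⁻¹) • iterTotalDeriv U n f y with hp
  have hpn : ∀ n, ‖p n‖ ≤ C * S ^ n := by
    intro n
    have hn : (0 : ℝ) < n.factorial := by positivity
    rw [hp, norm_smul, norm_inv, Real.norm_of_nonneg hn.le, inv_mul_le_iff₀ hn]
    exact (hbn n y hy).trans_eq (by ring)
  have hps : HasFPowerSeriesOnBall f p y ρ := by
    refine ⟨?_, by exact_mod_cast hρ0, fun {h} hh => ?_⟩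
    · refine p.le_radius_of_bound C fun n => ?_
      calc ‖p n‖ * (ρ : ℝ) ^ n ≤ C * S ^ n * (ρ : ℝ) ^ n := by gcongr; exact hpn n
        _ = C * (S * ρ) ^ n := by rw [mul_pow, mul_assoc]
        _ ≤ C * 1 := by
            gcongr
            exact pow_le_one₀ (by positivity) (hρS.trans (by norm_num))
        _ = C := mul_one C
    · have hhn : ‖h‖ < ρ := by
        rw [Metric.eball_coe] at hh
        exact mem_ball_zero_iff.1 hh
      set θ := S * ‖h‖ with hθ
      have hθ0 : 0 ≤ θ := by positivity
      have hθ1 : θ ≤ 1 / 2 := (mul_le_mul_of_nonneg_left hhn.le hS0).trans hρS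
      have hmem : ∀ t ∈ Icc (0 : ℝ) 1, y + t • h ∈ U := fun t ht => hball <| by
        rw [mem_ball_iff_norm, add_sub_cancel_left, norm_smul, Real.norm_of_nonneg ht.1]
        exact (mul_le_of_le_one_left (norm_nonneg _) ht.2).trans_lt (hhn.trans_le hρr)
      have hbφ : ∀ n, ∀ t ∈ Icc (0 : ℝ) 1, ‖iterTotalDeriv U n f (y + t • h) fun _ => h‖ ≤
          C * n.factorial * θ ^ n := fun n t ht => by
        refine (ContinuousMultilinearMap.le_opNorm _ _).trans ?_
        rw [Finset.prod_const, Finset.card_univ, Fintype.card_fin, hθ, mul_pow, ← mul_assoc]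
        gcongr
        exact hbn n _ (hmem t ht)
      have hsum : Summable fun n => p n fun _ : Fin n => h := by
        refine Summable.of_norm_bounded (g := fun n => C * θ ^ n)
          ((summable_geometric_of_lt_one hθ0 (by linarith)).mul_left C) fun n => ?_
        refine ((p n).le_opNorm _).trans ?_
        rw [Finset.prod_const, Finset.card_univ, Fintype.card_fin, hθ, mul_pow, ← mul_assoc]
        gcongr
        exact hpn n
      rw [hsum.hasSum_iff_tendsto_nat, ← tendsto_add_atTop_iff_nat 1,
        tendsto_iff_norm_sub_tendsto_zero]
      -- the remainder is estimated through the dependence of Taylor's polynomial on its base point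
      have hlim : Tendsto (fun n : ℕ => C * (((n + 1 : ℕ) : ℝ) * θ ^ (n + 1))) atTop (𝓝 0) := by
        have h1 := (tendsto_self_mul_const_pow_of_lt_one hθ0 (by linarith : θ < 1)).comp
          (tendsto_add_atTop_nat 1)
        simpa using h1.const_mul C
      refine squeeze_zero (fun _ => norm_nonneg _) (fun n => ?_) hlim
      have h1 := norm_image_sub_le_of_norm_deriv_le_segment_01'
        (C := C * (((n + 1 : ℕ) : ℝ) * θ ^ (n + 1)))
        (fun t ht => (hasDerivAt_taylorSum
          (φ := fun n t => iterTotalDeriv U n f (y + t • h) fun _ => h)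
          (fun k => hf.hasDerivAt_iterTotalDeriv hUo y h k (hmem t ht)) n).hasDerivWithinAt)
        (fun t ht => by
          have ht' : t ∈ Icc (0 : ℝ) 1 := ⟨ht.1, ht.2.le⟩
          have h2 : 0 ≤ 1 - t := by linarith [ht.2]
          rw [norm_smul, Real.norm_of_nonneg (by positivity)]
          have h3 : (1 - t) ^ n ≤ 1 := pow_le_one₀ h2 (by linarith [ht.1])
          calc (1 - t) ^ n / n.factorial * ‖iterTotalDeriv U (n + 1) f (y + t • h) fun _ => h‖
              ≤ 1 / n.factorial * (C * (n + 1).factorial * θ ^ (n + 1)) := by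
                gcongr
                exact hbφ _ t ht'
            _ = C * (((n + 1 : ℕ) : ℝ) * θ ^ (n + 1)) := by
                rw [Nat.factorial_succ]
                push_cast
                field_simp)
      refine le_trans (le_of_eq ?_) h1
      rw [← norm_neg, neg_sub]
      congr 2
      · simp only [Finset.sum_range_succ' _ n]
        simp [iterTotalDeriv_zero_apply]
      · refine Finset.sum_congr rfl fun k _ => ?_
        simp [hp]
  exact hps.analyticAt

end Analyticity

/-! ### Well-posedness and parametric regularity -/

theorem mainTheorem1 {d : ℕ} (D : PhysDomain d) (c : GradConvention) (C₄ : ℝ)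
    (hC₄ : IsL4EmbeddingConst D C₄)
    {ι : Type*} [DecidableEq ι] (U : Set (ι → ℝ)) (hU : IsParamDomain U)
    (K : NSConstants) (δ : ℝ) (hδ : 1 ≤ δ) (R : ι → ℝ) (hR : ∀ j, 0 < R j)
    (A B M : (ι → ℝ) → MatField D) (f : (ι → ℝ) → StrongDual ℝ (H10 D d))
    (g : (ι → ℝ) → L20 D)
    (hABM : CoeffAdmissible U A B M)
    (hcoer : UniformlyCoercive c K.α U A) (hinfsup : UniformInfSup K.β U B)
    (hsmall : K.SmallData) (hdata : GevreyData K C₄ δ R U A B M f g) :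
    (∀ y ∈ U, ∀ u p u' p', IsSmallSolution K c (A y) (B y) (M y) (f y) (g y) u p →
      IsSmallSolution K c (A y) (B y) (M y) (f y) (g y) u' p' → u = u' ∧ p = p') ∧
    (∀ y ∈ U, (∃ w, IsOrthLift c (A y) (B y) (g y) w ∧ ‖w‖ ≤ K.gbar / (2 * K.β)) →
      ∃ u p, IsSmallSolution K c (A y) (B y) (M y) (f y) (g y) u p) ∧
    ∃ Cu > 0, ∃ Cp > 0, ∃ R' : ι → ℝ, (∀ j, 0 < R' j) ∧
      ∀ (u : (ι → ℝ) → H10 D d) (p : (ι → ℝ) → L20 D),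
        (∀ y ∈ U, IsSmallSolution K c (A y) (B y) (M y) (f y) (g y) (u y) (p y)) →
        GevreyClass δ U u ∧ GevreyClass δ U p ∧
        GevreyBound δ Cu R' U U u ∧ GevreyBound δ Cp R' U U p ∧
        ∀ [Fintype ι], δ = 1 → IsOpen U → AnalyticOnNhd ℝ u U ∧ AnalyticOnNhd ℝ p U := by
  refine ⟨fun y hy u p u' p' h h' => isSmallSolution_unique hC₄ hcoer hinfsup hsmall hdata hy h h',
    fun y hy ⟨w, hw, hws⟩ => exists_isSmallSolution hC₄ hcoer hinfsup hsmall hdata hy hw hws, ?_⟩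
  obtain ⟨C, hC, R', hR', h⟩ :=
    exists_gevreyBound_solution (f := f) (g := g) hC₄ hU hδ hR hcoer hinfsup hsmall hdata
  refine ⟨C, hC, C, hC, R', hR', fun u p hup => ?_⟩
  obtain ⟨hu, hp, hub, hpb⟩ := h u p hup
  refine ⟨hub.gevreyClass hC hR' hu, hpb.gevreyClass hC hR' hp, hub, hpb, ?_⟩
  intro _ hδ1 hUo
  subst hδ1
  exact ⟨hub.analyticOnNhd hUo hu hR', hpb.analyticOnNhd hUo hp hR'⟩
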